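/- Let $T>0$, $0=\alpha_0<\alpha_1<\dots<\alpha_n=1$, and consider the Volterra equation of the first kind $$\int_0^t K(t,s)\,x(s)\,ds=f(t),\qquad 0<t\le T, \tag{1}$$ where $K(t,s)=K_i(t,s)$ for $\alpha_{i-1}t\le s<\alpha_i t$ ($i=1,\dots,n$; for $i=n$ also $s=t$). Assume that $f\in C^1[0,T]$, $f(0)=0$, and that on its closed sector $\{0\le t\le T,\ \alpha_{i-1}t\le s\le\alpha_i t\}$ each $K_i$ is continuous with a continuous partial derivative $K_i'=\partial K_i/\partial t$. Let $N\ge 0$ be an integer such that (A) $K_n(t,t)\ne 0$ on $[0,T]$, and for some $q<1$ $$\max_{0\le t\le T}|K_n(t,t)|^{-1}\sum_{i=1}^n\Bigl(\alpha_i^{1+N}|K_i(t,\alpha_i t)|+\alpha_{i-1}^{1+N}|K_i(t,\alpha_{i-1}t)|\Bigr)\le 1+q;$$ (B) $f$ and all $K_i$ are $N+1$ times differentiable near zero (on their domains). For $j\in\mathbb N=\{0,1,2,\dots\}$ put $$L(j)=\sum_{i=1}^nK_i(0,0)\bigl(\alpha_i^{1+j}-\alpha_{i-1}^{1+j}\bigr),$$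 $$P_j(\lambda)=K_n(0,0)+\sum_{i=1}^{n-1}\alpha_i^{1+j}\bigl(K_i(0,0)-K_{i+1}(0,0)\bigr)\lambda^{\ln\alpha_i}\quad(\lambda>0).$$ Suppose that $L(j)=0$ has exactly $k$ roots $j_1,\dots,j_k$ in $\mathbb N$, and let $r_m$ be the multiplicity of $\lambda=1$ as a root of $P_{j_m}$. Then equation (1) has a family of solutions, continuous on $(0,T]$, of the form $$x(t)=x^N(t)+t^Nu(t),\qquad x^N(t)=\sum_{i=0}^Nx_i(\ln t)\,t^i,$$ with polynomials $x_i$ and with $u\in C[0,T]$, $u(0)=0$, which depends on exactly $p=r_1+\dots+r_k$ arbitrary real constants: the $r_m$ lowest coefficients of $x_{j_m}$ ($m=1,\dots,k$) can be prescribed arbitrarily, these constants determine all the $x_i$ and $u$, different constants give different solutions, and every solution of this form belongs to the family. If $L(0)\ne0$, these solutions have a finite limit as $t\to+0$. For each choice of the constants let $g(t)=f(t)-\int_0^tK(t,s)x^N(s)\,ds$. Then $g$ is differentiable on $(0,T]$, $g'(t)=o(t^N)$ as $t\to+0$, $u$ is the unique solution in $C[0,T]$ of $\int_0^tK(t,s)s^Nu(s)\,ds=g(t)$,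 $0<t\le T$, and $u$ is obtained by successive approximations: for every initial function $u_0\in C[0,T]$ there is exactly one sequence $(u_m)$ in $C[0,T]$ starting with $u_0$ such that, for $0<t\le T$ and $m\ge0$, $$\frac1{K_n(t,t)}\sum_{i=1}^n\Bigl(\alpha_i^{1+N}K_i(t,\alpha_it)\,u_{m+1}(\alpha_it)-\alpha_{i-1}^{1+N}K_i(t,\alpha_{i-1}t)\,u_{m+1}(\alpha_{i-1}t)\Bigr)$$ $$=-\sum_{i=1}^n\int_{\alpha_{i-1}t}^{\alpha_it}\frac{K_i'(t,s)}{K_n(t,t)}\Bigl(\frac st\Bigr)^Nu_m(s)\,ds+\frac{g'(t)}{t^NK_n(t,t)},$$ and $u_m\to u$ uniformly on $[0,T]$. -/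

import Mathlib

open Set Filter Topology MeasureTheory Polynomial Asymptotics

namespace VolterraDisc

noncomputable section

/-- The closed sector `{(t, s) : 0 ≤ t ≤ T, a t ≤ s ≤ b t}`. -/
def sector (a b T : ℝ) : Set (ℝ × ℝ) :=
  {z | 0 ≤ z.1 ∧ z.1 ≤ T ∧ a * z.1 ≤ z.2 ∧ z.2 ≤ b * z.1}

/-- The piecewise kernel: `K (i+1) t s` on `α i * t ≤ s < α (i+1) * t` for `i + 1 < n`, and
`K n t s` on `α (n-1) * t ≤ s ≤ α n * t`. The pieces are `K 1, …, K n`. -/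
def kernel (n : ℕ) (α : ℕ → ℝ) (K : ℕ → ℝ → ℝ → ℝ) (t s : ℝ) : ℝ :=
  ∑ i ∈ Finset.range n,
    (open Classical in
      if α i * t ≤ s ∧ (s < α (i + 1) * t ∨ (i + 1 = n ∧ s = α (i + 1) * t))
      then K (i + 1) t s else 0)

/-- The integral `∫₀ᵗ K(t,s) x(s) ds`. -/
def volterra (n : ℕ) (α : ℕ → ℝ) (K : ℕ → ℝ → ℝ → ℝ) (x : ℝ → ℝ) (t : ℝ) : ℝ :=
  ∫ s in (0 : ℝ)..t, kernel n α K t s * x s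

/-- `x` is continuous on `(0,T]`, the integral in the equation exists, and
`∫₀ᵗ K(t,s) x(s) ds = f(t)` for `0 < t ≤ T`. -/
structure IsSolution (n : ℕ) (α : ℕ → ℝ) (K : ℕ → ℝ → ℝ → ℝ) (f : ℝ → ℝ) (T : ℝ)
    (x : ℝ → ℝ) : Prop where
  continuousOn : ContinuousOn x (Ioc 0 T)
  integrable : ∀ t ∈ Ioc 0 T, IntervalIntegrable (fun s => kernel n α K t s * x s) volume 0 t
  equation : ∀ t ∈ Ioc 0 T, volterra n α K x t = f t

/-- Each `K i` is continuous on its own closed sector, and `K' i` is its continuous partial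
derivative with respect to the first variable there. -/
structure KernelRegular (n : ℕ) (α : ℕ → ℝ) (K K' : ℕ → ℝ → ℝ → ℝ) (T : ℝ) : Prop where
  cont : ∀ i < n, ContinuousOn (fun z : ℝ × ℝ => K (i + 1) z.1 z.2) (sector (α i) (α (i + 1)) T)
  cont' : ∀ i < n, ContinuousOn (fun z : ℝ × ℝ => K' (i + 1) z.1 z.2) (sector (α i) (α (i + 1)) T)
  hasDeriv : ∀ i < n, ∀ t s, (t, s) ∈ sector (α i) (α (i + 1)) T →
    HasDerivWithinAt (fun τ => K (i + 1) τ s) (K' (i + 1) t s)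
      {τ | (τ, s) ∈ sector (α i) (α (i + 1)) T} t

/-- Condition A. -/
def ConditionA (n : ℕ) (α : ℕ → ℝ) (K : ℕ → ℝ → ℝ → ℝ) (T : ℝ) (N : ℕ) : Prop :=
  (∀ t ∈ Icc 0 T, K n t t ≠ 0) ∧
  ∃ q < (1 : ℝ), ∀ t ∈ Icc 0 T,
    |K n t t|⁻¹ * ∑ i ∈ Finset.range n,
      (α (i + 1) ^ (1 + N) * |K (i + 1) t (α (i + 1) * t)| +
        α i ^ (1 + N) * |K (i + 1) t (α i * t)|) ≤ 1 + q

/-- `F` is `m` times differentiable on `U` (continuity of the `m`-th derivative is not required):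
the iterated derivatives of all orders below `m` are differentiable on `U`. -/
def TimesDifferentiableOn {E F : Type*} [NormedAddCommGroup E] [NormedSpace ℝ E]
    [NormedAddCommGroup F] [NormedSpace ℝ F] (m : ℕ) (g : E → F) (U : Set E) : Prop :=
  ∀ l < m, DifferentiableOn ℝ (iteratedFDerivWithin ℝ l g U) U

/-- Condition B: near zero, `f` and the `K i` are `N + 1` times differentiable, each on its own
domain (`[0,T]`, respectively the closed sector of `K i`). -/
def ConditionB (n : ℕ) (α : ℕ → ℝ) (K : ℕ → ℝ → ℝ → ℝ) (f : ℝ → ℝ) (T : ℝ) (N : ℕ) : Prop :=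
  ∃ δ : ℝ, 0 < δ ∧ δ ≤ T ∧ TimesDifferentiableOn (N + 1) f (Icc 0 δ) ∧
    ∀ i < n, TimesDifferentiableOn (N + 1) (fun z : ℝ × ℝ => K (i + 1) z.1 z.2)
      (sector (α i) (α (i + 1)) δ)

/-- The left-hand side `L(j)` of the characteristic equation. -/
def charL (n : ℕ) (α : ℕ → ℝ) (K : ℕ → ℝ → ℝ → ℝ) (j : ℕ) : ℝ :=
  ∑ i ∈ Finset.range n, K (i + 1) 0 0 * (α (i + 1) ^ (1 + j) - α i ^ (1 + j))

/-- The function `P_j(z) = K_n(0,0) + ∑_{i=1}^{n-1} α_i^{1+j} (K_i(0,0) - K_{i+1}(0,0)) z^{ln α_i}`,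
for real `z > 0`. -/
def auxP (n : ℕ) (α : ℕ → ℝ) (K : ℕ → ℝ → ℝ → ℝ) (j : ℕ) (z : ℝ) : ℝ :=
  K n 0 0 + ∑ i ∈ Finset.Ico 1 n,
    α i ^ (1 + j) * (K i 0 0 - K (i + 1) 0 0) * z ^ Real.log (α i)

/-- The logarithmic-power sum `∑_{i=0}^N x_i(ln t) t^i`. -/
def logPoly (N : ℕ) (x : ℕ → ℝ[X]) (t : ℝ) : ℝ :=
  ∑ i ∈ Finset.range (N + 1), (x i).eval (Real.log t) * t ^ i

/-- `∑_{i=0}^N x_i(ln t) t^i + t^N u(t)`. -/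
def ansatz (N : ℕ) (x : ℕ → ℝ[X]) (u : ℝ → ℝ) (t : ℝ) : ℝ :=
  logPoly N x t + t ^ N * u t

/-- `g(t) = f(t) - ∫₀ᵗ K(t,s) y(s) ds`. -/
def regRhs (n : ℕ) (α : ℕ → ℝ) (K : ℕ → ℝ → ℝ → ℝ) (f : ℝ → ℝ) (y : ℝ → ℝ) (t : ℝ) : ℝ :=
  f t - volterra n α K y t

/-- The functional operator `L` acting on `u`. -/
def opL (n : ℕ) (α : ℕ → ℝ) (K : ℕ → ℝ → ℝ → ℝ) (N : ℕ) (u : ℝ → ℝ) (t : ℝ) : ℝ :=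
  (∑ i ∈ Finset.range n,
    (α (i + 1) ^ (1 + N) * K (i + 1) t (α (i + 1) * t) * u (α (i + 1) * t) -
      α i ^ (1 + N) * K (i + 1) t (α i * t) * u (α i * t))) / K n t t

/-- The integral operator
`∑ᵢ ∫_{α_{i-1} t}^{α_i t} (K_i'(t,s) / K_n(t,t)) (s/t)^N u(s) ds`. -/
def opV (n : ℕ) (α : ℕ → ℝ) (K K' : ℕ → ℝ → ℝ → ℝ) (N : ℕ) (u : ℝ → ℝ) (t : ℝ) : ℝ :=
  ∑ i ∈ Finset.range n,
    ∫ s in (α i * t)..(α (i + 1) * t), K' (i + 1) t s / K n t t * (s / t) ^ N * u s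

/-- `v` is a sequence of successive approximations in `C[0,T]` for the equation
`L u = -V u + g'(t) / (t^N K_n(t,t))`, that is `v_{m+1} = L⁻¹ (-V v_m + g' / (t^N K_n))`. -/
structure IsSuccApprox (n : ℕ) (α : ℕ → ℝ) (K K' : ℕ → ℝ → ℝ → ℝ) (T : ℝ) (N : ℕ) (g' : ℝ → ℝ)
    (v : ℕ → ℝ → ℝ) : Prop where
  cont : ∀ m, ContinuousOn (v m) (Icc 0 T)
  step : ∀ m, ∀ t ∈ Ioc 0 T,
    opL n α K N (v (m + 1)) t = -opV n α K K' N (v m) t + g' t / (t ^ N * K n t t)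

end

end VolterraDisc

open VolterraDisc

/-! Both sides of the equation vanish at zero, so it is equivalent to its derivative: dilated values
`x (α i * t)` with weights taken from the kernel on the rays, plus integrals of `K'`, equal `f'`.
This equation is analysed in two stages.

Formal stage. A dilation `t ↦ c * t` sends `p (log t) * t ^ j` to `c ^ j * p (log t + log c) * t ^
j`. Hence the leading coefficient produced by such a term is `diffOp j p`, a combination of
translates of `p`; all other contributions have order above `j`. By the binomial theorem `diffOp j`
is triangular on monomials, with entries the moments `∑ K_i(0,0) (α_i^{1+j} ln^l α_i - α_{i-1}^{1+j}
ln^l α_{i-1})`. These are the derivatives at `w = 0` of `P_j (e ^ w)`, so the first nonzero moment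
has index equal to the multiplicity `r` of the root `1`. Thus `diffOp j` lowers degree by exactly
`r`: it is onto, and its solutions are parametrised by their `r` lowest coefficients
(`diffOp_existsUnique`). The polynomials `x_j` follow recursively, and the residual `g'` is `o(t ^
N)` exactly when these formal equations hold (`exists_formal_expansion`, `isLittleO_iff_formal`),
because logarithmic-power sums are determined by their asymptotics.

Analytic stage. For the remainder `t ^ N * u` the differentiated equation reads `L u + V u = g' / (t
^ N K_n)`, with a continuous right-hand side vanishing at zero. Condition A says `‖L - I‖ ≤ q < 1`,
and in the norm weighted by `exp (-ω t)` the Volterra operator `V` has norm `O(1 / ω)`. Banach's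
theorem gives existence, a priori estimates give uniqueness, and `L⁻¹ V` contracts, so the
iterations converge.

Condition A also gives `L(j) ≠ 0` for `j ≥ N` (`charL_ne_zero`). Therefore every free constant sits
in a polynomial `x_j` of the ansatz, and `u 0 = 0` is automatic. Conversely, a solution of the
required form with `u 0 = 0` has `g' = o(t ^ N)`, so its polynomials satisfy the formal equations
and it belongs to the family. -/

namespace VolterraDisc

/-! ### Peano expansions without continuity of the top derivative -/

section Peano

variable {E F : Type} [NormedAddCommGroup E] [NormedSpace ℝ E]
  [NormedAddCommGroup F] [NormedSpace ℝ F]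

theorem TimesDifferentiableOn.differentiableOn {M : ℕ} {G : E → F} {U : Set E}
    (h : TimesDifferentiableOn (M + 1) G U) : DifferentiableOn ℝ G U := by
  have h0 := h 0 (Nat.succ_pos M)
  rw [iteratedFDerivWithin_zero_eq_comp] at h0
  exact (LinearIsometryEquiv.comp_differentiableOn_iff _).1 h0

theorem TimesDifferentiableOn.fderivWithin {M : ℕ} {G : E → F} {U : Set E}
    (hU : UniqueDiffOn ℝ U) (h : TimesDifferentiableOn (M + 1) G U) :
    TimesDifferentiableOn M (fderivWithin ℝ G U) U := by
  intro l hl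
  have h1 := h (l + 1) (Nat.succ_lt_succ hl)
  have h2 : DifferentiableOn ℝ ((continuousMultilinearCurryRightEquiv' ℝ l E F).symm ∘
      iteratedFDerivWithin ℝ l (_root_.fderivWithin ℝ G U) U) U :=
    h1.congr fun x hx => (iteratedFDerivWithin_succ_eq_comp_right hU hx).symm
  exact (LinearIsometryEquiv.comp_differentiableOn_iff _).1 h2

/-- `A l` is continuous and homogeneous of degree `l` for every `l`. -/
def IsHomogeneousSeq (A : ℕ → E → F) : Prop :=
  ∀ l, Continuous (A l) ∧ ∀ (c : ℝ) (z : E), A l (c • z) = c ^ l • A l z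

theorem IsHomogeneousSeq.zero_const {A : ℕ → E → F} (hA : IsHomogeneousSeq A) (z : E) :
    A 0 z = A 0 0 := by
  have := (hA 0).2 0 z
  simpa using this.symm

/-- Mean value inequality on the segment from `0` to `z`. It replaces integration of the derivative,
which need not be continuous. -/
theorem norm_radial_le {R : E → F} {R' : E → E →L[ℝ] F} {z : E} {C : ℝ}
    (hR : ∀ c ∈ Icc (0 : ℝ) 1,
      HasDerivWithinAt (fun c : ℝ => R (c • z)) (R' (c • z) z) (Icc 0 1) c)
    (hC : ∀ c ∈ Icc (0 : ℝ) 1, ‖R' (c • z)‖ ≤ C) : ‖R z - R 0‖ ≤ C * ‖z‖ := by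
  have := (convex_Icc (0 : ℝ) 1).norm_image_sub_le_of_norm_hasDerivWithin_le
    (f := fun c : ℝ => R (c • z)) hR (C := C * ‖z‖)
    (fun c hc => (ContinuousLinearMap.le_opNorm _ _).trans
      (mul_le_mul_of_nonneg_right (hC c hc) (norm_nonneg _)))
    (left_mem_Icc.2 zero_le_one) (right_mem_Icc.2 zero_le_one)
  simpa using this

end Peano

/-- Order one is differentiability at the origin. For higher orders the derivative is expanded by
induction, its terms are integrated radially, and the mean value inequality gains one power of `‖z‖`
in the remainder. Only continuity and homogeneity of the terms are used later, so no polynomial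
structure is recorded. -/
theorem exists_homogeneous_expansion {E : Type} [NormedAddCommGroup E] [NormedSpace ℝ E]
    {U : Set E} (hU : UniqueDiffOn ℝ U) (hst : StarConvex ℝ 0 U) (h0 : (0 : E) ∈ U) (M : ℕ) :
    ∀ {F : Type} [NormedAddCommGroup F] [NormedSpace ℝ F] {G : E → F},
      TimesDifferentiableOn (M + 1) G U →
      ∃ A : ℕ → E → F, IsHomogeneousSeq A ∧ A 0 0 = G 0 ∧
        (fun z => G z - ∑ l ∈ Finset.range (M + 2), A l z) =o[𝓝[U] 0] fun z => ‖z‖ ^ (M + 1) := by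
  induction M with
  | zero =>
    intro F _ _ G hG
    have hd := (hG.differentiableOn 0 h0).hasFDerivWithinAt
    refine ⟨fun l z => if l = 0 then G 0 else if l = 1 then fderivWithin ℝ G U 0 z else 0, ?_, ?_, ?_⟩
    · rintro (_ | _ | l)
      · simp [continuous_const]
      · simpa using (fderivWithin ℝ G U 0).continuous
      · simp [continuous_const]
    · simp
    · have := hd.isLittleO
      simp only [sub_zero] at this
      simp only [Finset.sum_range_succ, Finset.range_zero, Finset.sum_empty]
      refine (this.congr_left fun z => ?_).trans_isBigO ?_
      · simp [sub_sub]
      · simpa using (isBigO_refl (fun z : E => z) (𝓝[U] 0)).norm_right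
  | succ M ih =>
    intro F _ _ G hG
    obtain ⟨B, hB, hB0, hBo⟩ := ih (hG.fderivWithin hU)
    -- By homogeneity `∫₀¹ B l (τ z) z dτ = B l z z / (l + 1)`.
    let A : ℕ → E → F := fun l z => Nat.casesOn l (G 0) fun l => ((l : ℝ) + 1)⁻¹ • B l z z
    have hA : IsHomogeneousSeq A := by
      rintro (_ | l)
      · exact ⟨continuous_const, fun c z => by simp [A]⟩
      · refine ⟨((hB l).1.clm_apply continuous_id).const_smul _, fun c z => ?_⟩
        simp only [A]
        rw [(hB l).2, map_smul, _root_.smul_apply, smul_comm, smul_smul, smul_smul, smul_smul]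
        congr 1; ring
    refine ⟨A, hA, rfl, ?_⟩
    rw [isLittleO_iff] at hBo ⊢
    intro c hc
    have hc' := hBo hc
    rw [eventually_nhdsWithin_iff, Metric.eventually_nhds_iff] at hc' ⊢
    obtain ⟨ε, hε, H⟩ := hc'
    refine ⟨ε, hε, fun z hz hzU => ?_⟩
    have hseg : ∀ c ∈ Icc (0 : ℝ) 1, c • z ∈ U := fun c hc => by
      simpa using hst hzU (sub_nonneg.2 hc.2) hc.1 (by ring)
    have key := norm_radial_le (R := fun z => G z - ∑ l ∈ Finset.range (M + 3), A l z)
      (R' := fun z => fderivWithin ℝ G U z - ∑ l ∈ Finset.range (M + 2), B l z)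
      (z := z) (C := c * ‖z‖ ^ (M + 1)) ?_ ?_
    · have hz0 : G 0 - ∑ l ∈ Finset.range (M + 3), A l 0 = 0 := by
        rw [Finset.sum_range_succ']
        simp [A]
      rw [hz0, sub_zero] at key
      refine key.trans_eq ?_
      simp [pow_succ, mul_assoc]
    · intro τ hτ
      have h1 : HasDerivWithinAt (fun τ : ℝ => G (τ • z)) (fderivWithin ℝ G U (τ • z) z)
          (Icc 0 1) τ := by
        have := (hG.differentiableOn _ (hseg τ hτ)).hasFDerivWithinAt
        refine HasFDerivWithinAt.comp_hasDerivWithinAt (t := U) τ this ?_ (fun c hc => hseg c hc)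
        simpa using ((hasDerivAt_id τ).smul_const z).hasDerivWithinAt
      have h2 : HasDerivAt (fun τ : ℝ => ∑ l ∈ Finset.range (M + 3), A l (τ • z))
          (∑ l ∈ Finset.range (M + 2), B l (τ • z) z) τ := by
        have e : (fun τ : ℝ => ∑ l ∈ Finset.range (M + 3), A l (τ • z)) =
            fun τ : ℝ => ∑ l ∈ Finset.range (M + 2), τ ^ (l + 1) • A (l + 1) z + G 0 := by
          ext τ
          rw [Finset.sum_range_succ']
          congr 1
          exact Finset.sum_congr rfl fun l _ => (hA (l + 1)).2 τ z
        rw [e]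
        refine HasDerivAt.add_const _ (HasDerivAt.fun_sum fun l _ => ?_)
        rw [(hB l).2]
        refine ((hasDerivAt_pow (l + 1) τ).smul_const (A (l + 1) z)).congr_deriv ?_
        simp only [A, _root_.smul_apply, smul_smul]
        congr 1
        have : ((l : ℝ) + 1) ≠ 0 := by positivity
        push_cast
        field_simp
      refine (h1.sub h2.hasDerivWithinAt).congr_deriv ?_
      simp
    · intro τ hτ
      have hn : ‖τ • z‖ ≤ ‖z‖ := by
        rw [norm_smul, Real.norm_of_nonneg hτ.1]
        exact mul_le_of_le_one_left (norm_nonneg _) hτ.2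
      refine (H (y := τ • z) ?_ (hseg τ hτ)).trans ?_
      · rw [dist_zero_right] at hz ⊢
        exact hn.trans_lt hz
      · simp only [norm_pow, norm_norm]
        gcongr

/-! ### Geometry of the sectors and expansions of the data at the origin -/

theorem convex_sector (a b T : ℝ) : Convex ℝ (sector a b T) := by
  rintro ⟨t, s⟩ ⟨h1, h2, h3, h4⟩ ⟨t', s'⟩ ⟨h1', h2', h3', h4'⟩ p q hp hq hpq
  simp only [sector, mem_ofPred_eq, Prod.smul_mk, Prod.mk_add_mk, smul_eq_mul] at *
  have hq' : q = 1 - p := by linarith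
  refine ⟨by positivity, ?_, ?_, ?_⟩
  · calc p * t + q * t' ≤ p * T + q * T := by gcongr
      _ = T := by rw [← add_mul, hpq, one_mul]
  · nlinarith [mul_le_mul_of_nonneg_left h3 hp, mul_le_mul_of_nonneg_left h3' hq]
  · nlinarith [mul_le_mul_of_nonneg_left h4 hp, mul_le_mul_of_nonneg_left h4' hq]

theorem sector_mem_nhds {a b T t s : ℝ} (ht : 0 < t) (htT : t < T) (h : a * t < s)
    (h' : s < b * t) : sector a b T ∈ 𝓝 (t, s) := by
  have e1 : ∀ᶠ z : ℝ × ℝ in 𝓝 (t, s), 0 < z.1 :=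
    (isOpen_lt continuous_const continuous_fst).mem_nhds ht
  have e2 : ∀ᶠ z : ℝ × ℝ in 𝓝 (t, s), z.1 < T :=
    (isOpen_lt continuous_fst continuous_const).mem_nhds htT
  have e3 : ∀ᶠ z : ℝ × ℝ in 𝓝 (t, s), a * z.1 < z.2 :=
    (isOpen_lt (continuous_const.mul continuous_fst) continuous_snd).mem_nhds h
  have e4 : ∀ᶠ z : ℝ × ℝ in 𝓝 (t, s), z.2 < b * z.1 :=
    (isOpen_lt continuous_snd (continuous_const.mul continuous_fst)).mem_nhds h'
  filter_upwards [e1, e2, e3, e4] with z h1 h2 h3 h4 using ⟨h1.le, h2.le, h3.le, h4.le⟩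

theorem uniqueDiffOn_sector {a b T : ℝ} (hab : a < b) (hT : 0 < T) :
    UniqueDiffOn ℝ (sector a b T) := by
  refine uniqueDiffOn_convex (convex_sector a b T) ⟨(T / 2, (a + b) / 2 * (T / 2)), ?_⟩
  rw [mem_interior_iff_mem_nhds]
  refine sector_mem_nhds (by positivity) (by linarith) ?_ ?_ <;> gcongr <;> linarith

theorem zero_mem_sector {a b T : ℝ} (hT : 0 ≤ T) : (0 : ℝ × ℝ) ∈ sector a b T := by
  simp [sector, hT]

theorem starConvex_sector {a b T : ℝ} (hT : 0 ≤ T) : StarConvex ℝ 0 (sector a b T) :=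
  (convex_sector a b T).starConvex (zero_mem_sector hT)

theorem isCompact_sector {a b T : ℝ} : IsCompact (sector a b T) := by
  refine Metric.isCompact_of_isClosed_isBounded ?_ ?_
  · have : sector a b T = {z | 0 ≤ z.1} ∩ {z | z.1 ≤ T} ∩ {z | a * z.1 ≤ z.2} ∩
        {z | z.2 ≤ b * z.1} := by
      ext z; simp [sector, and_assoc]
    rw [this]
    refine (((isClosed_le ?_ ?_).inter (isClosed_le ?_ ?_)).inter (isClosed_le ?_ ?_)).inter
      (isClosed_le ?_ ?_) <;> fun_prop
  · refine (Metric.isBounded_closedBall (x := (0 : ℝ × ℝ))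
      (r := max T (|a| * T + |b| * T))).subset ?_
    rintro ⟨t, s⟩ ⟨h1, h2, h3, h4⟩
    simp only at h1 h2 h3 h4
    rw [mem_closedBall_zero_iff, Prod.norm_mk, Real.norm_eq_abs, Real.norm_eq_abs]
    refine max_le_max (by rwa [abs_of_nonneg h1]) ?_
    have ha : |a * t| ≤ |a| * T := by rw [abs_mul, abs_of_nonneg h1]; gcongr
    have hb : |b * t| ≤ |b| * T := by rw [abs_mul, abs_of_nonneg h1]; gcongr
    rw [abs_le] at ha hb ⊢
    constructor <;> linarith [mul_nonneg (abs_nonneg a) (h1.trans h2),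
      mul_nonneg (abs_nonneg b) (h1.trans h2)]

/-- Expansion of a kernel along a ray through the origin. -/
theorem exists_ray_expansion {a b c δ : ℝ} {N : ℕ} {k : ℝ → ℝ → ℝ} (hab : a < b) (hδ : 0 < δ)
    (hac : a ≤ c) (hcb : c ≤ b)
    (hk : TimesDifferentiableOn (N + 1) (fun z : ℝ × ℝ => k z.1 z.2) (sector a b δ)) :
    ∃ κ : ℕ → ℝ, κ 0 = k 0 0 ∧
      (fun t => k t (c * t) - ∑ l ∈ Finset.range (N + 2), κ l * t ^ l) =o[𝓝[>] 0]
        fun t : ℝ => t ^ (N + 1) := by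
  obtain ⟨A, hA, hA0, hAo⟩ := exists_homogeneous_expansion (uniqueDiffOn_sector hab hδ)
    (starConvex_sector hδ.le) (zero_mem_sector hδ.le) N hk
  refine ⟨fun l => A l (1, c), ?_, ?_⟩
  · show A 0 (1, c) = _
    rw [hA.zero_const, hA0]; rfl
  · have ht : Tendsto (fun t : ℝ => t • ((1 : ℝ), c)) (𝓝[>] 0) (𝓝[sector a b δ] 0) := by
      refine tendsto_nhdsWithin_iff.2 ⟨?_, ?_⟩
      · have : Continuous fun t : ℝ => t • ((1 : ℝ), c) := by fun_prop
        simpa using (this.tendsto 0).mono_left nhdsWithin_le_nhds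
      · filter_upwards [Ioo_mem_nhdsGT hδ] with t ht
        refine ⟨?_, ?_, ?_, ?_⟩ <;> simp only [Prod.smul_mk, smul_eq_mul, mul_one]
        · exact ht.1.le
        · exact ht.2.le
        · nlinarith [ht.1]
        · nlinarith [ht.1]
    refine ((hAo.comp_tendsto ht).congr_left fun t => ?_).trans_isBigO ?_
    · simp only [Function.comp_apply, (hA _).2]
      simp [mul_comm]
    · refine IsBigO.of_bound (‖((1 : ℝ), c)‖ ^ (N + 1)) (Eventually.of_forall fun t => ?_)
      simp only [Function.comp_apply, norm_smul, mul_pow, norm_mul, norm_pow, norm_norm]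
      rw [mul_comm]

/-- Expansion of the partial derivative of a kernel inside its sector. -/
theorem exists_partial_expansion {a b δ T : ℝ} {N : ℕ} {k k' : ℝ → ℝ → ℝ} (ha : 0 ≤ a)
    (hab : a < b) (hb : b ≤ 1) (hδ : 0 < δ) (hδT : δ ≤ T)
    (hk' : ContinuousOn (fun z : ℝ × ℝ => k' z.1 z.2) (sector a b T))
    (hd : ∀ t s, (t, s) ∈ sector a b T → HasDerivWithinAt (fun τ => k τ s) (k' t s)
      {τ | (τ, s) ∈ sector a b T} t)
    (hk : TimesDifferentiableOn (N + 1) (fun z : ℝ × ℝ => k z.1 z.2) (sector a b δ)) :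
    ∃ A : ℕ → ℝ × ℝ → ℝ, IsHomogeneousSeq A ∧ ∀ᶠ t in 𝓝[>] (0 : ℝ), ∀ s ∈ Ioo (a * t) (b * t),
      |k' t s - ∑ l ∈ Finset.range (N + 1), A l (t, s)| ≤ t ^ N := by
  obtain ⟨A, hA, hAo⟩ : ∃ A : ℕ → ℝ × ℝ → ℝ, IsHomogeneousSeq A ∧
      ∀ᶠ z in 𝓝[sector a b δ] (0 : ℝ × ℝ), z ∈ interior (sector a b δ) →
        |k' z.1 z.2 - ∑ l ∈ Finset.range (N + 1), A l z| ≤ ‖z‖ ^ N := by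
    -- For `N = 0` only one derivative is available and its continuity is not known from
    -- differentiability, so the assumed continuity of `k'` is used. For larger `N` the Fréchet
    -- derivative itself has an expansion, which is evaluated on `(1, 0)`.
    rcases N with _ | N
    · refine ⟨fun l z => if l = 0 then k' 0 0 else 0, ?_, ?_⟩
      · intro l
        rcases eq_or_ne l 0 with rfl | h
        · exact ⟨by simp [continuous_const], by simp⟩
        · simp [h, continuous_const]
      · have hc := (hk' 0 (zero_mem_sector (hδ.le.trans hδT))).mono
          (s := sector a b δ) fun z hz => ⟨hz.1, hz.2.1.trans hδT, hz.2.2⟩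
        have := Metric.tendsto_nhds.1 hc 1 one_pos
        filter_upwards [this] with z hz _
        simpa [Real.dist_eq] using hz.le
    · obtain ⟨B, hB, -, hBo⟩ := exists_homogeneous_expansion (uniqueDiffOn_sector hab hδ)
        (starConvex_sector hδ.le) (zero_mem_sector hδ.le) N
        (hk.fderivWithin (uniqueDiffOn_sector hab hδ))
      refine ⟨fun l z => B l z (1, 0), fun l => ⟨(hB l).1.clm_apply continuous_const,
        fun c z => by simp [(hB l).2]⟩, ?_⟩
      filter_upwards [isLittleO_iff.1 hBo one_pos] with z hz hzi
      have hn := mem_interior_iff_mem_nhds.1 hzi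
      have hf : HasFDerivAt (fun z : ℝ × ℝ => k z.1 z.2)
          (fderivWithin ℝ (fun z : ℝ × ℝ => k z.1 z.2) (sector a b δ) z) z :=
        ((hk.differentiableOn z (interior_subset hzi)).hasFDerivWithinAt).hasFDerivAt hn
      have h1 : HasDerivAt (fun τ => k τ z.2)
          (fderivWithin ℝ (fun z : ℝ × ℝ => k z.1 z.2) (sector a b δ) z (1, 0)) z.1 :=
        HasFDerivAt.comp_hasDerivAt (f := fun τ => (τ, z.2)) z.1 hf
          ((hasDerivAt_id z.1).prodMk (hasDerivAt_const z.1 z.2))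
      have hsub : sector a b δ ⊆ sector a b T := fun z hz => ⟨hz.1, hz.2.1.trans hδT, hz.2.2⟩
      -- At interior points the derivative along the slice of the sector is two-sided, hence equals
      -- the Fréchet derivative on `(1, 0)`.
      have h2 : HasDerivAt (fun τ => k τ z.2) (k' z.1 z.2) z.1 := by
        refine (hd z.1 z.2 (hsub (interior_subset hzi))).hasDerivAt ?_
        have hc : Continuous fun τ : ℝ => (τ, z.2) := by fun_prop
        exact hc.continuousAt.preimage_mem_nhds (mem_of_superset hn hsub)
      rw [h2.unique h1]
      have h3 := ContinuousLinearMap.le_opNorm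
        (fderivWithin ℝ (fun z : ℝ × ℝ => k z.1 z.2) (sector a b δ) z -
          ∑ l ∈ Finset.range (N + 2), B l z) (1, 0)
      have h4 : ‖((1 : ℝ), (0 : ℝ))‖ = 1 := by simp
      rw [h4, mul_one] at h3
      simpa [_root_.sum_apply] using h3.trans hz
  refine ⟨A, hA, ?_⟩
  rw [eventually_nhdsWithin_iff, Metric.eventually_nhds_iff] at hAo
  obtain ⟨ε, hε, H⟩ := hAo
  filter_upwards [Ioo_mem_nhdsGT (lt_min hε hδ)] with t ht s hs
  have hs0 : 0 ≤ s := (mul_nonneg ha ht.1.le).trans hs.1.le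
  have hst : s ≤ t := hs.2.le.trans (mul_le_of_le_one_left ht.1.le hb)
  have hn : ‖(t, s)‖ = t := by
    rw [Prod.norm_mk, Real.norm_of_nonneg ht.1.le, Real.norm_of_nonneg hs0, max_eq_left hst]
  have hnh := sector_mem_nhds ht.1 (ht.2.trans_le (min_le_right _ _)) hs.1 hs.2
  have := H (y := (t, s)) (by rw [dist_zero_right, hn]; exact ht.2.trans_le (min_le_left _ _))
    (mem_of_mem_nhds hnh) (mem_interior_iff_mem_nhds.2 hnh)
  rwa [hn] at this

/-- Expansion of the derivative of a function of one variable. -/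
theorem exists_deriv_expansion {δ T : ℝ} {N : ℕ} {f : ℝ → ℝ} (hδ : 0 < δ) (hδT : δ ≤ T)
    (hf : ContDiffOn ℝ 1 f (Icc 0 T)) (hfN : TimesDifferentiableOn (N + 1) f (Icc 0 δ)) :
    ∃ d : ℕ → ℝ, (fun t => derivWithin f (Icc 0 T) t - ∑ l ∈ Finset.range (N + 1), d l * t ^ l)
      =o[𝓝[>] 0] fun t : ℝ => t ^ N := by
  have hT := hδ.trans_le hδT
  rcases N with _ | N
  · refine ⟨fun _ => derivWithin f (Icc 0 T) 0, ?_⟩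
    have hc := (hf.continuousOn_derivWithin (uniqueDiffOn_Icc hT) le_rfl) 0
      (left_mem_Icc.2 hT.le)
    simp only [zero_add, Finset.range_one, Finset.sum_singleton, pow_zero, mul_one]
    rw [isLittleO_one_iff]
    have h2 : Tendsto (derivWithin f (Icc 0 T)) (𝓝[>] 0) (𝓝 (derivWithin f (Icc 0 T) 0)) :=
      hc.mono_left (nhdsWithin_le_of_mem (Icc_mem_nhdsGT hT))
    simpa using h2.sub_const (derivWithin f (Icc 0 T) 0)
  · obtain ⟨B, hB, -, hBo⟩ := exists_homogeneous_expansion (uniqueDiffOn_Icc hδ)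
      ((convex_Icc 0 δ).starConvex (left_mem_Icc.2 hδ.le)) (left_mem_Icc.2 hδ.le) N
      (hfN.fderivWithin (uniqueDiffOn_Icc hδ))
    refine ⟨fun l => B l 1 1, ?_⟩
    have h1 := (hBo.mono (nhdsWithin_le_of_mem (Icc_mem_nhdsGT hδ)) :
      _ =o[𝓝[>] (0 : ℝ)] _)
    have h2 : (fun t : ℝ => (fderivWithin ℝ f (Icc 0 δ) t -
        ∑ l ∈ Finset.range (N + 2), B l t) 1) =o[𝓝[>] (0 : ℝ)] fun t : ℝ => ‖t‖ ^ (N + 1) := by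
      refine IsBigO.trans_isLittleO (IsBigO.of_bound 1 (Eventually.of_forall fun t => ?_)) h1
      simpa using ContinuousLinearMap.le_opNorm (fderivWithin ℝ f (Icc 0 δ) t -
        ∑ l ∈ Finset.range (N + 2), B l t) (1 : ℝ)
    refine (h2.congr' ?_ EventuallyEq.rfl).trans_isBigO
      (IsBigO.of_bound 1 (Eventually.of_forall fun t => by simp))
    filter_upwards [Ioo_mem_nhdsGT hδ] with t ht
    rw [derivWithin_of_mem_nhds (Icc_mem_nhds ht.1 (ht.2.trans_le hδT)),
      ← derivWithin_of_mem_nhds (Icc_mem_nhds ht.1 ht.2)]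
    simp only [_root_.sub_apply, _root_.sum_apply,
      ← fderivWithin_derivWithin]
    congr 1
    refine Finset.sum_congr rfl fun l _ => ?_
    have := (hB l).2 t 1
    rw [smul_eq_mul, mul_one] at this
    rw [this]
    simp [mul_comm]

/-! ### Linear operators on polynomials that lower the degree by `r` -/

section Triangular

variable {D : ℝ[X] →ₗ[ℝ] ℝ[X]} {r : ℕ}

/-- If `p` were nonzero, the coefficient of `D p` in degree `natDegree p - r` would come from the
leading term of `p` alone: the other monomials of degree at least `r` are sent to smaller degrees,
and those of degree below `r` are absent. -/
theorem eq_zero_of_triangular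
    (h1 : ∀ m a, m < a → (D (X ^ (m + r))).coeff a = 0)
    (h2 : ∀ m, (D (X ^ (m + r))).coeff m ≠ 0) {p : ℝ[X]} (hD : D p = 0)
    (hp : ∀ i < r, p.coeff i = 0) : p = 0 := by
  by_contra hne
  have hr : r ≤ p.natDegree := by
    by_contra! h
    exact hne (leadingCoeff_eq_zero.1 (hp _ h))
  have h3 : (D p).coeff (p.natDegree - r) = 0 := by rw [hD, coeff_zero]
  have hs : D p = ∑ i ∈ Finset.range (p.natDegree + 1), D (C (p.coeff i) * X ^ i) := by
    conv_lhs => rw [p.as_sum_range_C_mul_X_pow, map_sum]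
  rw [hs, finsetSum_coeff, Finset.sum_range_succ, Finset.sum_eq_zero, zero_add] at h3
  · rw [C_mul', map_smul, coeff_smul, smul_eq_mul] at h3
    have h4 := h2 (p.natDegree - r)
    rw [Nat.sub_add_cancel hr] at h4
    exact (mul_ne_zero (leadingCoeff_ne_zero.2 hne) h4) h3
  · intro i hi
    rw [C_mul', map_smul, coeff_smul, smul_eq_mul]
    rcases lt_or_ge i r with h | h
    · rw [hp i h, zero_mul]
    · have h5 := h1 (i - r) (p.natDegree - r)
        (by have := Finset.mem_range.1 hi; omega)
      rw [Nat.sub_add_cancel h] at h5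
      rw [h5, mul_zero]

/-- Elimination from the top: a multiple of `D (X ^ (d + r))` removes the coefficient of degree `d`.
-/
theorem exists_of_triangular (h1 : ∀ m a, m < a → (D (X ^ (m + r))).coeff a = 0)
    (h2 : ∀ m, (D (X ^ (m + r))).coeff m ≠ 0) (d : ℕ) :
    ∀ q : ℝ[X], q.degree < d → ∃ p, D p = q ∧ ∀ i < r, p.coeff i = 0 := by
  induction d with
  | zero =>
    intro q hq
    refine ⟨0, ?_, by simp⟩
    rw [degree_lt_iff_coeff_zero] at hq
    rw [map_zero]
    ext m
    simp [hq m (Nat.zero_le m)]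
  | succ d ih =>
    intro q hq
    obtain ⟨p, hp, hp0⟩ := ih (q - (q.coeff d / (D (X ^ (d + r))).coeff d) • D (X ^ (d + r))) (by
      rw [degree_lt_iff_coeff_zero] at hq ⊢
      intro m hm
      rw [coeff_sub, coeff_smul, smul_eq_mul]
      rcases hm.eq_or_lt with rfl | hm
      · rw [div_mul_cancel₀ _ (h2 d), sub_self]
      · rw [hq m hm, h1 d m hm]; simp)
    refine ⟨p + (q.coeff d / (D (X ^ (d + r))).coeff d) • X ^ (d + r), ?_, fun i hi => ?_⟩
    · rw [map_add, map_smul, hp, sub_add_cancel]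
    · rw [coeff_add, hp0 i hi, coeff_smul, coeff_X_pow, if_neg (by omega)]; simp

/-- A triangular operator lowering degrees by `r` is bijective once the `r` lowest coefficients
are prescribed. -/
theorem existsUnique_of_triangular (h0 : ∀ m < r, D (X ^ m) = 0)
    (h1 : ∀ m a, m < a → (D (X ^ (m + r))).coeff a = 0)
    (h2 : ∀ m, (D (X ^ (m + r))).coeff m ≠ 0) (q : ℝ[X]) (c : ℕ → ℝ) :
    ∃! p, D p = q ∧ ∀ i < r, p.coeff i = c i := by
  obtain ⟨p, hp, hp0⟩ := exists_of_triangular h1 h2 (q.natDegree + 1) q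
    (degree_le_natDegree.trans_lt (by exact_mod_cast Nat.lt_succ_self _))
  have hc : ∀ i < r, (∑ i ∈ Finset.range r, c i • (X : ℝ[X]) ^ i).coeff i = c i := by
    intro i hi
    simp [coeff_X_pow, hi]
  refine ⟨p + ∑ i ∈ Finset.range r, c i • X ^ i, ⟨?_, fun i hi => ?_⟩, ?_⟩
  · rw [map_add, hp, map_sum, Finset.sum_eq_zero, add_zero]
    intro i hi
    rw [map_smul, h0 i (Finset.mem_range.1 hi), smul_zero]
  · rw [coeff_add, hp0 i hi, hc i hi, zero_add]
  · rintro p' ⟨hp', hc'⟩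
    refine sub_eq_zero.1 (eq_zero_of_triangular h1 h2 ?_ fun i hi => ?_)
    · rw [map_sub, map_add, hp, hp', map_sum, Finset.sum_eq_zero, add_zero, sub_self]
      intro i hi
      rw [map_smul, h0 i (Finset.mem_range.1 hi), smul_zero]
    · rw [coeff_sub, coeff_add, hp0 i hi, hc i hi, hc' i hi, zero_add, sub_self]

end Triangular

/-! ### The difference operator, its moments and the multiplicity of the root -/

section Difference

variable (n : ℕ) (α : ℕ → ℝ) (K : ℕ → ℝ → ℝ → ℝ)

/-- The difference operator governing the coefficient of `t ^ j`. -/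
noncomputable def diffOp (j : ℕ) : ℝ[X] →ₗ[ℝ] ℝ[X] :=
  ∑ i ∈ Finset.range n, K (i + 1) 0 0 •
    (α (i + 1) ^ (1 + j) • taylor (Real.log (α (i + 1))) - α i ^ (1 + j) • taylor (Real.log (α i)))

/-- The logarithmic moments of the jumps; they are the Taylor coefficients of the symbol. -/
noncomputable def moment (j l : ℕ) : ℝ :=
  ∑ i ∈ Finset.range n, K (i + 1) 0 0 *
    (α (i + 1) ^ (1 + j) * Real.log (α (i + 1)) ^ l - α i ^ (1 + j) * Real.log (α i) ^ l)

theorem moment_zero (j : ℕ) : moment n α K j 0 = charL n α K j := by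
  simp [moment, charL]

/-- Binomial expansion of `(X + log α) ^ m`. For `a > m` the truncated difference `m - a` is
harmless, since the binomial coefficient vanishes. -/
theorem coeff_diffOp_X_pow (j m a : ℕ) :
    (diffOp n α K j (X ^ m)).coeff a = moment n α K j (m - a) * m.choose a := by
  simp only [diffOp, moment, LinearMap.sum_apply, LinearMap.smul_apply, LinearMap.sub_apply,
    finsetSum_coeff, coeff_smul, coeff_sub, smul_eq_mul, Finset.sum_mul, taylor_X_pow,
    coeff_X_add_C_pow]
  exact Finset.sum_congr rfl fun i _ => by ring

variable {n α K}

/-- When the first nonzero moment has index `r`, the image of `X ^ (m + r)` has degree exactly `m`,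
with leading coefficient `moment r * choose (m + r) m`. -/
theorem diffOp_existsUnique {j r : ℕ} (h0 : ∀ l < r, moment n α K j l = 0)
    (hr : moment n α K j r ≠ 0) (q : ℝ[X]) (c : ℕ → ℝ) :
    ∃! p, diffOp n α K j p = q ∧ ∀ i < r, p.coeff i = c i := by
  refine existsUnique_of_triangular (fun m hm => ?_) (fun m a hma => ?_) (fun m => ?_) q c
  · ext a
    rw [coeff_diffOp_X_pow, h0 _ ((Nat.sub_le m a).trans_lt hm), zero_mul, coeff_zero]
  · rw [coeff_diffOp_X_pow]
    rcases lt_or_ge (m + r) a with h | h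
    · rw [Nat.choose_eq_zero_of_lt h]; simp
    · rw [h0 _ (by omega), zero_mul]
  · rw [coeff_diffOp_X_pow, Nat.add_sub_cancel_left]
    exact mul_ne_zero hr (by exact_mod_cast (Nat.choose_pos (Nat.le_add_right m r)).ne')

theorem sum_mul_sub_eq (k b : ℕ → ℝ) (hb : b 0 = 0) (m : ℕ) :
    ∑ i ∈ Finset.range (m + 1), k (i + 1) * (b (i + 1) - b i) =
      k (m + 1) * b (m + 1) + ∑ i ∈ Finset.Ico 1 (m + 1), b i * (k i - k (i + 1)) := by
  induction m with
  | zero => simp [hb]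
  | succ m ih =>
    rw [Finset.sum_range_succ, ih, Finset.sum_Ico_succ_top (Nat.succ_le_succ (Nat.zero_le m))]
    ring

/-- Summation by parts. The boundary term at `α 0 = 0` disappears because `0 ^ (1 + j) = 0`,
whatever value `Real.log 0` has. Exponentials in `w` make differentiation at `w = 0` produce powers
of `log α`, that is, the moments. -/
theorem auxP_exp (hn : n ≠ 0) (hα0 : α 0 = 0) (hαn : α n = 1) (j : ℕ) (w : ℝ) :
    auxP n α K j (Real.exp w) = ∑ i ∈ Finset.range n, K (i + 1) 0 0 *
      (α (i + 1) ^ (1 + j) * Real.exp (Real.log (α (i + 1)) * w) -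
        α i ^ (1 + j) * Real.exp (Real.log (α i) * w)) := by
  obtain ⟨m, rfl⟩ := Nat.exists_eq_succ_of_ne_zero hn
  rw [Nat.succ_eq_add_one] at *
  have := sum_mul_sub_eq (fun i => K i 0 0)
    (fun i => α i ^ (1 + j) * Real.exp (Real.log (α i) * w)) (by simp [hα0]) m
  rw [this, auxP, hαn]
  simp only [one_pow, Real.log_one, zero_mul, Real.exp_zero, mul_one]
  congr 1
  refine Finset.sum_congr rfl fun i _ => ?_
  rw [← Real.exp_mul, mul_comm w]
  ring

theorem iteratedDeriv_auxP_exp (hn : n ≠ 0) (hα0 : α 0 = 0) (hαn : α n = 1) (j l : ℕ) :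
    iteratedDeriv l (auxP n α K j ∘ Real.exp) 0 = moment n α K j l := by
  have key : ∀ l, iteratedDeriv l (auxP n α K j ∘ Real.exp) = fun w =>
      ∑ i ∈ Finset.range n, K (i + 1) 0 0 *
        (α (i + 1) ^ (1 + j) * (Real.log (α (i + 1)) ^ l * Real.exp (Real.log (α (i + 1)) * w)) -
        α i ^ (1 + j) * (Real.log (α i) ^ l * Real.exp (Real.log (α i) * w))) := by
    intro l
    induction l with
    | zero =>
      ext w
      simp [auxP_exp hn hα0 hαn]
    | succ l ih =>
      rw [iteratedDeriv_succ, ih]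
      ext w
      have e : ∀ c : ℝ, HasDerivAt (fun w => c ^ l * Real.exp (c * w))
          (c ^ (l + 1) * Real.exp (c * w)) w := fun c => by
        have := (((hasDerivAt_id w).const_mul c).exp).const_mul (c ^ l)
        refine this.congr_deriv ?_
        simp; ring
      exact (HasDerivAt.fun_sum fun i _ =>
        (((e _).const_mul _).sub ((e _).const_mul _)).const_mul _).deriv
  rw [key]
  simp [moment]

/-- The multiplicity of the root `1` of the symbol in terms of the moments. -/
theorem moment_of_analyticOrderAt (hn : n ≠ 0) (hα0 : α 0 = 0) (hαn : α n = 1) {j r : ℕ}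
    (h : analyticOrderAt (auxP n α K j) 1 = r) :
    (∀ l < r, moment n α K j l = 0) ∧ moment n α K j r ≠ 0 := by
  have ha : AnalyticAt ℝ (auxP n α K j ∘ Real.exp) 0 := by
    have : auxP n α K j ∘ Real.exp = _ := funext fun w => auxP_exp hn hα0 hαn j w
    rw [this]
    fun_prop
  -- The substitution `z = exp w` has nonzero derivative at `0`, so it preserves the order of
  -- vanishing.
  have h1 : analyticOrderAt (auxP n α K j ∘ Real.exp) 0 = r := by
    rw [analyticOrderAt_comp_of_deriv_ne_zero (by fun_prop) (by simp), Real.exp_zero, h]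
  rw [analyticOrderAt_eq_nat_iff_iteratedDeriv_eq_zero ha] at h1
  simpa [iteratedDeriv_auxP_exp hn hα0 hαn] using h1

end Difference

/-! ### Asymptotics of logarithmic-power sums -/

section LogAsymptotics

theorem eval_log_isLittleO (p : ℝ[X]) {ε : ℝ} (hε : 0 < ε) :
    (fun t => p.eval (Real.log t)) =o[𝓝[>] 0] fun t : ℝ => t ^ (-ε) := by
  have e : (fun t => p.eval (Real.log t)) =
      fun t => ∑ i ∈ Finset.range (p.natDegree + 1), p.coeff i * Real.log t ^ i := by
    ext t; rw [eval_eq_sum_range]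
  rw [e]
  refine IsLittleO.fun_sum fun i _ => IsLittleO.const_mul_left ?_ _
  have := isLittleO_abs_log_rpow_rpow_nhdsGT_zero (i : ℝ) (neg_lt_zero.2 hε)
  refine IsLittleO.of_norm_left (this.congr_left fun t => ?_)
  rw [Real.rpow_natCast, norm_pow, Real.norm_eq_abs]

theorem pow_mul_eval_log_isLittleO (p : ℝ[X]) {m N : ℕ} (h : N < m) :
    (fun t => t ^ m * p.eval (Real.log t)) =o[𝓝[>] 0] fun t : ℝ => t ^ N := by
  have h1 := (isBigO_refl (fun t : ℝ => t ^ m) (𝓝[>] 0)).mul_isLittleO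
    (eval_log_isLittleO p one_pos)
  refine h1.trans_isBigO (IsBigO.of_bound 1 ?_)
  filter_upwards [Ioo_mem_nhdsGT one_pos] with t ht
  obtain ⟨l, rfl⟩ : ∃ l, m = N + l + 1 := ⟨m - N - 1, by omega⟩
  have h2 : t ^ (N + l + 1) * t ^ (-1 : ℝ) = t ^ N * t ^ l := by
    rw [Real.rpow_neg_one, pow_succ, mul_assoc, mul_inv_cancel₀ ht.1.ne', mul_one, pow_add]
  rw [h2, one_mul, norm_mul]
  refine mul_le_of_le_one_right (norm_nonneg _) ?_
  rw [norm_pow]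
  exact pow_le_one₀ (norm_nonneg _) (by rw [Real.norm_of_nonneg ht.1.le]; exact ht.2.le)

/-- With `t = exp (-z)` the polynomial `p (-z)` tends to `0` at infinity, which forces it to vanish.
-/
theorem eq_zero_of_eval_log_tendsto {p : ℝ[X]}
    (h : Tendsto (fun t => p.eval (Real.log t)) (𝓝[>] 0) (𝓝 0)) : p = 0 := by
  have h1 : Tendsto (fun z : ℝ => (p.comp (-X)).eval z) atTop (𝓝 0) := by
    have := h.comp (Real.tendsto_exp_atBot_nhdsGT.comp tendsto_neg_atTop_atBot)
    refine this.congr fun z => ?_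
    simp
  have h2 := leadingCoeff_eq_zero.1 ((Polynomial.tendsto_nhds_iff _).1 h1).1
  have h3 := congrArg (fun q : ℝ[X] => q.comp (-X)) h2
  simpa [comp_assoc] using h3

/-- Logarithmic-power sums are determined by their asymptotics. -/
theorem eq_zero_of_logPoly_isLittleO {N : ℕ} {e : ℕ → ℝ[X]}
    (h : logPoly N e =o[𝓝[>] 0] fun t : ℝ => t ^ N) : ∀ j ≤ N, e j = 0 := by
  intro j
  induction j using Nat.strong_induction_on with
  | _ j ih =>
    intro hj
    have h1 : logPoly N e =o[𝓝[>] 0] fun t : ℝ => t ^ j := by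
      refine h.trans_isBigO (IsBigO.of_bound 1 ?_)
      filter_upwards [Ioo_mem_nhdsGT one_pos] with t ht
      rw [one_mul, norm_pow, norm_pow, Real.norm_of_nonneg ht.1.le]
      exact pow_le_pow_of_le_one ht.1.le ht.2.le hj
    -- Terms of order below `j` vanish by induction, and terms of order above `j` are `o(t ^ j)`
    -- despite the logarithms. So the coefficient of order `j` itself tends to zero.
    have h2 : (fun t => ∑ i ∈ (Finset.range (N + 1)).erase j,
        (e i).eval (Real.log t) * t ^ i) =o[𝓝[>] 0] fun t : ℝ => t ^ j := by
      refine IsLittleO.fun_sum fun i hi => ?_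
      rw [Finset.mem_erase, Finset.mem_range] at hi
      rcases lt_or_gt_of_ne hi.1 with hij | hij
      · rw [ih i hij (by omega)]
        simp
      · simpa [mul_comm] using pow_mul_eval_log_isLittleO (e i) hij
    have h3 : (fun t => (e j).eval (Real.log t) * t ^ j) =o[𝓝[>] 0] fun t : ℝ => t ^ j := by
      refine (h1.sub h2).congr_left fun t => ?_
      rw [logPoly, ← Finset.add_sum_erase _ _ (Finset.mem_range.2 (Nat.lt_succ_of_le hj)),
        add_sub_cancel_right]
    refine eq_zero_of_eval_log_tendsto ?_
    have h4 := h3.tendsto_div_nhds_zero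
    refine h4.congr' ?_
    filter_upwards [self_mem_nhdsWithin] with t ht
    rw [mul_div_cancel_right₀ _ (pow_ne_zero _ (ne_of_gt ht))]

theorem logPoly_add (N : ℕ) (e e' : ℕ → ℝ[X]) (t : ℝ) :
    logPoly N (fun i => e i + e' i) t = logPoly N e t + logPoly N e' t := by
  simp [logPoly, add_mul, Finset.sum_add_distrib]

theorem logPoly_sub (N : ℕ) (e e' : ℕ → ℝ[X]) (t : ℝ) :
    logPoly N (fun i => e i - e' i) t = logPoly N e t - logPoly N e' t := by
  simp [logPoly, sub_mul, Finset.sum_sub_distrib]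

/-- `h` is a logarithmic-power sum up to `o(t ^ N)`, whose terms of order below `m` vanish and
whose term of order `m` is `v (log t) * t ^ m`. -/
def LogLead (N m : ℕ) (v : ℝ[X]) (h : ℝ → ℝ) : Prop :=
  ∃ e : ℕ → ℝ[X], (∀ j < m, e j = 0) ∧ e m = v ∧
    (fun t => h t - logPoly N e t) =o[𝓝[>] 0] fun t : ℝ => t ^ N

namespace LogLead

variable {N m : ℕ} {v v' : ℝ[X]} {h h' : ℝ → ℝ}

theorem add (H : LogLead N m v h) (H' : LogLead N m v' h') :
    LogLead N m (v + v') fun t => h t + h' t := by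
  obtain ⟨e, h1, h2, h3⟩ := H
  obtain ⟨e', h1', h2', h3'⟩ := H'
  refine ⟨fun i => e i + e' i, fun j hj => by simp [h1 j hj, h1' j hj], by simp only [h2, h2'], ?_⟩
  refine (h3.add h3').congr_left fun t => ?_
  rw [logPoly_add]; ring

theorem congr' (H : LogLead N m v h) (hh : h =ᶠ[𝓝[>] 0] h') : LogLead N m v h' := by
  obtain ⟨e, h1, h2, h3⟩ := H
  exact ⟨e, h1, h2, h3.congr' (hh.mono fun t ht => by simp only [ht]) EventuallyEq.rfl⟩

theorem of_isLittleO (H : h =o[𝓝[>] 0] fun t : ℝ => t ^ N) : LogLead N m 0 h :=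
  ⟨fun _ => 0, fun _ _ => rfl, rfl, by simpa [logPoly] using H⟩

theorem zero : LogLead N m 0 fun _ => 0 := of_isLittleO (isLittleO_zero _ _)

theorem sum {ι : Type*} (s : Finset ι) {v : ι → ℝ[X]} {h : ι → ℝ → ℝ}
    (H : ∀ i ∈ s, LogLead N m (v i) (h i)) :
    LogLead N m (∑ i ∈ s, v i) fun t => ∑ i ∈ s, h i t := by
  classical
  induction s using Finset.induction_on with
  | empty => simpa using zero
  | insert a s ha ih =>
    simp only [Finset.sum_insert ha]
    exact (H a (Finset.mem_insert_self a s)).add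
      (ih fun i hi => H i (Finset.mem_insert_of_mem hi))

theorem monomial (q : ℝ[X]) : LogLead N m q fun t => t ^ m * q.eval (Real.log t) := by
  refine ⟨fun j => if j = m then q else 0, fun j hj => if_neg hj.ne, if_pos rfl, ?_⟩
  rcases le_or_gt m N with h | h
  · refine (isLittleO_zero (fun t : ℝ => t ^ N) _).congr_left fun t => ?_
    rw [logPoly, Finset.sum_eq_single m]
    · rw [if_pos rfl]; ring
    · intro b _ hb
      rw [if_neg hb, eval_zero, zero_mul]
    · intro hm
      exact absurd (Finset.mem_range.2 (Nat.lt_succ_of_le h)) hm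
  · refine (pow_mul_eval_log_isLittleO q h).congr_left fun t => ?_
    rw [logPoly, Finset.sum_eq_zero, sub_zero]
    intro i hi
    rw [if_neg (by have := Finset.mem_range.1 hi; omega), eval_zero, zero_mul]

theorem of_lt {m' : ℕ} (hm : m < m') (H : LogLead N m' v h) : LogLead N m 0 h := by
  obtain ⟨e, h1, -, h3⟩ := H
  exact ⟨e, fun j hj => h1 j (hj.trans hm), h1 m hm, h3⟩

end LogLead

end LogAsymptotics

/-! ### Functions with an integrable singularity at zero -/

section Singular

/-- Continuous functions on `(0, T]` with at most an integrable power singularity at zero. -/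
structure MildSingular (T : ℝ) (x : ℝ → ℝ) : Prop where
  continuousOn : ContinuousOn x (Ioc 0 T)
  isBigO : x =O[𝓝[>] 0] fun t : ℝ => t ^ (-(1 / 2) : ℝ)

variable {T : ℝ} {x y : ℝ → ℝ}

theorem MildSingular.add (hx : MildSingular T x) (hy : MildSingular T y) :
    MildSingular T fun t => x t + y t :=
  ⟨hx.1.add hy.1, hx.2.add hy.2⟩

theorem MildSingular.exists_bound (hT : 0 < T) (hx : MildSingular T x) :
    ∃ C, 0 ≤ C ∧ ∀ t ∈ Ioc 0 T, |x t| ≤ C * t ^ (-(1 / 2) : ℝ) := by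
  obtain ⟨C₁, hC₁⟩ := hx.isBigO.bound
  rw [eventually_nhdsWithin_iff, Metric.eventually_nhds_iff] at hC₁
  obtain ⟨ε, hε, H⟩ := hC₁
  have hc : ContinuousOn (fun t => x t * t ^ (1 / 2 : ℝ)) (Icc (min ε T) T) := by
    refine (hx.continuousOn.mono fun t ht => ⟨(lt_min hε hT).trans_le ht.1, ht.2⟩).mul ?_
    exact (Real.continuous_rpow_const (by norm_num)).continuousOn
  obtain ⟨C₂, hC₂⟩ := isCompact_Icc.exists_bound_of_continuousOn hc
  refine ⟨max 0 (max C₁ C₂), le_max_left _ _, fun t ht => ?_⟩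
  have hp : 0 < t ^ (-(1 / 2) : ℝ) := Real.rpow_pos_of_pos ht.1 _
  rcases lt_or_ge t ε with h | h
  · have := H (y := t) (by rwa [dist_zero_right, Real.norm_of_nonneg ht.1.le]) ht.1
    rw [Real.norm_eq_abs, Real.norm_of_nonneg hp.le] at this
    exact this.trans (by gcongr; exact (le_max_left _ _).trans (le_max_right _ _))
  · have := hC₂ t ⟨(min_le_left _ _).trans h, ht.2⟩
    rw [norm_mul, Real.norm_eq_abs, Real.norm_of_nonneg (Real.rpow_nonneg ht.1.le _)] at this
    have h1 : |x t| = (|x t| * t ^ (1 / 2 : ℝ)) * t ^ (-(1 / 2) : ℝ) := by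
      rw [mul_assoc, ← Real.rpow_add ht.1]; norm_num
    rw [h1]
    gcongr
    exact this.trans ((le_max_right _ _).trans (le_max_right _ _))

theorem mildSingular_of_continuousOn (hT : 0 < T) (hx : ContinuousOn x (Icc 0 T)) :
    MildSingular T x := by
  refine ⟨hx.mono Ioc_subset_Icc_self, ?_⟩
  obtain ⟨C, hC⟩ := isCompact_Icc.exists_bound_of_continuousOn hx
  refine IsBigO.of_bound C ?_
  filter_upwards [Ioo_mem_nhdsGT (lt_min one_pos hT)] with t ht
  have h1 : 1 ≤ t ^ (-(1 / 2) : ℝ) :=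
    Real.one_le_rpow_of_pos_of_le_one_of_nonpos ht.1 (ht.2.le.trans (min_le_left _ _))
      (by norm_num)
  have h2 := hC t ⟨ht.1.le, ht.2.le.trans (min_le_right _ _)⟩
  rw [Real.norm_of_nonneg (zero_le_one.trans h1)]
  nlinarith [norm_nonneg (x t)]

/-- Powers of the logarithm are dominated by `t ^ (-1/2)`. Any exponent strictly between `-1` and
`0` would serve equally: it must dominate logarithms and remain integrable. -/
theorem mildSingular_eval_log_mul_pow (T : ℝ) (p : ℝ[X]) (m : ℕ) :
    MildSingular T fun t => p.eval (Real.log t) * t ^ m := by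
  refine ⟨?_, ?_⟩
  · refine ContinuousOn.mul ?_ (continuous_pow m).continuousOn
    exact p.continuous.comp_continuousOn
      (Real.continuousOn_log.mono fun t ht => (ne_of_gt ht.1 : t ≠ 0))
  · have h1 := (eval_log_isLittleO p (ε := 1 / 2) (by norm_num)).isBigO
    have h2 : (fun t : ℝ => t ^ m) =O[𝓝[>] 0] fun _ => (1 : ℝ) :=
      ((continuous_pow m).tendsto (0 : ℝ)).mono_left nhdsWithin_le_nhds |>.isBigO_one ℝ
    simpa using h1.mul h2

theorem mildSingular_logPoly (T : ℝ) (N : ℕ) (e : ℕ → ℝ[X]) : MildSingular T (logPoly N e) := by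
  refine ⟨continuousOn_finsetSum _ fun i _ => (mildSingular_eval_log_mul_pow T (e i) i).1, ?_⟩
  exact IsBigO.fun_sum fun i _ => (mildSingular_eval_log_mul_pow T (e i) i).2

end Singular

theorem intervalIntegrable_of_bound {x : ℝ → ℝ} {p q C : ℝ} (hpq : p ≤ q)
    (hx : ContinuousOn x (Ioc p q)) (hC : ∀ s ∈ Ioc p q, |x s| ≤ C * s ^ (-(1 / 2) : ℝ)) :
    IntervalIntegrable x volume p q := by
  have h : IntervalIntegrable (fun s : ℝ => C * s ^ (-(1 / 2) : ℝ)) volume p q :=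
    (intervalIntegral.intervalIntegrable_rpow' (by norm_num)).const_mul C
  rw [intervalIntegrable_iff_integrableOn_Ioc_of_le hpq] at h ⊢
  refine Integrable.mono' h (hx.aestronglyMeasurable measurableSet_Ioc) ?_
  exact (ae_restrict_mem measurableSet_Ioc).mono fun s hs => hC s hs

theorem MildSingular.intervalIntegrable {T : ℝ} {x : ℝ → ℝ} (hT : 0 < T) (hx : MildSingular T x)
    {t : ℝ} (ht : t ∈ Ioc 0 T) : IntervalIntegrable x volume 0 t := by
  obtain ⟨C, -, hC⟩ := hx.exists_bound hT
  exact intervalIntegrable_of_bound ht.1.le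
    (hx.continuousOn.mono (Ioc_subset_Ioc_right ht.2)) fun s hs => hC s ⟨hs.1, hs.2.trans ht.2⟩

/-- The majorant is integrated over all of `[0, t]`, and `∫₀ᵗ s ^ (-1/2) ds = 2 t ^ (1/2)`. The
bound is asked on the open interval only, because expansions of `k'` are available only in the
interior of a sector. -/
theorem abs_integral_le_of_bound {h : ℝ → ℝ} {a b t B : ℝ} (ha : 0 ≤ a) (hab : a ≤ b) (hb : b ≤ 1)
    (ht : 0 ≤ t) (hB : 0 ≤ B)
    (hh : ∀ s ∈ Ioo (a * t) (b * t), |h s| ≤ B * s ^ (-(1 / 2) : ℝ)) :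
    |∫ s in (a * t)..(b * t), h s| ≤ 2 * B * t ^ (1 / 2 : ℝ) := by
  have hi : ∀ p q : ℝ, IntervalIntegrable (fun s : ℝ => B * s ^ (-(1 / 2) : ℝ)) volume p q :=
    fun p q => (intervalIntegral.intervalIntegrable_rpow' (by norm_num)).const_mul B
  have h1 : ‖∫ s in (a * t)..(b * t), h s‖ ≤
      ∫ s in (a * t)..(b * t), B * s ^ (-(1 / 2) : ℝ) := by
    have hle : a * t ≤ b * t := by gcongr
    refine intervalIntegral.norm_integral_le_of_norm_le hle ?_ (hi _ _)
    have : ∀ᵐ s : ℝ, s ≠ b * t := by simp [ae_iff]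
    filter_upwards [this] with s hs hs'
    exact hh s ⟨hs'.1, lt_of_le_of_ne hs'.2 hs⟩
  have h2 : ∫ s in (a * t)..(b * t), B * s ^ (-(1 / 2) : ℝ) ≤
      ∫ s in (0 : ℝ)..t, B * s ^ (-(1 / 2) : ℝ) := by
    refine intervalIntegral.integral_mono_interval (by positivity) (by gcongr)
      (mul_le_of_le_one_left ht hb) ?_ (hi _ _)
    filter_upwards [ae_restrict_mem measurableSet_Ioc] with s hs
    exact mul_nonneg hB (Real.rpow_nonneg hs.1.le _)
  refine (h1.trans h2).trans_eq ?_
  rw [intervalIntegral.integral_const_mul, integral_rpow (Or.inl (by norm_num))]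
  norm_num
  ring

/-- The contribution of one sector to the derivative of the Volterra integral. -/
noncomputable def sectorDeriv (a b : ℝ) (k k' : ℝ → ℝ → ℝ) (x : ℝ → ℝ) (t : ℝ) : ℝ :=
  b * k t (b * t) * x (b * t) - a * k t (a * t) * x (a * t) +
    ∫ s in (a * t)..(b * t), k' t s * x s

/-! ### Integrals over one sector and on its boundary rays -/

section Sector

variable {a b T : ℝ} {g k k' : ℝ → ℝ → ℝ} {x y : ℝ → ℝ}

theorem mem_sector_of_mem_Icc {t s : ℝ} (ht : t ∈ Ioc 0 T) (hs : s ∈ Icc (a * t) (b * t)) :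
    (t, s) ∈ sector a b T := ⟨ht.1.le, ht.2, hs.1, hs.2⟩

theorem exists_sector_bound (hg : ContinuousOn (fun z : ℝ × ℝ => g z.1 z.2) (sector a b T)) :
    ∃ M, 0 ≤ M ∧ ∀ t s, (t, s) ∈ sector a b T → |g t s| ≤ M := by
  obtain ⟨M, hM⟩ := isCompact_sector.exists_bound_of_continuousOn hg
  exact ⟨max 0 M, le_max_left _ _, fun t s h => (hM _ h).trans (le_max_right _ _)⟩

theorem intervalIntegrable_sector (ha : 0 ≤ a) (hab : a ≤ b) (hb : b ≤ 1) (hT : 0 < T)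
    (hg : ContinuousOn (fun z : ℝ × ℝ => g z.1 z.2) (sector a b T)) (hx : MildSingular T x)
    {t : ℝ} (ht : t ∈ Ioc 0 T) :
    IntervalIntegrable (fun s => g t s * x s) volume (a * t) (b * t) := by
  obtain ⟨M, hM0, hM⟩ := exists_sector_bound hg
  obtain ⟨C, hC0, hC⟩ := hx.exists_bound hT
  have h0 : 0 ≤ a * t := mul_nonneg ha ht.1.le
  have hbt : b * t ≤ T := (mul_le_of_le_one_left ht.1.le hb).trans ht.2
  have hsub : ∀ s ∈ Ioc (a * t) (b * t), s ∈ Ioc 0 T := fun s hs =>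
    ⟨h0.trans_lt hs.1, hs.2.trans hbt⟩
  have hsec : ∀ s ∈ Ioc (a * t) (b * t), (t, s) ∈ sector a b T := fun s hs =>
    mem_sector_of_mem_Icc ht (Ioc_subset_Icc_self hs)
  refine intervalIntegrable_of_bound (C := M * C) (by gcongr; exact ht.1.le) ?_ fun s hs => ?_
  · refine ContinuousOn.mul ?_ (hx.continuousOn.mono hsub)
    exact hg.comp (f := fun s => (t, s)) (by fun_prop) hsec
  · rw [abs_mul, mul_assoc]
    exact mul_le_mul (hM _ _ (hsec s hs)) (hC s (hsub s hs)) (abs_nonneg _) hM0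

/-- The scaling `s = σ t` fixes the interval of integration. Near `t₀ > 0` the integrand is
dominated by a multiple of `σ ^ (-1/2)`, where restricting to `t > t₀ / 2` makes the constant
uniform. -/
theorem continuousOn_integral_sector (ha : 0 ≤ a) (hab : a ≤ b) (hb : b ≤ 1) (hT : 0 < T)
    (hg : ContinuousOn (fun z : ℝ × ℝ => g z.1 z.2) (sector a b T)) (hx : MildSingular T x) :
    ContinuousOn (fun t => ∫ s in (a * t)..(b * t), g t s * x s) (Ioc 0 T) := by
  obtain ⟨M, hM0, hM⟩ := exists_sector_bound hg
  obtain ⟨C, hC0, hC⟩ := hx.exists_bound hT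
  have e : ∀ t, ∫ s in (a * t)..(b * t), g t s * x s =
      t * ∫ σ in a..b, g t (σ * t) * x (σ * t) := fun t =>
    (intervalIntegral.mul_integral_comp_mul_right (f := fun s => g t s * x s) t).symm
  simp only [e]
  refine continuousOn_id.mul fun t₀ ht₀ => ?_
  have hsec : ∀ t ∈ Ioc 0 T, ∀ σ ∈ Ioc a b, (t, σ * t) ∈ sector a b T := fun t ht σ hσ =>
    mem_sector_of_mem_Icc ht ⟨by have := ht.1.le; gcongr; exact hσ.1.le,
      by have := ht.1.le; gcongr; exact hσ.2⟩
  have hpos : ∀ t ∈ Ioc 0 T, ∀ σ ∈ Ioc a b, σ * t ∈ Ioc 0 T := fun t ht σ hσ =>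
    ⟨mul_pos (ha.trans_lt hσ.1) ht.1, (mul_le_of_le_one_left ht.1.le (hσ.2.trans hb)).trans ht.2⟩
  refine intervalIntegral.continuousWithinAt_of_dominated_interval
    (bound := fun σ => M * C * (t₀ / 2) ^ (-(1 / 2) : ℝ) * σ ^ (-(1 / 2) : ℝ)) ?_ ?_ ?_ ?_
  · filter_upwards [self_mem_nhdsWithin] with t ht
    rw [uIoc_of_le hab]
    refine ContinuousOn.aestronglyMeasurable ?_ measurableSet_Ioc
    refine ContinuousOn.mul ?_ ?_
    · exact hg.comp (f := fun σ => (t, σ * t)) (by fun_prop) (hsec t ht)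
    · exact hx.continuousOn.comp (by fun_prop) (hpos t ht)
  · have h2 : ∀ᶠ t in 𝓝[Ioc 0 T] t₀, t₀ / 2 < t :=
      mem_nhdsWithin_of_mem_nhds (Ioi_mem_nhds (half_lt_self ht₀.1))
    filter_upwards [self_mem_nhdsWithin, h2] with t ht ht2
    refine Eventually.of_forall fun σ hσ => ?_
    rw [uIoc_of_le hab] at hσ
    have hσ0 : 0 < σ := ha.trans_lt hσ.1
    rw [norm_mul, mul_assoc, mul_assoc, Real.norm_eq_abs, Real.norm_eq_abs]
    refine mul_le_mul (hM _ _ (hsec t ht σ hσ)) ((hC _ (hpos t ht σ hσ)).trans ?_)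
      (abs_nonneg _) hM0
    rw [Real.mul_rpow hσ0.le ht.1.le, mul_comm (σ ^ _)]
    have : t ^ (-(1 / 2) : ℝ) ≤ (t₀ / 2) ^ (-(1 / 2) : ℝ) :=
      Real.rpow_le_rpow_of_nonpos (half_pos ht₀.1) ht2.le (by norm_num)
    gcongr
  · exact (intervalIntegral.intervalIntegrable_rpow' (by norm_num)).const_mul _
  · refine Eventually.of_forall fun σ hσ => ?_
    rw [uIoc_of_le hab] at hσ
    refine ContinuousWithinAt.mul ?_ ?_
    · exact (hg.comp (f := fun t => (t, σ * t)) (s := Ioc 0 T) (by fun_prop)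
        fun t ht => hsec t ht σ hσ) t₀ ht₀
    · exact (hx.continuousOn.comp (f := fun t => σ * t) (s := Ioc 0 T) (by fun_prop)
        fun t ht => hpos t ht σ hσ) t₀ ht₀

theorem mildSingular_integral_sector (ha : 0 ≤ a) (hab : a ≤ b) (hb : b ≤ 1) (hT : 0 < T)
    (hg : ContinuousOn (fun z : ℝ × ℝ => g z.1 z.2) (sector a b T)) (hx : MildSingular T x) :
    MildSingular T fun t => ∫ s in (a * t)..(b * t), g t s * x s := by
  refine ⟨continuousOn_integral_sector ha hab hb hT hg hx, ?_⟩
  obtain ⟨M, hM0, hM⟩ := exists_sector_bound hg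
  obtain ⟨C, hC0, hC⟩ := hx.exists_bound hT
  refine IsBigO.of_bound (2 * (M * C)) ?_
  filter_upwards [Ioo_mem_nhdsGT (lt_min one_pos hT)] with t ht
  have ht1 : t ≤ 1 := ht.2.le.trans (min_le_left _ _)
  have htT : t ∈ Ioc 0 T := ⟨ht.1, ht.2.le.trans (min_le_right _ _)⟩
  refine (abs_integral_le_of_bound ha hab hb ht.1.le (mul_nonneg hM0 hC0) fun s hs => ?_).trans ?_
  · have hs' : s ∈ Ioc 0 T := ⟨(mul_nonneg ha ht.1.le).trans_lt hs.1,
      (hs.2.le.trans (mul_le_of_le_one_left ht.1.le hb)).trans htT.2⟩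
    rw [abs_mul, mul_assoc]
    exact mul_le_mul (hM _ _ (mem_sector_of_mem_Icc htT (Ioo_subset_Icc_self hs))) (hC s hs')
      (abs_nonneg _) hM0
  · rw [Real.norm_of_nonneg (Real.rpow_nonneg ht.1.le _)]
    refine mul_le_mul_of_nonneg_left ?_ (by positivity)
    exact Real.rpow_le_rpow_of_exponent_ge ht.1 ht1 (by norm_num)

theorem mildSingular_ray {c : ℝ} (ha : 0 ≤ a) (hac : a ≤ c) (hcb : c ≤ b) (hb : b ≤ 1)
    (hT : 0 < T) (hg : ContinuousOn (fun z : ℝ × ℝ => g z.1 z.2) (sector a b T))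
    (hx : MildSingular T x) : MildSingular T fun t => c * g t (c * t) * x (c * t) := by
  -- For `c = 0` the value `x 0` is uncontrolled, but the factor `c` annihilates the term.
  rcases (ha.trans hac).eq_or_lt with rfl | hc
  · simpa using mildSingular_of_continuousOn hT continuousOn_const
  obtain ⟨M, hM0, hM⟩ := exists_sector_bound hg
  obtain ⟨C, hC0, hC⟩ := hx.exists_bound hT
  have hsec : ∀ t ∈ Ioc 0 T, (t, c * t) ∈ sector a b T := fun t ht =>
    mem_sector_of_mem_Icc ht ⟨by have := ht.1.le; gcongr, by have := ht.1.le; gcongr⟩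
  have hpos : ∀ t ∈ Ioc 0 T, c * t ∈ Ioc 0 T := fun t ht =>
    ⟨mul_pos hc ht.1, (mul_le_of_le_one_left ht.1.le (hcb.trans hb)).trans ht.2⟩
  refine ⟨(continuousOn_const.mul ?_).mul ?_, ?_⟩
  · exact hg.comp (f := fun t => (t, c * t)) (by fun_prop) hsec
  · exact hx.continuousOn.comp (by fun_prop) hpos
  · refine IsBigO.of_bound (c * M * (C * c ^ (-(1 / 2) : ℝ))) ?_
    filter_upwards [Ioo_mem_nhdsGT hT] with t ht
    have ht' := Ioo_subset_Ioc_self ht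
    rw [norm_mul, norm_mul, Real.norm_of_nonneg hc.le, mul_assoc (c * M),
      Real.norm_of_nonneg (Real.rpow_nonneg ht.1.le _)]
    refine mul_le_mul (mul_le_mul_of_nonneg_left (hM _ _ (hsec t ht')) hc.le)
      ((hC _ (hpos t ht')).trans_eq ?_) (norm_nonneg _) (by positivity)
    rw [Real.mul_rpow hc.le ht.1.le, mul_assoc]

theorem mildSingular_sectorDeriv (ha : 0 ≤ a) (hab : a ≤ b) (hb : b ≤ 1) (hT : 0 < T)
    (hk : ContinuousOn (fun z : ℝ × ℝ => k z.1 z.2) (sector a b T))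
    (hk' : ContinuousOn (fun z : ℝ × ℝ => k' z.1 z.2) (sector a b T)) (hx : MildSingular T x) :
    MildSingular T (sectorDeriv a b k k' x) := by
  have h1 := mildSingular_ray ha hab le_rfl hb hT hk hx
  have h2 := mildSingular_ray ha le_rfl hab hb hT hk hx
  have h3 := mildSingular_integral_sector ha hab hb hT hk' hx
  exact ⟨(h1.1.sub h2.1).add h3.1, (h1.2.sub h2.2).add h3.2⟩

theorem sectorDeriv_add (ha : 0 ≤ a) (hab : a ≤ b) (hb : b ≤ 1) (hT : 0 < T)
    (hk' : ContinuousOn (fun z : ℝ × ℝ => k' z.1 z.2) (sector a b T)) (hx : MildSingular T x)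
    (hy : MildSingular T y) {t : ℝ} (ht : t ∈ Ioc 0 T) :
    sectorDeriv a b k k' (fun s => x s + y s) t =
      sectorDeriv a b k k' x t + sectorDeriv a b k k' y t := by
  simp only [sectorDeriv, mul_add]
  rw [intervalIntegral.integral_add (intervalIntegrable_sector ha hab hb hT hk' hx ht)
    (intervalIntegrable_sector ha hab hb hT hk' hy ht)]
  ring

/-- The domain of the double integral of a sector up to time `t`. -/
def sectorUpTo (a b t : ℝ) : Set (ℝ × ℝ) :=
  {z | 0 < z.1 ∧ z.1 ≤ t ∧ a * z.1 < z.2 ∧ z.2 ≤ b * z.1}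

theorem measurableSet_sectorUpTo (a b t : ℝ) : MeasurableSet (sectorUpTo a b t) := by
  have : sectorUpTo a b t = {z | 0 < z.1} ∩ ({z | z.1 ≤ t} ∩ ({z | a * z.1 < z.2} ∩
      {z | z.2 ≤ b * z.1})) := by ext z; rfl
  rw [this]
  refine (measurableSet_lt ?_ ?_).inter ((measurableSet_le ?_ ?_).inter
    ((measurableSet_lt ?_ ?_).inter (measurableSet_le ?_ ?_))) <;> fun_prop

theorem integrableOn_sectorUpTo (ha : 0 ≤ a) (hb : b ≤ 1) (hT : 0 < T)
    (hg : ContinuousOn (fun z : ℝ × ℝ => g z.1 z.2) (sector a b T)) (hx : MildSingular T x)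
    {t : ℝ} (ht : t ∈ Ioc 0 T) :
    IntegrableOn (fun z : ℝ × ℝ => g z.1 z.2 * x z.2) (sectorUpTo a b t)
      (volume.prod volume) := by
  obtain ⟨M, hM0, hM⟩ := exists_sector_bound hg
  obtain ⟨C, hC0, hC⟩ := hx.exists_bound hT
  have hsub : ∀ z ∈ sectorUpTo a b t, z.1 ∈ Ioc 0 t ∧ z.2 ∈ Ioc 0 t ∧ z ∈ sector a b T := by
    rintro z ⟨h1, h2, h3, h4⟩
    exact ⟨⟨h1, h2⟩, ⟨(mul_nonneg ha h1.le).trans_lt h3,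
      (h4.trans (mul_le_of_le_one_left h1.le hb)).trans h2⟩, h1.le, h2.trans ht.2, h3.le, h4⟩
  have hint : IntegrableOn (fun z : ℝ × ℝ => (M * C) * z.2 ^ (-(1 / 2) : ℝ)) (Ioc 0 t ×ˢ Ioc 0 t)
      (volume.prod volume) := by
    rw [IntegrableOn, ← Measure.prod_restrict]
    refine Integrable.mul_prod (f := fun _ => M * C) (g := fun s : ℝ => s ^ (-(1 / 2) : ℝ))
      (integrable_const _) ?_
    have := intervalIntegral.intervalIntegrable_rpow' (a := 0) (b := t) (r := (-(1 / 2) : ℝ))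
      (by norm_num)
    rwa [intervalIntegrable_iff_integrableOn_Ioc_of_le ht.1.le] at this
  refine Integrable.mono' (hint.mono_set fun z hz => ⟨(hsub z hz).1, (hsub z hz).2.1⟩) ?_ ?_
  · refine ContinuousOn.aestronglyMeasurable ?_ (measurableSet_sectorUpTo a b t)
    exact (hg.mono fun z hz => (hsub z hz).2.2).mul
      (hx.continuousOn.comp continuous_snd.continuousOn
        fun z hz => Ioc_subset_Ioc_right ht.2 (hsub z hz).2.1)
  · filter_upwards [ae_restrict_mem (measurableSet_sectorUpTo a b t)] with z hz
    obtain ⟨h1, h2, h3⟩ := hsub z hz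
    rw [norm_mul, mul_assoc]
    exact mul_le_mul (hM _ _ h3) (hC _ (Ioc_subset_Ioc_right ht.2 h2)) (norm_nonneg _) hM0

/-- Fundamental theorem of calculus in the first variable at fixed `s`. The slice stays in the
sector because `s / b ≤ τ` and `a * τ ≤ a * c ≤ s`. -/
theorem integral_partial (hb : 0 < b)
    (hk' : ContinuousOn (fun z : ℝ × ℝ => k' z.1 z.2) (sector a b T))
    (hd : ∀ t s, (t, s) ∈ sector a b T → HasDerivWithinAt (fun τ => k τ s) (k' t s)
      {τ | (τ, s) ∈ sector a b T} t) {s c : ℝ} (hs : 0 < s) (hsc : s / b ≤ c) (hcT : c ≤ T)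
    (ha : 0 ≤ a) (hac : a * c ≤ s) : ∫ τ in (s / b)..c, k' τ s = k c s - k (s / b) s := by
  have hmem : ∀ τ ∈ Icc (s / b) c, (τ, s) ∈ sector a b T := fun τ hτ =>
    ⟨(div_pos hs hb).le.trans hτ.1, hτ.2.trans hcT,
      (mul_le_mul_of_nonneg_left hτ.2 ha).trans hac, by
        have := (div_le_iff₀ hb).1 hτ.1; simp only; linarith⟩
  refine intervalIntegral.integral_eq_sub_of_hasDerivAt_of_le
    (f := fun τ => k τ s) (f' := fun τ => k' τ s) hsc ?_ ?_ ?_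
  · exact fun τ hτ => ((hd τ s (hmem τ hτ)).mono fun τ' hτ' => hmem τ' hτ').continuousWithinAt
  · exact fun τ hτ => (hd τ s (hmem τ (Ioo_subset_Icc_self hτ))).hasDerivAt
      (mem_of_superset (Icc_mem_nhds hτ.1 hτ.2) hmem)
  · refine ContinuousOn.intervalIntegrable ?_
    rw [uIcc_of_le hsc]
    exact hk'.comp (f := fun τ => (τ, s)) (by fun_prop) hmem

end Sector

/-! ### Differentiated form of a sector integral, by exchanging integrations -/

section Sector

variable {a b T : ℝ} {g k k' : ℝ → ℝ → ℝ} {x y : ℝ → ℝ}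

/-- The double integral of the partial derivative, with the order of integration exchanged. -/
theorem integral_integral_partial (ha : 0 ≤ a) (hab : a < b) (hb : b ≤ 1) (hT : 0 < T)
    (hk' : ContinuousOn (fun z : ℝ × ℝ => k' z.1 z.2) (sector a b T))
    (hd : ∀ t s, (t, s) ∈ sector a b T → HasDerivWithinAt (fun τ => k τ s) (k' t s)
      {τ | (τ, s) ∈ sector a b T} t) (hx : MildSingular T x) {t : ℝ} (ht : t ∈ Ioc 0 T) :
    ∫ τ in (0 : ℝ)..t, ∫ s in (a * τ)..(b * τ), k' τ s * x s =
      ∫ s in (0 : ℝ)..(b * t),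
        (k (if s ≤ a * t then s / a else t) s * x s - k (s / b) s * x s) := by
  have hb0 : 0 < b := ha.trans_lt hab
  have hsw := integral_integral_swap (μ := (volume : Measure ℝ)) (ν := (volume : Measure ℝ))
    (f := fun τ s => (sectorUpTo a b t).indicator (fun z => k' z.1 z.2 * x z.2) (τ, s))
    ((integrableOn_sectorUpTo ha hb hT hk' hx ht).integrable_indicator
      (measurableSet_sectorUpTo a b t))
  have hl : ∀ τ, ∫ s, (sectorUpTo a b t).indicator (fun z => k' z.1 z.2 * x z.2) (τ, s) =
      (Ioc 0 t).indicator (fun τ => ∫ s in (a * τ)..(b * τ), k' τ s * x s) τ := by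
    intro τ
    by_cases hτ : τ ∈ Ioc 0 t
    · rw [indicator_of_mem hτ, intervalIntegral.integral_of_le (by gcongr; exact hτ.1.le),
        ← integral_indicator measurableSet_Ioc]
      congr 1
      ext s
      by_cases hs : s ∈ Ioc (a * τ) (b * τ)
      · rw [indicator_of_mem hs, indicator_of_mem (show (τ, s) ∈ sectorUpTo a b t from
          ⟨hτ.1, hτ.2, hs.1, hs.2⟩)]
      · rw [indicator_of_notMem hs, indicator_of_notMem
          (fun h : (τ, s) ∈ sectorUpTo a b t => hs ⟨h.2.2.1, h.2.2.2⟩)]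
    · rw [indicator_of_notMem hτ]
      refine integral_eq_zero_of_ae (Eventually.of_forall fun s => ?_)
      exact indicator_of_notMem (fun h : (τ, s) ∈ sectorUpTo a b t => hτ ⟨h.1, h.2.1⟩) _
  have hr : ∀ s, ∫ τ, (sectorUpTo a b t).indicator (fun z => k' z.1 z.2 * x z.2) (τ, s) =
      (Ioc 0 (b * t)).indicator (fun s => k (if s ≤ a * t then s / a else t) s * x s -
        k (s / b) s * x s) s := by
    intro s
    by_cases hs : s ∈ Ioc 0 (b * t)
    · rw [indicator_of_mem hs]
      have hst : s / b ≤ t := by rw [div_le_iff₀ hb0]; linarith [hs.2]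
      have hsb : 0 < s / b := div_pos hs.1 hb0
      -- At fixed `s` the variable `τ` runs from `s / b` to `min (s / a) t`, which the `if` encodes.
      -- When `a = 0` the first case is empty for `s > 0`, so the quotient by zero never matters.
      by_cases hsa : s ≤ a * t
      · rw [if_pos hsa]
        have ha0 : 0 < a := by
          by_contra h
          have : a = 0 := le_antisymm (not_lt.1 h) ha
          rw [this, zero_mul] at hsa
          exact absurd hs.1 (not_lt.2 hsa)
        have hle : s / b ≤ s / a := div_le_div_of_nonneg_left hs.1.le ha0 hab.le
        have hat : s / a ≤ t := by rw [div_le_iff₀ ha0]; linarith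
        have e : (fun τ => (sectorUpTo a b t).indicator (fun z => k' z.1 z.2 * x z.2) (τ, s)) =
            (Ico (s / b) (s / a)).indicator fun τ => k' τ s * x s := by
          ext τ
          by_cases hτ : τ ∈ Ico (s / b) (s / a)
          · rw [indicator_of_mem hτ, indicator_of_mem]
            have h1 := (div_le_iff₀ hb0).1 hτ.1
            have h2 := (lt_div_iff₀ ha0).1 hτ.2
            exact ⟨hsb.trans_le hτ.1, hτ.2.le.trans hat, by simp only; linarith,
              by simp only; linarith⟩
          · rw [indicator_of_notMem hτ, indicator_of_notMem]
            rintro ⟨-, -, h3, h4⟩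
            exact hτ ⟨(div_le_iff₀ hb0).2 (by simp only at h4; linarith),
              (lt_div_iff₀ ha0).2 (by simp only at h3; linarith)⟩
        rw [e, integral_indicator measurableSet_Ico, integral_Ico_eq_integral_Ioo,
          ← integral_Ioc_eq_integral_Ioo, ← intervalIntegral.integral_of_le hle,
          intervalIntegral.integral_mul_const, integral_partial hb0 hk' hd hs.1 hle
            (hat.trans ht.2) ha (by rw [mul_div_cancel₀ _ ha0.ne']), sub_mul]
      · rw [if_neg hsa]
        have e : (fun τ => (sectorUpTo a b t).indicator (fun z => k' z.1 z.2 * x z.2) (τ, s)) =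
            (Icc (s / b) t).indicator fun τ => k' τ s * x s := by
          ext τ
          by_cases hτ : τ ∈ Icc (s / b) t
          · rw [indicator_of_mem hτ, indicator_of_mem]
            have h1 := (div_le_iff₀ hb0).1 hτ.1
            have h2 := mul_le_mul_of_nonneg_left hτ.2 ha
            exact ⟨hsb.trans_le hτ.1, hτ.2, by simp only; linarith, by simp only; linarith⟩
          · rw [indicator_of_notMem hτ, indicator_of_notMem]
            rintro ⟨-, h2, -, h4⟩
            exact hτ ⟨(div_le_iff₀ hb0).2 (by simp only at h4; linarith), h2⟩
        rw [e, integral_indicator measurableSet_Icc, integral_Icc_eq_integral_Ioc,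
          ← intervalIntegral.integral_of_le hst,
          intervalIntegral.integral_mul_const, integral_partial hb0 hk' hd hs.1 hst
            ht.2 ha (not_le.1 hsa).le, sub_mul]
    · rw [indicator_of_notMem hs]
      refine integral_eq_zero_of_ae (Eventually.of_forall fun τ => ?_)
      refine indicator_of_notMem (fun h : (τ, s) ∈ sectorUpTo a b t => hs ⟨?_, ?_⟩) _
      · exact (mul_nonneg ha h.1.le).trans_lt h.2.2.1
      · exact h.2.2.2.trans (mul_le_mul_of_nonneg_left h.2.1 hb0.le)
  simp only [hl, hr] at hsw
  rw [integral_indicator measurableSet_Ioc, integral_indicator measurableSet_Ioc] at hsw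
  rwa [intervalIntegral.integral_of_le ht.1.le,
    intervalIntegral.integral_of_le (mul_nonneg hb0.le ht.1.le)]

theorem intervalIntegrable_ray {c : ℝ} (ha : 0 ≤ a) (hac : a ≤ c) (hcb : c ≤ b) (hb : b ≤ 1)
    (hT : 0 < T) (hc : 0 < c) (hg : ContinuousOn (fun z : ℝ × ℝ => g z.1 z.2) (sector a b T))
    (hx : MildSingular T x) {t : ℝ} (ht : t ∈ Ioc 0 T) :
    IntervalIntegrable (fun s => g (s / c) s * x s) volume 0 (c * t) := by
  have h1 := ((mildSingular_ray ha hac hcb hb hT hg hx).intervalIntegrable hT ht).const_mul c⁻¹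
  have h2 := h1.comp_mul_left (c := c⁻¹)
  rw [zero_div, div_inv_eq_mul, mul_comm t c] at h2
  refine h2.congr_uIoo fun s _ => ?_
  simp only [mul_assoc]
  rw [inv_mul_cancel_left₀ hc.ne', mul_inv_cancel_left₀ hc.ne', div_eq_inv_mul]

theorem integral_ray {c : ℝ} (hc : 0 < c) (g : ℝ → ℝ → ℝ) (x : ℝ → ℝ) (t : ℝ) :
    ∫ τ in (0 : ℝ)..t, c * g τ (c * τ) * x (c * τ) =
      ∫ s in (0 : ℝ)..(c * t), g (s / c) s * x s := by
  have := intervalIntegral.mul_integral_comp_mul_left (a := 0) (b := t)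
    (f := fun s => g (s / c) s * x s) c
  rw [mul_zero] at this
  rw [← this, ← intervalIntegral.integral_const_mul]
  refine intervalIntegral.integral_congr fun τ _ => ?_
  simp only [mul_div_cancel_left₀ _ hc.ne', mul_assoc]

/-- The integrated form of the Leibniz rule, which never evaluates `k` off its sector in a
difference quotient. Exchanging the integrations in the double integral of `k'` leaves the terms `k
(s / a) s` and `k (s / b) s`; the substitutions `s = a τ` and `s = b τ` show that they cancel the
two ray terms of `sectorDeriv`. -/
theorem integral_sector_eq (ha : 0 ≤ a) (hab : a < b) (hb : b ≤ 1) (hT : 0 < T)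
    (hk : ContinuousOn (fun z : ℝ × ℝ => k z.1 z.2) (sector a b T))
    (hk' : ContinuousOn (fun z : ℝ × ℝ => k' z.1 z.2) (sector a b T))
    (hd : ∀ t s, (t, s) ∈ sector a b T → HasDerivWithinAt (fun τ => k τ s) (k' t s)
      {τ | (τ, s) ∈ sector a b T} t) (hx : MildSingular T x) {t : ℝ} (ht : t ∈ Ioc 0 T) :
    ∫ s in (a * t)..(b * t), k t s * x s = ∫ τ in (0 : ℝ)..t, sectorDeriv a b k k' x τ := by
  have hb0 : 0 < b := ha.trans_lt hab
  have i1 := (mildSingular_ray ha hab.le le_rfl hb hT hk hx).intervalIntegrable hT ht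
  have i2 := (mildSingular_ray ha le_rfl hab.le hb hT hk hx).intervalIntegrable hT ht
  have i3 := (mildSingular_integral_sector ha hab.le hb hT hk' hx).intervalIntegrable hT ht
  have j1 := intervalIntegrable_sector ha hab.le hb hT hk hx ht
  have j2 := intervalIntegrable_ray ha hab.le le_rfl hb hT hb0 hk hx ht
  have hat : 0 ≤ a * t := mul_nonneg ha ht.1.le
  have habt : a * t ≤ b * t := by gcongr; exact ht.1.le
  have e1 : EqOn (fun s => k (if s ≤ a * t then s / a else t) s * x s)
      (fun s => k (s / a) s * x s) (Ioo 0 (a * t)) := fun s hs => by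
    simp only [if_pos hs.2.le]
  have e2 : EqOn (fun s => k (if s ≤ a * t then s / a else t) s * x s)
      (fun s => k t s * x s) (Ioo (a * t) (b * t)) := fun s hs => by
    simp only [if_neg (not_le.2 hs.1)]
  have j3 : IntervalIntegrable (fun s => k (if s ≤ a * t then s / a else t) s * x s) volume
      (a * t) (b * t) := by
    refine j1.congr_uIoo ?_
    rw [uIoo_of_le habt]
    exact e2.symm
  have j4 : IntervalIntegrable (fun s => k (if s ≤ a * t then s / a else t) s * x s) volume
      0 (a * t) := by
    rcases ha.eq_or_lt with rfl | ha0
    · simp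
    · refine (intervalIntegrable_ray ha le_rfl hab.le hb hT ha0 hk hx ht).congr_uIoo ?_
      rw [uIoo_of_le hat]
      exact e1.symm
  have h4 : ∫ s in (0 : ℝ)..(a * t), k (if s ≤ a * t then s / a else t) s * x s =
      ∫ τ in (0 : ℝ)..t, a * k τ (a * τ) * x (a * τ) := by
    rcases ha.eq_or_lt with rfl | ha0
    · simp
    · rw [integral_ray ha0]
      exact intervalIntegral.integral_congr_Ioo_of_le hat e1
  simp only [sectorDeriv]
  rw [intervalIntegral.integral_add (i1.sub i2) i3, intervalIntegral.integral_sub i1 i2,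
    integral_integral_partial ha hab hb hT hk' hd hx ht,
    intervalIntegral.integral_sub (j4.trans j3) j2, integral_ray hb0,
    ← intervalIntegral.integral_add_adjacent_intervals j4 j3, h4,
    intervalIntegral.integral_congr_Ioo_of_le habt e2]
  ring

end Sector

/-! ### The derivative of the whole Volterra integral -/

section Volterra

variable {n : ℕ} {α : ℕ → ℝ} {K K' : ℕ → ℝ → ℝ → ℝ} {T : ℝ} {x y : ℝ → ℝ}

/-- The derivative of the Volterra integral. -/
noncomputable def volterraDeriv (n : ℕ) (α : ℕ → ℝ) (K K' : ℕ → ℝ → ℝ → ℝ) (x : ℝ → ℝ) (t : ℝ) :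
    ℝ :=
  ∑ i ∈ Finset.range n, sectorDeriv (α i) (α (i + 1)) (K (i + 1)) (K' (i + 1)) x t

/-- The nodes `0 = α 0 < α 1 < ⋯ < α n = 1`. -/
structure IsNodes (n : ℕ) (α : ℕ → ℝ) : Prop where
  zero : α 0 = 0
  last : α n = 1
  lt : ∀ i < n, α i < α (i + 1)

namespace IsNodes

variable (hα : IsNodes n α)
include hα

theorem le_of_le {i j : ℕ} (hij : i ≤ j) (hj : j ≤ n) : α i ≤ α j := by
  induction j, hij using Nat.le_induction with
  | base => exact le_rfl
  | succ j _ ih => exact (ih (by omega)).trans (hα.lt j (by omega)).le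

theorem nonneg {i : ℕ} (hi : i ≤ n) : 0 ≤ α i := hα.zero ▸ hα.le_of_le (Nat.zero_le i) hi

theorem le_one {i : ℕ} (hi : i ≤ n) : α i ≤ 1 := hα.last ▸ hα.le_of_le hi le_rfl

theorem ne_zero : n ≠ 0 := by
  rintro rfl
  have := hα.zero.symm.trans hα.last
  norm_num at this

theorem kernel_eq {i : ℕ} (hi : i < n) {t s : ℝ} (ht : 0 ≤ t)
    (hs : s ∈ Ioo (α i * t) (α (i + 1) * t)) : kernel n α K t s = K (i + 1) t s := by
  rw [kernel, Finset.sum_eq_single i]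
  · rw [if_pos ⟨hs.1.le, Or.inl hs.2⟩]
  · intro j hj hji
    rw [Finset.mem_range] at hj
    refine if_neg ?_
    rintro ⟨h1, h2⟩
    rcases lt_or_gt_of_ne hji with h | h
    · have := mul_le_mul_of_nonneg_right (hα.le_of_le (Nat.succ_le_of_lt h) hi.le) ht
      rw [Nat.succ_eq_add_one] at this
      have h3 := hs.1
      rcases h2 with h2 | h2
      · linarith
      · linarith [h2.2]
    · have := mul_le_mul_of_nonneg_right (hα.le_of_le (Nat.succ_le_of_lt h) hj.le) ht
      rw [Nat.succ_eq_add_one] at this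
      linarith [hs.2]
  · intro h
    exact absurd (Finset.mem_range.2 hi) h

end IsNodes

theorem intervalIntegrable_kernel_sector (hα : IsNodes n α) (hT : 0 < T)
    (hK : KernelRegular n α K K' T) (hx : MildSingular T x) {t : ℝ} (ht : t ∈ Ioc 0 T)
    {i : ℕ} (hi : i < n) :
    IntervalIntegrable (fun s => kernel n α K t s * x s) volume (α i * t) (α (i + 1) * t) := by
  refine (intervalIntegrable_sector (hα.nonneg hi.le) (hα.lt i hi).le (hα.le_one hi) hT
    (hK.cont i hi) hx ht).congr_uIoo ?_
  rw [uIoo_of_le (mul_le_mul_of_nonneg_right (hα.lt i hi).le ht.1.le)]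
  intro s hs
  simp only [hα.kernel_eq hi ht.1.le hs]

theorem intervalIntegrable_kernel (hα : IsNodes n α) (hT : 0 < T)
    (hK : KernelRegular n α K K' T) (hx : MildSingular T x) {t : ℝ} (ht : t ∈ Ioc 0 T) :
    IntervalIntegrable (fun s => kernel n α K t s * x s) volume 0 t := by
  have := IntervalIntegrable.trans_iterate (a := fun i => α i * t) (n := n) fun i hi =>
    intervalIntegrable_kernel_sector hα hT hK hx ht hi
  simpa [hα.zero, hα.last] using this

theorem mildSingular_volterraDeriv (hα : IsNodes n α) (hT : 0 < T)
    (hK : KernelRegular n α K K' T) (hx : MildSingular T x) :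
    MildSingular T (volterraDeriv n α K K' x) := by
  have h : ∀ i ∈ Finset.range n,
      MildSingular T (sectorDeriv (α i) (α (i + 1)) (K (i + 1)) (K' (i + 1)) x) := fun i hi => by
    rw [Finset.mem_range] at hi
    exact mildSingular_sectorDeriv (hα.nonneg hi.le) (hα.lt i hi).le (hα.le_one hi) hT
      (hK.cont i hi) (hK.cont' i hi) hx
  exact ⟨continuousOn_finsetSum _ fun i hi => (h i hi).1, IsBigO.fun_sum fun i hi => (h i hi).2⟩

theorem volterra_eq_integral (hα : IsNodes n α) (hT : 0 < T)
    (hK : KernelRegular n α K K' T) (hx : MildSingular T x) {t : ℝ} (ht : t ∈ Ioc 0 T) :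
    volterra n α K x t = ∫ τ in (0 : ℝ)..t, volterraDeriv n α K K' x τ := by
  have h1 := intervalIntegral.sum_integral_adjacent_intervals (a := fun i => α i * t) (n := n)
    fun i hi => intervalIntegrable_kernel_sector hα hT hK hx ht hi
  rw [hα.zero, hα.last, zero_mul, one_mul] at h1
  simp only [volterraDeriv]
  rw [volterra, ← h1, intervalIntegral.integral_finsetSum]
  · refine Finset.sum_congr rfl fun i hi => ?_
    rw [Finset.mem_range] at hi
    rw [← integral_sector_eq (hα.nonneg hi.le) (hα.lt i hi) (hα.le_one hi) hT (hK.cont i hi)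
      (hK.cont' i hi) (hK.hasDeriv i hi) hx ht]
    refine intervalIntegral.integral_congr_Ioo_of_le
      (mul_le_mul_of_nonneg_right (hα.lt i hi).le ht.1.le) fun s hs => ?_
    simp only [hα.kernel_eq hi ht.1.le hs]
  · intro i hi
    rw [Finset.mem_range] at hi
    exact (mildSingular_sectorDeriv (hα.nonneg hi.le) (hα.lt i hi).le (hα.le_one hi) hT
      (hK.cont i hi) (hK.cont' i hi) hx).intervalIntegrable hT ht

theorem volterra_add (hα : IsNodes n α) (hT : 0 < T)
    (hK : KernelRegular n α K K' T) (hx : MildSingular T x) (hy : MildSingular T y)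
    {t : ℝ} (ht : t ∈ Ioc 0 T) :
    volterra n α K (fun s => x s + y s) t = volterra n α K x t + volterra n α K y t := by
  simp only [volterra, mul_add]
  exact intervalIntegral.integral_add (intervalIntegrable_kernel hα hT hK hx ht)
    (intervalIntegrable_kernel hα hT hK hy ht)

theorem hasDerivWithinAt_integral (hT : 0 < T) (hx : MildSingular T x) {t : ℝ}
    (ht : t ∈ Ioc 0 T) :
    HasDerivWithinAt (fun t => ∫ s in (0 : ℝ)..t, x s) (x t) (Ioc 0 T) t := by
  -- Since `x` may be singular at zero, the fundamental theorem is applied on `[t / 2, T]`, a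
  -- neighbourhood of `t` within `(0, T]`.
  have hc : ContinuousOn x (Icc (t / 2) T) :=
    hx.continuousOn.mono fun s hs => ⟨(half_pos ht.1).trans_le hs.1, hs.2⟩
  have hmem : t ∈ Icc (t / 2) T := ⟨(half_lt_self ht.1).le, ht.2⟩
  have : Fact (t ∈ Icc (t / 2) T) := ⟨hmem⟩
  have h := intervalIntegral.integral_hasDerivWithinAt_right (s := Icc (t / 2) T)
    (t := Icc (t / 2) T) (hx.intervalIntegrable hT ht)
    ⟨_, self_mem_nhdsWithin, hc.aestronglyMeasurable measurableSet_Icc⟩ (hc t hmem)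
  refine h.mono_of_mem_nhdsWithin ?_
  filter_upwards [self_mem_nhdsWithin,
    mem_nhdsWithin_of_mem_nhds (Ioi_mem_nhds (half_lt_self ht.1))] with s hs hs2
  exact ⟨le_of_lt hs2, hs.2⟩

theorem hasDerivWithinAt_volterra (hα : IsNodes n α) (hT : 0 < T)
    (hK : KernelRegular n α K K' T) (hx : MildSingular T x) {t : ℝ} (ht : t ∈ Ioc 0 T) :
    HasDerivWithinAt (volterra n α K x) (volterraDeriv n α K K' x t) (Ioc 0 T) t :=
  (hasDerivWithinAt_integral hT (mildSingular_volterraDeriv hα hT hK hx) ht).congr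
    (fun _ hs => volterra_eq_integral hα hT hK hx hs) (volterra_eq_integral hα hT hK hx ht)

theorem integral_derivWithin_eq {f : ℝ → ℝ} (hT : 0 < T) (hf : ContDiffOn ℝ 1 f (Icc 0 T))
    (hf0 : f 0 = 0) {t : ℝ} (ht : t ∈ Ioc 0 T) :
    ∫ s in (0 : ℝ)..t, derivWithin f (Icc 0 T) s = f t := by
  have hd := hf.differentiableOn one_ne_zero
  have hsub : Icc 0 t ⊆ Icc 0 T := Icc_subset_Icc_right ht.2
  rw [intervalIntegral.integral_eq_sub_of_hasDerivAt_of_le (f := f) ht.1.le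
    (hf.continuousOn.mono hsub) ?_ ?_, hf0, sub_zero]
  · intro s hs
    exact (hd s (hsub (Ioo_subset_Icc_self hs))).hasDerivWithinAt.hasDerivAt
      (Icc_mem_nhds hs.1 (hs.2.trans_le ht.2))
  · refine ContinuousOn.intervalIntegrable ?_
    rw [uIcc_of_le ht.1.le]
    exact (hf.continuousOn_derivWithin (uniqueDiffOn_Icc hT) le_rfl).mono hsub

end Volterra

/-! ### Contractions in exponentially weighted norms -/

section FixedPoint

variable {T ω κ : ℝ}

/-- Banach's fixed point theorem in `C[0,T]` with an exponentially weighted norm. -/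
theorem exists_weighted_fixedPoint (hT : 0 ≤ T) (hκ : 0 ≤ κ) (hκ1 : κ < 1)
    {Φ : (ℝ → ℝ) → ℝ → ℝ}
    (hc : ∀ u, ContinuousOn u (Icc 0 T) → ContinuousOn (Φ u) (Icc 0 T))
    (hΦ : ∀ u v, ContinuousOn u (Icc 0 T) → ContinuousOn v (Icc 0 T) → ∀ B, 0 ≤ B →
      (∀ s ∈ Icc 0 T, |u s - v s| ≤ B * Real.exp (ω * s)) →
      ∀ t ∈ Icc 0 T, |Φ u t - Φ v t| ≤ κ * B * Real.exp (ω * t)) :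
    ∃ u, ContinuousOn u (Icc 0 T) ∧ EqOn (Φ u) u (Icc 0 T) := by
  -- Multiplication by `exp (ω s)` carries the sup norm to the weighted one, so conjugating `Φ` by
  -- it gives a contraction for the usual metric of `C[0,T]`.
  let lift : C(Icc 0 T, ℝ) → ℝ → ℝ := fun v s => Real.exp (ω * s) * IccExtend hT v s
  have hlift : ∀ v, ContinuousOn (lift v) (Icc 0 T) := fun v =>
    (Continuous.mul (by fun_prop) (v.continuous.Icc_extend')).continuousOn
  let Ψ : C(Icc 0 T, ℝ) → C(Icc 0 T, ℝ) := fun v =>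
    ⟨fun t => Real.exp (-(ω * t)) * Φ (lift v) t,
      Continuous.mul (by fun_prop) (continuousOn_iff_continuous_domRestrict.1 (hc _ (hlift v)))⟩
  have hΨ : ContractingWith κ.toNNReal Ψ := by
    refine ⟨Real.toNNReal_lt_one.2 hκ1, LipschitzWith.of_dist_le_mul fun v w => ?_⟩
    rw [Real.coe_toNNReal κ hκ, ContinuousMap.dist_le (mul_nonneg hκ dist_nonneg)]
    intro t
    have h1 := hΦ (lift v) (lift w) (hlift v) (hlift w) (dist v w) dist_nonneg (fun s hs => by
      simp only [lift]
      rw [IccExtend_of_mem hT _ hs, IccExtend_of_mem hT _ hs, ← mul_sub, abs_mul, Real.abs_exp,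
        mul_comm]
      exact mul_le_mul_of_nonneg_right (ContinuousMap.dist_apply_le_dist (f := v) (g := w) _)
        (Real.exp_pos _).le) t t.2
    rw [Real.dist_eq]
    simp only [Ψ, ContinuousMap.coe_mk]
    rw [← mul_sub, abs_mul, Real.abs_exp]
    calc Real.exp (-(ω * t)) * |Φ (lift v) t - Φ (lift w) t|
        ≤ Real.exp (-(ω * t)) * (κ * dist v w * Real.exp (ω * t)) := by gcongr
      _ = κ * dist v w := by
        rw [mul_comm, mul_assoc, ← Real.exp_add, add_neg_cancel, Real.exp_zero, mul_one]
  obtain ⟨v, hv, -⟩ := hΨ.exists_fixedPoint 0 (edist_ne_top _ _)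
  refine ⟨lift v, hlift v, fun t ht => ?_⟩
  have h2 : Real.exp (-(ω * t)) * Φ (lift v) t = v ⟨t, ht⟩ :=
    congrArg (fun w : C(Icc 0 T, ℝ) => w ⟨t, ht⟩) hv
  simp only [lift]
  rw [IccExtend_of_mem hT _ ht, ← h2, ← mul_assoc, ← Real.exp_add, add_neg_cancel, Real.exp_zero,
    one_mul]

theorem exists_weighted_bound (ω : ℝ) {w : ℝ → ℝ} (hw : ContinuousOn w (Icc 0 T)) :
    ∃ B, 0 ≤ B ∧ ∀ t ∈ Icc 0 T, |w t| ≤ B * Real.exp (ω * t) := by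
  obtain ⟨B, hB⟩ := isCompact_Icc.exists_bound_of_continuousOn
    (f := fun t => Real.exp (-(ω * t)) * w t) (ContinuousOn.mul (by fun_prop) hw)
  refine ⟨max 0 B, le_max_left _ _, fun t ht => ?_⟩
  have := (hB t ht).trans (le_max_right 0 B)
  rw [Real.norm_eq_abs, abs_mul, Real.abs_exp, Real.exp_neg, inv_mul_eq_div,
    div_le_iff₀ (Real.exp_pos _)] at this
  exact this

/-- Taking for `B` the attained maximum of `|w t| exp (-ω t)` turns the hypothesis into `B ≤ κ B +
ε`. With `ε = 0` this gives uniqueness. -/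
theorem weighted_bound_of_contraction (hT : 0 ≤ T) (hκ1 : κ < 1) {ε : ℝ} {w : ℝ → ℝ}
    (hw : ContinuousOn w (Icc 0 T))
    (h : ∀ B, 0 ≤ B → (∀ s ∈ Icc 0 T, |w s| ≤ B * Real.exp (ω * s)) →
      ∀ t ∈ Icc 0 T, |w t| ≤ (κ * B + ε) * Real.exp (ω * t)) :
    ∀ t ∈ Icc 0 T, |w t| ≤ ε / (1 - κ) * Real.exp (ω * t) := by
  have hc : ContinuousOn (fun t => |w t| * Real.exp (-(ω * t))) (Icc 0 T) :=
    hw.abs.mul (by fun_prop)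
  obtain ⟨t₀, ht₀, hmax⟩ := isCompact_Icc.exists_isMaxOn (nonempty_Icc.2 hT) hc
  set B := |w t₀| * Real.exp (-(ω * t₀)) with hB
  have hB0 : 0 ≤ B := by positivity
  have e : ∀ t, |w t| = |w t| * Real.exp (-(ω * t)) * Real.exp (ω * t) := fun t => by
    rw [mul_assoc, ← Real.exp_add, neg_add_cancel, Real.exp_zero, mul_one]
  have hle : ∀ s ∈ Icc 0 T, |w s| ≤ B * Real.exp (ω * s) := fun s hs => by
    rw [e s]
    exact mul_le_mul_of_nonneg_right (hmax hs) (Real.exp_pos _).le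
  have h0 := h B hB0 hle t₀ ht₀
  rw [e t₀, ← hB] at h0
  have h1 : B ≤ κ * B + ε := le_of_mul_le_mul_right h0 (Real.exp_pos _)
  have h2 : B ≤ ε / (1 - κ) := by
    rw [le_div_iff₀ (by linarith)]; linarith
  exact fun t ht => (hle t ht).trans (mul_le_mul_of_nonneg_right h2 (Real.exp_pos _).le)

theorem eqOn_Icc_of_eqOn_Ioc (hT : 0 < T) {u v : ℝ → ℝ} (hu : ContinuousOn u (Icc 0 T))
    (hv : ContinuousOn v (Icc 0 T)) (h : EqOn u v (Ioc 0 T)) : EqOn u v (Icc 0 T) :=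
  h.of_subset_closure hu hv Ioc_subset_Icc_self (by rw [closure_Ioc hT.ne])

end FixedPoint

/-! ### The operators `L` and `V`: bounds, solvability, iterations -/

section Operators

variable {n N : ℕ} {α : ℕ → ℝ} {K K' : ℕ → ℝ → ℝ → ℝ} {T q : ℝ} {u v : ℝ → ℝ}

/-- Condition A with the diagonal value moved to the right-hand side. -/
structure DiagBound (n : ℕ) (α : ℕ → ℝ) (K : ℕ → ℝ → ℝ → ℝ) (T : ℝ) (N : ℕ) (q : ℝ) : Prop where
  nonneg : 0 ≤ q
  lt_one : q < 1
  ne_zero : ∀ t ∈ Icc 0 T, K n t t ≠ 0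
  bound : ∀ t ∈ Icc 0 T, ∑ i ∈ Finset.range n,
    (α (i + 1) ^ (1 + N) * |K (i + 1) t (α (i + 1) * t)| +
      α i ^ (1 + N) * |K (i + 1) t (α i * t)|) ≤ (1 + q) * |K n t t|

theorem ConditionA.exists_diagBound (hA : ConditionA n α K T N) : ∃ q, DiagBound n α K T N q := by
  obtain ⟨h0, q, hq, h⟩ := hA
  refine ⟨max q 0, le_max_right _ _, max_lt hq one_pos, h0, fun t ht => ?_⟩
  have h1 := h t ht
  have hp : 0 < |K n t t| := abs_pos.2 (h0 t ht)
  rw [inv_mul_le_iff₀ hp, mul_comm] at h1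
  refine h1.trans ?_
  gcongr
  exact le_max_left _ _

theorem continuousOn_ray (hK : KernelRegular n α K K' T) {i : ℕ} (hi : i < n) {c : ℝ}
    (h1 : α i ≤ c) (h2 : c ≤ α (i + 1)) :
    ContinuousOn (fun t => K (i + 1) t (c * t)) (Icc 0 T) :=
  (hK.cont i hi).comp (f := fun t => (t, c * t)) (by fun_prop) fun t ht =>
    ⟨ht.1, ht.2, mul_le_mul_of_nonneg_right h1 ht.1, mul_le_mul_of_nonneg_right h2 ht.1⟩

theorem opL_sub (t : ℝ) :
    opL n α K N (fun s => u s - v s) t = opL n α K N u t - opL n α K N v t := by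
  rw [opL, opL, opL, ← sub_div, ← Finset.sum_sub_distrib]
  congr 1
  exact Finset.sum_congr rfl fun i _ => by ring

/-- Dividing by `t ^ N` turns `(α i * t) ^ N` into `α i ^ N`, which joins the endpoint factor `α i`,
and `s ^ N` into `(s / t) ^ N`. -/
theorem volterraDeriv_pow_mul (hA : DiagBound n α K T N q) {t : ℝ} (ht : t ∈ Ioc 0 T) :
    volterraDeriv n α K K' (fun s => s ^ N * u s) t =
      t ^ N * K n t t * (opL n α K N u t + opV n α K K' N u t) := by
  have hK0 := hA.ne_zero t (Ioc_subset_Icc_self ht)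
  have ht0 := ht.1.ne'
  rw [mul_add, opL, mul_assoc (t ^ N), mul_div_cancel₀ _ hK0, opV, Finset.mul_sum, Finset.mul_sum,
    ← Finset.sum_add_distrib, volterraDeriv]
  refine Finset.sum_congr rfl fun i _ => ?_
  rw [sectorDeriv, ← intervalIntegral.integral_const_mul]
  congr 1
  · ring
  · congr 1
    ext s
    rw [div_pow]
    field_simp

/-- A weight for which the regularized operator is a contraction. -/
theorem exists_contraction_weight {M q : ℝ} (hM : 0 ≤ M) (hq : q < 1) :
    ∃ ω : ℝ, 0 < ω ∧ q + M / ω < 1 := by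
  refine ⟨(M + 1) / (1 - q), div_pos (by linarith) (by linarith), ?_⟩
  have h1 : 0 < 1 - q := by linarith
  have h2 : 0 < M + 1 := by linarith
  have h3 : M / ((M + 1) / (1 - q)) < 1 - q := by
    rw [div_div_eq_mul_div, div_lt_iff₀ h2]
    nlinarith
  linarith

/-- At zero all dilated arguments coincide. Together with `L(N) ≠ 0` this links the value `u 0` to
the right-hand side. -/
theorem opL_zero : opL n α K N u 0 = u 0 * charL n α K N / K n 0 0 := by
  rw [opL, charL, Finset.mul_sum]
  congr 1
  refine Finset.sum_congr rfl fun i _ => ?_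
  simp only [mul_zero]
  ring

section Nodes

variable (hα : IsNodes n α)
include hα

theorem continuousOn_diag (hK : KernelRegular n α K K' T) :
    ContinuousOn (fun t => K n t t) (Icc 0 T) := by
  obtain ⟨m, rfl⟩ := Nat.exists_eq_succ_of_ne_zero hα.ne_zero
  have := continuousOn_ray hK (Nat.lt_succ_self m) (hα.lt m (Nat.lt_succ_self m)).le le_rfl
  have h1 := hα.last
  rw [Nat.succ_eq_add_one] at *
  simpa [h1] using this

theorem mul_mem_Icc {i : ℕ} (hi : i ≤ n) {t : ℝ} (ht : t ∈ Icc 0 T) : α i * t ∈ Icc 0 T :=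
  ⟨mul_nonneg (hα.nonneg hi) ht.1, (mul_le_of_le_one_left ht.1 (hα.le_one hi)).trans ht.2⟩

theorem continuousOn_opL (hK : KernelRegular n α K K' T) (hA : DiagBound n α K T N q)
    (hu : ContinuousOn u (Icc 0 T)) : ContinuousOn (opL n α K N u) (Icc 0 T) := by
  refine ContinuousOn.div (continuousOn_finsetSum _ fun i hi => ?_) (continuousOn_diag hα hK)
    hA.ne_zero
  rw [Finset.mem_range] at hi
  have hlt := (hα.lt i hi).le
  refine ContinuousOn.sub ((continuousOn_const.mul (continuousOn_ray hK hi hlt le_rfl)).mul ?_)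
    ((continuousOn_const.mul (continuousOn_ray hK hi le_rfl hlt)).mul ?_)
  · exact hu.comp (by fun_prop) fun t ht => mul_mem_Icc hα hi ht
  · exact hu.comp (by fun_prop) fun t ht => mul_mem_Icc hα hi.le ht

/-- Since `α n = 1`, the last upper-endpoint term of `L u` is `u t` itself and accounts for the `1`
in the bound `1 + q`; the remaining terms have total weight at most `q`. Dilations by `α i ≤ 1` do
not increase the weight `exp (ω t)`. -/
theorem opL_sub_self_le (hA : DiagBound n α K T N q) {ω B : ℝ} (hω : 0 ≤ ω) (hB : 0 ≤ B)
    (hu : ∀ s ∈ Icc 0 T, |u s| ≤ B * Real.exp (ω * s)) {t : ℝ} (ht : t ∈ Icc 0 T) :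
    |opL n α K N u t - u t| ≤ q * B * Real.exp (ω * t) := by
  have hu' : ∀ i ≤ n, |u (α i * t)| ≤ B * Real.exp (ω * t) := fun i hi => by
    refine (hu _ (mul_mem_Icc hα hi ht)).trans ?_
    have := mul_le_of_le_one_left ht.1 (hα.le_one hi)
    gcongr
  have hterm : ∀ i < n, ∀ l ≤ n, |α l ^ (1 + N) * K (i + 1) t (α l * t) * u (α l * t)| ≤
      α l ^ (1 + N) * |K (i + 1) t (α l * t)| * (B * Real.exp (ω * t)) := fun i _ l hl => by
    rw [abs_mul, abs_mul, abs_of_nonneg (pow_nonneg (hα.nonneg hl) _)]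
    exact mul_le_mul_of_nonneg_left (hu' l hl)
      (mul_nonneg (pow_nonneg (hα.nonneg hl) _) (abs_nonneg _))
  have hK0 := hA.ne_zero t ht
  have hp : 0 < |K n t t| := abs_pos.2 hK0
  have hb := hA.bound t ht
  obtain ⟨m, rfl⟩ := Nat.exists_eq_succ_of_ne_zero hα.ne_zero
  rw [Nat.succ_eq_add_one] at *
  have h1 := hα.last
  have e : opL (m + 1) α K N u t - u t = (∑ i ∈ Finset.range m,
      (α (i + 1) ^ (1 + N) * K (i + 1) t (α (i + 1) * t) * u (α (i + 1) * t) -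
        α i ^ (1 + N) * K (i + 1) t (α i * t) * u (α i * t)) -
        α m ^ (1 + N) * K (m + 1) t (α m * t) * u (α m * t)) / K (m + 1) t t := by
    rw [opL, Finset.sum_range_succ, h1, div_sub' hK0]
    simp only [one_pow, one_mul]
    ring
  rw [e, abs_div, div_le_iff₀ hp]
  rw [Finset.sum_range_succ, h1] at hb
  simp only [one_pow, one_mul] at hb
  have h2 : |∑ i ∈ Finset.range m,
      (α (i + 1) ^ (1 + N) * K (i + 1) t (α (i + 1) * t) * u (α (i + 1) * t) -
        α i ^ (1 + N) * K (i + 1) t (α i * t) * u (α i * t))| ≤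
      (∑ i ∈ Finset.range m, (α (i + 1) ^ (1 + N) * |K (i + 1) t (α (i + 1) * t)| +
        α i ^ (1 + N) * |K (i + 1) t (α i * t)|)) * (B * Real.exp (ω * t)) := by
    rw [Finset.sum_mul]
    refine (Finset.abs_sum_le_sum_abs _ _).trans (Finset.sum_le_sum fun i hi => ?_)
    rw [Finset.mem_range] at hi
    refine (abs_sub _ _).trans ?_
    rw [add_mul]
    exact add_le_add (hterm i (by omega) (i + 1) (by omega)) (hterm i (by omega) i (by omega))
  have h3 := hterm m (by omega) m (by omega)
  refine (abs_sub _ _).trans ((add_le_add h2 h3).trans ?_)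
  rw [← add_mul]
  calc _ ≤ (q * |K (m + 1) t t|) * (B * Real.exp (ω * t)) := by
        gcongr
        linarith
    _ = _ := by ring

theorem exists_quotient_bound (hK : KernelRegular n α K K' T) (hA : DiagBound n α K T N q) :
    ∃ M, 0 ≤ M ∧ ∀ i < n, ∀ t s, (t, s) ∈ sector (α i) (α (i + 1)) T →
      |K' (i + 1) t s / K n t t| ≤ M := by
  have h : ∀ i, ∃ M, 0 ≤ M ∧ (i < n → ∀ t s, (t, s) ∈ sector (α i) (α (i + 1)) T →
      |K' (i + 1) t s / K n t t| ≤ M) := fun i => by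
    by_cases hi : i < n
    · obtain ⟨M, hM, h⟩ := exists_sector_bound (g := fun t s => K' (i + 1) t s / K n t t)
        (a := α i) (b := α (i + 1)) (T := T) ((hK.cont' i hi).div
          ((continuousOn_diag hα hK).comp continuous_fst.continuousOn
            fun z hz => ⟨hz.1, hz.2.1⟩) fun z hz => hA.ne_zero _ ⟨hz.1, hz.2.1⟩)
      exact ⟨M, hM, fun _ => h⟩
    · exact ⟨0, le_rfl, fun h => absurd h hi⟩
  choose M hM0 hM using h
  refine ⟨∑ i ∈ Finset.range n, M i, Finset.sum_nonneg fun i _ => hM0 i, fun i hi t s hts => ?_⟩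
  exact (hM i hi t s hts).trans
    (Finset.single_le_sum (fun i _ => hM0 i) (Finset.mem_range.2 hi))

theorem intervalIntegrable_opV (hK : KernelRegular n α K K' T) (hu : ContinuousOn u (Icc 0 T))
    {t : ℝ} (ht : t ∈ Icc 0 T) {i : ℕ} (hi : i < n) :
    IntervalIntegrable (fun s => K' (i + 1) t s / K n t t * (s / t) ^ N * u s) volume
      (α i * t) (α (i + 1) * t) := by
  have hle := mul_le_mul_of_nonneg_right (hα.lt i hi).le ht.1
  refine ContinuousOn.intervalIntegrable ?_
  rw [uIcc_of_le hle]
  refine ContinuousOn.mul (ContinuousOn.mul (ContinuousOn.div_const ?_ _) (by fun_prop)) ?_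
  · exact (hK.cont' i hi).comp (f := fun s => (t, s)) (by fun_prop)
      fun s hs => ⟨ht.1, ht.2, hs.1, hs.2⟩
  · exact hu.mono (Icc_subset_Icc (mul_mem_Icc hα hi.le ht).1 (mul_mem_Icc hα hi ht).2)

theorem opV_sub (hK : KernelRegular n α K K' T) (hu : ContinuousOn u (Icc 0 T))
    (hv : ContinuousOn v (Icc 0 T)) {t : ℝ} (ht : t ∈ Icc 0 T) :
    opV n α K K' N (fun s => u s - v s) t = opV n α K K' N u t - opV n α K K' N v t := by
  simp only [opV, mul_sub]
  rw [← Finset.sum_sub_distrib]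
  refine Finset.sum_congr rfl fun i hi => ?_
  rw [Finset.mem_range] at hi
  exact intervalIntegral.integral_sub (intervalIntegrable_opV hα hK hu ht hi)
    (intervalIntegrable_opV hα hK hv ht hi)

/-- As `(s / t) ^ N ≤ 1` on each piece, the pieces add up to one integral over `[0, t]`. The
majorant `β` is taken constant for continuity at zero and exponential for the weighted estimate. -/
theorem abs_opV_le {M : ℝ} (hM0 : 0 ≤ M)
    (hM : ∀ i < n, ∀ t s, (t, s) ∈ sector (α i) (α (i + 1)) T → |K' (i + 1) t s / K n t t| ≤ M)
    {β : ℝ → ℝ} (hβ : Continuous β) {t : ℝ} (ht : t ∈ Icc 0 T)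
    (hu : ∀ s ∈ Icc 0 t, |u s| ≤ β s) :
    |opV n α K K' N u t| ≤ M * ∫ s in (0 : ℝ)..t, β s := by
  have hi' : ∀ p r : ℝ, IntervalIntegrable (fun s => M * β s) volume p r := fun p r =>
    (continuous_const.mul hβ).intervalIntegrable p r
  have hs := intervalIntegral.sum_integral_adjacent_intervals (a := fun i => α i * t) (n := n)
    (f := fun s => M * β s) (μ := volume) fun i _ => hi' _ _
  simp only [hα.zero, hα.last, zero_mul, one_mul] at hs
  rw [← intervalIntegral.integral_const_mul, ← hs, opV]
  refine (Finset.abs_sum_le_sum_abs _ _).trans (Finset.sum_le_sum fun i hi => ?_)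
  rw [Finset.mem_range] at hi
  have hle := mul_le_mul_of_nonneg_right (hα.lt i hi).le ht.1
  rw [← Real.norm_eq_abs]
  refine intervalIntegral.norm_integral_le_of_norm_le hle (Eventually.of_forall fun s hs => ?_)
    (hi' _ _)
  have h0 : 0 ≤ s := (mul_nonneg (hα.nonneg hi.le) ht.1).trans hs.1.le
  have h1 : s ≤ t := hs.2.trans (mul_le_of_le_one_left ht.1 (hα.le_one hi))
  have h2 := hM i hi t s ⟨ht.1, ht.2, hs.1.le, hs.2⟩
  have h3 : |(s / t) ^ N| ≤ 1 := by
    rw [abs_of_nonneg (pow_nonneg (div_nonneg h0 ht.1) _)]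
    exact pow_le_one₀ (div_nonneg h0 ht.1) (div_le_one_of_le₀ h1 ht.1)
  rw [norm_mul, norm_mul]
  simp only [Real.norm_eq_abs]
  calc _ ≤ M * 1 * β s := by
        refine mul_le_mul (mul_le_mul h2 h3 (abs_nonneg _) hM0) (hu s ⟨h0, h1⟩) (abs_nonneg _)
          (by linarith)
    _ = _ := by ring

/-- The gain `1 / ω` comes from `∫₀ᵗ exp (ω s) ds ≤ exp (ω t) / ω`. -/
theorem abs_opV_le_exp {M : ℝ} (hM0 : 0 ≤ M)
    (hM : ∀ i < n, ∀ t s, (t, s) ∈ sector (α i) (α (i + 1)) T → |K' (i + 1) t s / K n t t| ≤ M)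
    {ω B : ℝ} (hω : 0 < ω) (hB : 0 ≤ B)
    (hu : ∀ s ∈ Icc 0 T, |u s| ≤ B * Real.exp (ω * s)) {t : ℝ} (ht : t ∈ Icc 0 T) :
    |opV n α K K' N u t| ≤ M / ω * B * Real.exp (ω * t) := by
  refine (abs_opV_le hα hM0 hM (β := fun s => B * Real.exp (ω * s)) (by fun_prop) ht
    fun s hs => hu s ⟨hs.1, hs.2.trans ht.2⟩).trans ?_
  have h : ∫ s in (0 : ℝ)..t, B * Real.exp (ω * s) = B * (Real.exp (ω * t) - 1) / ω := by
    rw [intervalIntegral.integral_const_mul, intervalIntegral.integral_comp_mul_left _ hω.ne',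
      integral_exp]
    simp only [mul_zero, Real.exp_zero, smul_eq_mul]
    field_simp
  rw [h]
  have : M / ω * B * Real.exp (ω * t) = M * (B * Real.exp (ω * t) / ω) := by ring
  rw [this]
  gcongr
  linarith

/-- For `t > 0` the factor `t ^ (-N)` is taken out of the integrals. This is unavailable at `t = 0`,
where the estimate by `M * B * t` is used instead. -/
theorem continuousOn_opV (hT : 0 < T) (hK : KernelRegular n α K K' T)
    (hA : DiagBound n α K T N q) (hu : ContinuousOn u (Icc 0 T)) :
    ContinuousOn (opV n α K K' N u) (Icc 0 T) := by
  have hIoc : ContinuousOn (opV n α K K' N u) (Ioc 0 T) := by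
    have h1 : ContinuousOn (fun t => (t ^ N * K n t t)⁻¹ * ∑ i ∈ Finset.range n,
        ∫ s in (α i * t)..(α (i + 1) * t), K' (i + 1) t s * (s ^ N * u s)) (Ioc 0 T) := by
      refine ContinuousOn.mul (ContinuousOn.inv₀ ?_ ?_) (continuousOn_finsetSum _ fun i hi => ?_)
      · exact (continuousOn_pow N).mul ((continuousOn_diag hα hK).mono Ioc_subset_Icc_self)
      · exact fun t ht => mul_ne_zero (pow_ne_zero _ ht.1.ne')
          (hA.ne_zero t (Ioc_subset_Icc_self ht))
      · rw [Finset.mem_range] at hi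
        exact continuousOn_integral_sector (hα.nonneg hi.le) (hα.lt i hi).le (hα.le_one hi) hT
          (hK.cont' i hi) (mildSingular_of_continuousOn hT ((continuousOn_pow N).mul hu))
    refine h1.congr fun t ht => ?_
    simp only [opV, Finset.mul_sum]
    refine Finset.sum_congr rfl fun i _ => ?_
    rw [← intervalIntegral.integral_const_mul]
    congr 1
    ext s
    have h1 := hA.ne_zero t (Ioc_subset_Icc_self ht)
    have h2 := ht.1.ne'
    rw [div_pow]
    field_simp
  obtain ⟨M, hM0, hM⟩ := exists_quotient_bound hα hK hA
  obtain ⟨B, hB⟩ := isCompact_Icc.exists_bound_of_continuousOn hu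
  have h0 : opV n α K K' N u 0 = 0 := by simp [opV]
  intro t ht
  rcases ht.1.eq_or_lt with rfl | ht0
  · rw [ContinuousWithinAt, h0]
    refine squeeze_zero_norm' (a := fun t => M * (B * t)) ?_ ?_
    · filter_upwards [self_mem_nhdsWithin] with t ht
      refine (abs_opV_le hα hM0 hM (β := fun _ => B) continuous_const ht
        fun s hs => hB s ⟨hs.1, hs.2.trans ht.2⟩).trans_eq ?_
      simp [mul_comm]
    · have : Continuous fun t : ℝ => M * (B * t) := by fun_prop
      simpa using (this.tendsto 0).mono_left nhdsWithin_le_nhds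
  · refine (hIoc t ⟨ht0, ht.2⟩).mono_of_mem_nhdsWithin ?_
    filter_upwards [self_mem_nhdsWithin, mem_nhdsWithin_of_mem_nhds (Ioi_mem_nhds ht0)]
      with s hs hs0 using ⟨hs0, hs.2⟩

theorem exists_opL_eq (hT : 0 < T) (hK : KernelRegular n α K K' T) (hA : DiagBound n α K T N q)
    {h : ℝ → ℝ} (hh : ContinuousOn h (Icc 0 T)) :
    ∃ u, ContinuousOn u (Icc 0 T) ∧ EqOn (opL n α K N u) h (Icc 0 T) := by
  obtain ⟨u, hu, hfix⟩ := exists_weighted_fixedPoint (ω := 0) hT.le hA.nonneg hA.lt_one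
    (Φ := fun u t => h t - (opL n α K N u t - u t))
    (fun u hu => hh.sub ((continuousOn_opL hα hK hA hu).sub hu))
    (fun u v _ _ B hB huv t ht => by
      have := opL_sub_self_le hα hA le_rfl hB (u := fun s => u s - v s) huv ht
      rw [opL_sub] at this
      rw [← abs_neg]
      refine (congrArg abs ?_).trans_le this
      ring)
  refine ⟨u, hu, fun t ht => ?_⟩
  have := hfix ht
  simp only at this
  linarith

/-- The map `u ↦ h - (L u - u) - V u` contracts with constant `q + M / ω`. For `L` alone the
unweighted norm, `ω = 0`, already suffices. -/
theorem exists_opL_add_opV_eq (hT : 0 < T) (hK : KernelRegular n α K K' T)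
    (hA : DiagBound n α K T N q) {h : ℝ → ℝ} (hh : ContinuousOn h (Icc 0 T)) :
    ∃ u, ContinuousOn u (Icc 0 T) ∧
      ∀ t ∈ Icc 0 T, opL n α K N u t + opV n α K K' N u t = h t := by
  obtain ⟨M, hM0, hM⟩ := exists_quotient_bound hα hK hA
  obtain ⟨ω, hω, hlt⟩ := exists_contraction_weight hM0 hA.lt_one
  obtain ⟨u, hu, hfix⟩ := exists_weighted_fixedPoint (ω := ω) (κ := q + M / ω) hT.le
    (add_nonneg hA.nonneg (div_nonneg hM0 hω.le)) hlt
    (Φ := fun u t => h t - (opL n α K N u t - u t) - opV n α K K' N u t)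
    (fun u hu => (hh.sub ((continuousOn_opL hα hK hA hu).sub hu)).sub
      (continuousOn_opV hα hT hK hA hu))
    (fun u v hu hv B hB huv t ht => by
      have h1 := opL_sub_self_le hα hA hω.le hB (u := fun s => u s - v s) huv ht
      have h2 := abs_opV_le_exp hα hM0 hM (N := N) hω hB (u := fun s => u s - v s) huv ht
      rw [opL_sub] at h1
      rw [opV_sub hα hK hu hv ht] at h2
      rw [← abs_neg, add_mul, add_mul]
      refine ((congrArg abs ?_).trans_le (abs_add_le _ _)).trans (add_le_add h1 h2)
      ring)
  refine ⟨u, hu, fun t ht => ?_⟩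
  have := hfix ht
  simp only at this
  linarith

/-- The norm of `L⁻¹` is at most `1 / (1 - q)`, in every weighted norm with `ω ≥ 0`. -/
theorem abs_le_of_opL_le (hT : 0 < T) (hA : DiagBound n α K T N q) (hu : ContinuousOn u (Icc 0 T))
    {ω ε : ℝ} (hω : 0 ≤ ω)
    (h : ∀ t ∈ Icc 0 T, |opL n α K N u t| ≤ ε * Real.exp (ω * t)) :
    ∀ t ∈ Icc 0 T, |u t| ≤ ε / (1 - q) * Real.exp (ω * t) := by
  refine weighted_bound_of_contraction hT.le hA.lt_one hu fun B hB hle t ht => ?_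
  have h1 := opL_sub_self_le hα hA hω hB hle ht
  have h2 := h t ht
  rw [add_mul]
  rw [abs_sub_comm] at h1
  calc |u t| = |(u t - opL n α K N u t) + opL n α K N u t| := by rw [sub_add_cancel]
    _ ≤ _ := (abs_add_le _ _).trans (add_le_add h1 h2)

theorem eqOn_of_opL_eq (hT : 0 < T) (hA : DiagBound n α K T N q) (hu : ContinuousOn u (Icc 0 T))
    (hv : ContinuousOn v (Icc 0 T)) (h : EqOn (opL n α K N u) (opL n α K N v) (Icc 0 T)) :
    EqOn u v (Icc 0 T) := fun t ht => by
  have := abs_le_of_opL_le hα hT hA (hu.sub hv) le_rfl (ω := 0) (ε := 0) (fun t ht => by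
    have e := opL_sub (n := n) (α := α) (K := K) (N := N) (u := u) (v := v) t
    simp only [Pi.sub_def]
    rw [e, h ht, sub_self]; simp) t ht
  rw [zero_div, zero_mul] at this
  exact sub_eq_zero.1 (abs_nonpos_iff.1 this)

theorem eqOn_of_opL_add_opV_eq (hT : 0 < T) (hK : KernelRegular n α K K' T)
    (hA : DiagBound n α K T N q) (hu : ContinuousOn u (Icc 0 T)) (hv : ContinuousOn v (Icc 0 T))
    (h : ∀ t ∈ Icc 0 T, opL n α K N u t + opV n α K K' N u t =
      opL n α K N v t + opV n α K K' N v t) : EqOn u v (Icc 0 T) := fun t ht => by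
  obtain ⟨M, hM0, hM⟩ := exists_quotient_bound hα hK hA
  obtain ⟨ω, hω, hlt⟩ := exists_contraction_weight hM0 hA.lt_one
  have key := weighted_bound_of_contraction (ω := ω) hT.le hlt (ε := 0)
    (w := fun s => u s - v s) (hu.sub hv) (fun B hB hle t ht => by
      have h1 := opL_sub_self_le hα hA hω.le hB hle ht
      have h2 := abs_opV_le_exp hα hM0 hM (N := N) hω hB hle ht
      rw [opL_sub] at h1
      rw [opV_sub hα hK hu hv ht] at h2
      rw [← abs_neg, add_zero, add_mul, add_mul]
      refine ((congrArg abs ?_).trans_le (abs_add_le _ _)).trans (add_le_add h1 h2)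
      linarith [h t ht]) t ht
  rw [zero_div, zero_mul] at key
  exact sub_eq_zero.1 (abs_nonpos_iff.1 key)

/-- Successive approximations exist, are unique, and converge uniformly. -/
theorem exists_succApprox (hT : 0 < T) (hK : KernelRegular n α K K' T)
    (hA : DiagBound n α K T N q) {g' h : ℝ → ℝ} (hh : ContinuousOn h (Icc 0 T))
    (hg : ∀ t ∈ Ioc 0 T, h t = g' t / (t ^ N * K n t t)) (hu : ContinuousOn u (Icc 0 T))
    (huh : ∀ t ∈ Icc 0 T, opL n α K N u t + opV n α K K' N u t = h t) {v₀ : ℝ → ℝ}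
    (hv₀ : ContinuousOn v₀ (Icc 0 T)) :
    ∃ v : ℕ → ℝ → ℝ, v 0 = v₀ ∧ IsSuccApprox n α K K' T N g' v ∧
      (∀ v' : ℕ → ℝ → ℝ, v' 0 = v₀ → IsSuccApprox n α K K' T N g' v' →
        ∀ m, EqOn (v' m) (v m) (Icc 0 T)) ∧
      TendstoUniformlyOn v u atTop (Icc 0 T) := by
  have hstep : ∀ w : {w : ℝ → ℝ // ContinuousOn w (Icc 0 T)},
      ∃ w' : {w : ℝ → ℝ // ContinuousOn w (Icc 0 T)},
        EqOn (opL n α K N w') (fun t => -opV n α K K' N w t + h t) (Icc 0 T) := fun w => by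
    obtain ⟨w', hw', he⟩ := exists_opL_eq hα hT hK hA
      ((continuousOn_opV hα hT hK hA (N := N) w.2).neg.add hh)
    exact ⟨⟨w', hw'⟩, he⟩
  choose S hS using hstep
  let V : ℕ → {w : ℝ → ℝ // ContinuousOn w (Icc 0 T)} := fun m => S^[m] ⟨v₀, hv₀⟩
  have hV : ∀ m, V (m + 1) = S (V m) := fun m => Function.iterate_succ_apply' _ _ _
  have hVs : ∀ m, ∀ t ∈ Icc 0 T, opL n α K N (V (m + 1)) t =
      -opV n α K K' N (V m) t + h t := fun m t ht => by
    rw [hV]; exact hS (V m) ht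
  refine ⟨fun m => V m, rfl, ⟨fun m => (V m).2, fun m t ht => ?_⟩, fun v' h0 hv' m => ?_, ?_⟩
  · rw [hVs m t (Ioc_subset_Icc_self ht), hg t ht]
  · induction m with
    | zero => rw [h0]; exact fun t _ => rfl
    | succ m ih =>
      refine eqOn_of_opL_eq hα hT hA (hv'.cont _) (V (m + 1)).2 ?_
      -- The recursion is prescribed only for `t > 0`; continuity extends it to `t = 0`, where
      -- injectivity of `L` needs it.
      refine eqOn_Icc_of_eqOn_Ioc hT (continuousOn_opL hα hK hA (hv'.cont _))
        (continuousOn_opL hα hK hA (V (m + 1)).2) fun t ht => ?_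
      have ht' := Ioc_subset_Icc_self ht
      rw [hv'.step m t ht, hVs m t ht', ← hg t ht]
      have h1 := opV_sub hα hK (N := N) (hv'.cont m) (V m).2 ht'
      have h2 : opV n α K K' N (fun s => v' m s - (V m : ℝ → ℝ) s) t = 0 := by
        rw [opV]
        refine Finset.sum_eq_zero fun i hi => ?_
        rw [Finset.mem_range] at hi
        refine intervalIntegral.integral_zero_ae (Eventually.of_forall fun s hs => ?_)
        rw [uIoc_of_le (mul_le_mul_of_nonneg_right (hα.lt i hi).le ht'.1)] at hs
        have hs' : s ∈ Icc 0 T := ⟨(mul_mem_Icc hα hi.le ht').1.trans hs.1.le,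
          hs.2.trans (mul_mem_Icc hα hi ht').2⟩
        rw [ih hs', sub_self, mul_zero]
      linarith
  · obtain ⟨M, hM0, hM⟩ := exists_quotient_bound hα hK hA
    obtain ⟨ω, hω, hlt⟩ := exists_contraction_weight hM0 hA.lt_one
    have h1q : 0 < 1 - q := by linarith [hA.lt_one]
    obtain ⟨B, hB0, hB⟩ := exists_weighted_bound ω ((V 0).2.sub hu)
    -- The errors satisfy `L (v_{m+1} - u) = -V (v_m - u)`, so `κ` bounds the weighted norm of `L⁻¹
    -- V`; `κ < 1` is `q + M / ω < 1` rearranged.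
    set κ := M / ω / (1 - q) with hκ
    have hκ0 : 0 ≤ κ := by positivity
    have hκ1 : κ < 1 := by rw [hκ, div_lt_one h1q]; linarith
    have hb : ∀ m, ∀ t ∈ Icc 0 T, |(V m : ℝ → ℝ) t - u t| ≤ B * κ ^ m * Real.exp (ω * t) := by
      intro m
      induction m with
      | zero => simpa using hB
      | succ m ih =>
        have h3 := abs_le_of_opL_le hα hT hA ((V (m + 1)).2.sub hu) hω.le
          (ε := M / ω * (B * κ ^ m)) (fun t ht => by
            have e := opL_sub (n := n) (α := α) (K := K) (N := N)
              (u := (V (m + 1) : ℝ → ℝ)) (v := u) t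
            have e' := opV_sub hα hK (N := N) (V m).2 hu ht
            have h4 := abs_opV_le_exp hα hM0 hM (N := N) hω (by positivity)
              (u := fun s => (V m : ℝ → ℝ) s - u s) ih ht
            rw [← abs_neg] at h4
            refine (congrArg abs ?_).trans_le h4
            simp only [Pi.sub_def]
            rw [e, e', hVs m t ht]
            linarith [huh t ht])
        intro t ht
        refine (h3 t ht).trans_eq ?_
        rw [hκ]; ring
    rw [Metric.tendstoUniformlyOn_iff]
    intro ε hε
    have hlim : Tendsto (fun m => B * κ ^ m * Real.exp (ω * T)) atTop (𝓝 0) := by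
      simpa using ((tendsto_pow_atTop_nhds_zero_of_lt_one hκ0 hκ1).const_mul B).mul_const
        (Real.exp (ω * T))
    filter_upwards [hlim.eventually (gt_mem_nhds hε)] with m hm t ht
    rw [dist_comm, Real.dist_eq]
    refine (hb m t ht).trans_lt (lt_of_le_of_lt ?_ hm)
    have := ht.2
    gcongr

/-- Under Condition A the characteristic function has no zero at `N` or beyond. -/
theorem charL_ne_zero (hT : 0 < T) (hA : DiagBound n α K T N q) {j : ℕ} (hj : N ≤ j) :
    charL n α K j ≠ 0 := by
  have h0 : (0 : ℝ) ∈ Icc 0 T := left_mem_Icc.2 hT.le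
  have hK0 := hA.ne_zero 0 h0
  have hb := hA.bound 0 h0
  have hpow : ∀ i ≤ n, α i ^ (1 + j) ≤ α i ^ (1 + N) := fun i hi =>
    pow_le_pow_of_le_one (hα.nonneg hi) (hα.le_one hi) (by omega)
  obtain ⟨m, rfl⟩ := Nat.exists_eq_succ_of_ne_zero hα.ne_zero
  rw [Nat.succ_eq_add_one] at *
  have h1 := hα.last
  rw [Finset.sum_range_succ, h1] at hb
  simp only [mul_zero, one_pow, one_mul] at hb
  intro hL
  rw [charL, Finset.sum_range_succ, h1, one_pow] at hL
  have h2 : |∑ i ∈ Finset.range m, K (i + 1) 0 0 * (α (i + 1) ^ (1 + j) - α i ^ (1 + j))| ≤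
      ∑ i ∈ Finset.range m, (α (i + 1) ^ (1 + N) * |K (i + 1) 0 0| +
        α i ^ (1 + N) * |K (i + 1) 0 0|) := by
    refine (Finset.abs_sum_le_sum_abs _ _).trans (Finset.sum_le_sum fun i hi => ?_)
    rw [Finset.mem_range] at hi
    rw [abs_mul, mul_comm, ← add_mul]
    refine mul_le_mul_of_nonneg_right ((abs_sub _ _).trans ?_) (abs_nonneg _)
    rw [abs_of_nonneg (pow_nonneg (hα.nonneg (by omega)) _),
      abs_of_nonneg (pow_nonneg (hα.nonneg (by omega)) _)]
    exact add_le_add (hpow _ (by omega)) (hpow _ (by omega))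
  -- If `L(j) = 0`, the term with `α n = 1` is balanced by all the others, whose total is at most `q
  -- |K_n(0,0)|` by Condition A. This contradicts `q < 1`.
  have h3 : |K (m + 1) 0 0| ≤
      |∑ i ∈ Finset.range m, K (i + 1) 0 0 * (α (i + 1) ^ (1 + j) - α i ^ (1 + j))| +
        α m ^ (1 + N) * |K (m + 1) 0 0| := by
    have e : K (m + 1) 0 0 = K (m + 1) 0 0 * α m ^ (1 + j) -
      ∑ i ∈ Finset.range m, K (i + 1) 0 0 * (α (i + 1) ^ (1 + j) - α i ^ (1 + j)) := by linarith
    have h4 : |K (m + 1) 0 0 * α m ^ (1 + j)| ≤ α m ^ (1 + N) * |K (m + 1) 0 0| := by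
      rw [abs_mul, mul_comm, abs_of_nonneg (pow_nonneg (hα.nonneg (by omega)) _)]
      exact mul_le_mul_of_nonneg_right (hpow _ (by omega)) (abs_nonneg _)
    calc |K (m + 1) 0 0| = _ := congrArg abs e
      _ ≤ _ := (abs_sub _ _).trans (by linarith)
  have hp : 0 < |K (m + 1) 0 0| := abs_pos.2 hK0
  nlinarith [hA.lt_one]

end Nodes

end Operators

theorem LogLead.neg {N m : ℕ} {v : ℝ[X]} {h : ℝ → ℝ} (H : LogLead N m v h) :
    LogLead N m (-v) fun t => -h t := by
  obtain ⟨e, h1, h2, h3⟩ := H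
  refine ⟨fun i => -e i, fun j hj => by simp [h1 j hj], by simp only [h2], ?_⟩
  refine h3.neg_left.congr_left fun t => ?_
  simp only [logPoly, eval_neg, neg_mul, Finset.sum_neg_distrib]
  ring

/-! ### Action of one sector on a logarithmic-power term -/

section Expansion

variable {a b c δ T : ℝ} {N m : ℕ} {k k' : ℝ → ℝ → ℝ}

/-- Since `log (c t) = log c + log t`, the dilation becomes a translation of `p`, and only the
constant term of the kernel along the ray affects order `m`. For `c = 0` everything vanishes. -/
theorem logLead_ray (hab : a < b) (hδ : 0 < δ) (ha : 0 ≤ a) (hac : a ≤ c) (hcb : c ≤ b)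
    (hk : TimesDifferentiableOn (N + 1) (fun z : ℝ × ℝ => k z.1 z.2) (sector a b δ))
    (p : ℝ[X]) :
    LogLead N m (k 0 0 • (c ^ (1 + m) • taylor (Real.log c) p))
      fun t => c * k t (c * t) * (p.eval (Real.log (c * t)) * (c * t) ^ m) := by
  rcases (ha.trans hac).eq_or_lt with rfl | hc
  · simpa using LogLead.zero
  obtain ⟨κ, hκ0, hκ⟩ := exists_ray_expansion hab hδ hac hcb hk
  rw [← hκ0]
  set p' := c ^ (1 + m) • taylor (Real.log c) p with hp'
  have hx : ∀ t : ℝ, 0 < t → c * (p.eval (Real.log (c * t)) * (c * t) ^ m) =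
      t ^ m * p'.eval (Real.log t) := fun t ht => by
    rw [hp', eval_smul, taylor_eval, Real.log_mul hc.ne' ht.ne', add_comm (Real.log c), smul_eq_mul]
    ring
  have h1 : ∀ l ∈ Finset.range (N + 1), LogLead N m 0
      fun t => t ^ (m + (l + 1)) * (κ (l + 1) • p').eval (Real.log t) := fun l _ =>
    (LogLead.monomial _).of_lt (by omega)
  -- The kernel remainder `o(t ^ (N + 1))` can afford the loss of a full power: `t ^ m` times a
  -- polynomial in `log t` is `O(t⁻¹)` even for `m = 0`.
  have h2 : LogLead N m 0 fun t => (k t (c * t) - ∑ l ∈ Finset.range (N + 2), κ l * t ^ l) *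
      (t ^ m * p'.eval (Real.log t)) := by
    refine LogLead.of_isLittleO ?_
    have h3 := (eval_log_isLittleO p' one_pos).isBigO
    have h4 : (fun t : ℝ => t ^ m) =O[𝓝[>] 0] fun _ => (1 : ℝ) :=
      ((continuous_pow m).tendsto (0 : ℝ)).mono_left nhdsWithin_le_nhds |>.isBigO_one ℝ
    refine (hκ.mul_isBigO (h4.mul h3)).congr' EventuallyEq.rfl ?_
    filter_upwards [self_mem_nhdsWithin] with t ht
    have ht0 : t ≠ 0 := ne_of_gt ht
    rw [one_mul, Real.rpow_neg_one, pow_succ, mul_assoc, mul_inv_cancel₀ ht0, mul_one]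
  have h5 := (((LogLead.monomial (N := N) (m := m) (κ 0 • p')).add (LogLead.sum _ h1)).add h2)
  rw [Finset.sum_const_zero, add_zero, add_zero] at h5
  refine h5.congr' ?_
  filter_upwards [self_mem_nhdsWithin] with t ht
  have e : c * k t (c * t) * (p.eval (Real.log (c * t)) * (c * t) ^ m) =
      k t (c * t) * (t ^ m * p'.eval (Real.log t)) := by rw [← hx t ht]; ring
  rw [e, sub_mul, Finset.sum_range_succ' _ (N + 1), add_mul, Finset.sum_mul]
  simp only [eval_smul, smul_eq_mul, pow_zero, mul_one]
  have e2 : ∀ l ∈ Finset.range (N + 1),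
      t ^ (m + (l + 1)) * (κ (l + 1) * p'.eval (Real.log t)) =
        κ (l + 1) * t ^ (l + 1) * (t ^ m * p'.eval (Real.log t)) := fun l _ => by
    rw [pow_add]; ring
  rw [Finset.sum_congr rfl e2]
  ring

/-- Scale by `s = σ t` and expand `p (log σ + log t)` in powers of `log t`; the coefficients of `Q`
are integrals over `σ`. -/
theorem exists_integral_homogeneous (ha : 0 ≤ a) (hab : a ≤ b) (hb : b ≤ 1) {A : ℝ × ℝ → ℝ}
    {l : ℕ} (hA : Continuous A) (hh : ∀ (c : ℝ) (z : ℝ × ℝ), A (c • z) = c ^ l • A z)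
    (p : ℝ[X]) (m : ℕ) :
    ∃ Q : ℝ[X], ∀ t, 0 < t → ∫ s in (a * t)..(b * t), A (t, s) * (p.eval (Real.log s) * s ^ m) =
      t ^ (m + (l + 1)) * Q.eval (Real.log t) := by
  refine ⟨∑ i ∈ Finset.range (p.natDegree + 1), C (∫ σ in a..b,
    A (1, σ) * ((hasseDeriv i p).eval (Real.log σ) * σ ^ m)) * X ^ i, fun t ht => ?_⟩
  have hint : ∀ i, IntervalIntegrable
      (fun σ => A (1, σ) * ((hasseDeriv i p).eval (Real.log σ) * σ ^ m)) volume a b := fun i => by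
    have := intervalIntegrable_sector (g := fun t s => A (t, s)) (T := 1) (t := 1) ha hab hb one_pos
      hA.continuousOn (mildSingular_eval_log_mul_pow 1 (hasseDeriv i p) m) ⟨one_pos, le_rfl⟩
    simpa using this
  rw [← intervalIntegral.mul_integral_comp_mul_right
    (f := fun s => A (t, s) * (p.eval (Real.log s) * s ^ m)) t]
  have e : ∫ σ in a..b, A (t, σ * t) * (p.eval (Real.log (σ * t)) * (σ * t) ^ m) =
      ∫ σ in a..b, t ^ (m + l) * ∑ i ∈ Finset.range (p.natDegree + 1),
        A (1, σ) * ((hasseDeriv i p).eval (Real.log σ) * σ ^ m) * Real.log t ^ i := by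
    refine intervalIntegral.integral_congr_Ioo_of_le hab fun σ hσ => ?_
    have hσ0 : 0 < σ := ha.trans_lt hσ.1
    have h1 : A (t, σ * t) = t ^ l * A (1, σ) := by
      have := hh t (1, σ)
      simpa [mul_comm σ t] using this
    have h2 : p.eval (Real.log (σ * t)) = ∑ i ∈ Finset.range (p.natDegree + 1),
        (hasseDeriv i p).eval (Real.log σ) * Real.log t ^ i := by
      rw [Real.log_mul hσ0.ne' ht.ne', add_comm, ← taylor_eval, eval_eq_sum_range,
        natDegree_taylor]
      simp only [taylor_coeff]
    simp only [h1, h2, Finset.sum_mul, Finset.mul_sum]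
    refine Finset.sum_congr rfl fun i _ => ?_
    ring
  rw [e, intervalIntegral.integral_const_mul, intervalIntegral.integral_finsetSum
    fun i _ => (hint i).mul_const _, eval_finsetSum]
  simp only [intervalIntegral.integral_mul_const, eval_mul, eval_C, eval_pow, eval_X]
  ring

/-- Integration raises the order by one, so the integral terms never reach order `m`. The remainder
of `k'`, at most `t ^ N`, gains a factor `t ^ (1/2)` from integration and becomes `o(t ^ N)`. -/
theorem logLead_integral (ha : 0 ≤ a) (hab : a < b) (hb : b ≤ 1) (hδ : 0 < δ) (hδT : δ ≤ T)
    (hk' : ContinuousOn (fun z : ℝ × ℝ => k' z.1 z.2) (sector a b T))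
    (hd : ∀ t s, (t, s) ∈ sector a b T → HasDerivWithinAt (fun τ => k τ s) (k' t s)
      {τ | (τ, s) ∈ sector a b T} t)
    (hk : TimesDifferentiableOn (N + 1) (fun z : ℝ × ℝ => k z.1 z.2) (sector a b δ))
    (p : ℝ[X]) :
    LogLead N m 0 fun t => ∫ s in (a * t)..(b * t), k' t s * (p.eval (Real.log s) * s ^ m) := by
  have hT := hδ.trans_le hδT
  have hx := mildSingular_eval_log_mul_pow T p m
  obtain ⟨A, hA, hev⟩ := exists_partial_expansion ha hab hb hδ hδT hk' hd hk
  choose Q hQ using fun l => exists_integral_homogeneous ha hab.le hb (hA l).1 (hA l).2 p m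
  obtain ⟨C, hC0, hC⟩ := hx.exists_bound hT
  have h1 : ∀ l ∈ Finset.range (N + 1), LogLead N m 0
      fun t => t ^ (m + (l + 1)) * (Q l).eval (Real.log t) := fun l _ =>
    (LogLead.monomial _).of_lt (by omega)
  have hiA : ∀ t ∈ Ioc 0 T, ∀ l, IntervalIntegrable
      (fun s => A l (t, s) * (p.eval (Real.log s) * s ^ m)) volume (a * t) (b * t) :=
    fun t ht l => intervalIntegrable_sector (g := fun t s => A l (t, s)) ha hab.le hb hT
      (hA l).1.continuousOn hx ht
  have h2 : LogLead N m 0 fun t => ∫ s in (a * t)..(b * t),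
      (k' t s - ∑ l ∈ Finset.range (N + 1), A l (t, s)) * (p.eval (Real.log s) * s ^ m) := by
    refine LogLead.of_isLittleO ?_
    have h3 : (fun t : ℝ => t ^ N * t ^ (1 / 2 : ℝ)) =o[𝓝[>] 0] fun t : ℝ => t ^ N := by
      have : Tendsto (fun t : ℝ => t ^ (1 / 2 : ℝ)) (𝓝[>] 0) (𝓝 0) := by
        have h := (Real.continuous_rpow_const (q := 1 / 2) (by norm_num)).tendsto (0 : ℝ)
        rw [Real.zero_rpow (by norm_num)] at h
        exact h.mono_left nhdsWithin_le_nhds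
      simpa using (isBigO_refl (fun t : ℝ => t ^ N) (𝓝[>] 0)).mul_isLittleO
        ((isLittleO_one_iff ℝ).2 this)
    refine IsBigO.trans_isLittleO (IsBigO.of_bound (2 * C) ?_) h3
    filter_upwards [hev, Ioo_mem_nhdsGT hT] with t ht htT
    have h4 := abs_integral_le_of_bound (a := a) (b := b) (t := t) (B := t ^ N * C)
      (h := fun s => (k' t s - ∑ l ∈ Finset.range (N + 1), A l (t, s)) *
        (p.eval (Real.log s) * s ^ m)) ha hab.le hb htT.1.le
      (mul_nonneg (pow_nonneg htT.1.le _) hC0) fun s hs => by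
        rw [abs_mul, mul_assoc]
        refine mul_le_mul (ht s hs) (hC s ⟨(mul_nonneg ha htT.1.le).trans_lt hs.1, ?_⟩)
          (abs_nonneg _) (pow_nonneg htT.1.le _)
        exact (hs.2.le.trans (mul_le_of_le_one_left htT.1.le hb)).trans htT.2.le
    refine h4.trans_eq ?_
    rw [Real.norm_of_nonneg (mul_nonneg (pow_nonneg htT.1.le _) (Real.rpow_nonneg htT.1.le _))]
    ring
  have h5 := (LogLead.sum _ h1).add h2
  rw [Finset.sum_const_zero, add_zero] at h5
  refine h5.congr' ?_
  filter_upwards [Ioo_mem_nhdsGT hT] with t ht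
  have ht' := Ioo_subset_Ioc_self ht
  have e1 : ∑ l ∈ Finset.range (N + 1), t ^ (m + (l + 1)) * (Q l).eval (Real.log t) =
      ∫ s in (a * t)..(b * t), ∑ l ∈ Finset.range (N + 1),
        A l (t, s) * (p.eval (Real.log s) * s ^ m) := by
    rw [intervalIntegral.integral_finsetSum fun l _ => hiA t ht' l]
    exact Finset.sum_congr rfl fun l _ => (hQ l t ht.1).symm
  have i1 := intervalIntegrable_sector ha hab.le hb hT hk' hx ht'
  have i2 : IntervalIntegrable (fun s => ∑ l ∈ Finset.range (N + 1),
      A l (t, s) * (p.eval (Real.log s) * s ^ m)) volume (a * t) (b * t) := by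
    have e : (fun s => ∑ l ∈ Finset.range (N + 1), A l (t, s) * (p.eval (Real.log s) * s ^ m)) =
        ∑ l ∈ Finset.range (N + 1), fun s => A l (t, s) * (p.eval (Real.log s) * s ^ m) := by
      ext s; simp
    rw [e]
    exact IntervalIntegrable.sum (Finset.range (N + 1)) fun l _ => hiA t ht' l
  rw [e1]
  simp only [sub_mul, Finset.sum_mul]
  rw [intervalIntegral.integral_sub i1 i2]
  ring

theorem logLead_sectorDeriv (ha : 0 ≤ a) (hab : a < b) (hb : b ≤ 1) (hδ : 0 < δ) (hδT : δ ≤ T)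
    (hk' : ContinuousOn (fun z : ℝ × ℝ => k' z.1 z.2) (sector a b T))
    (hd : ∀ t s, (t, s) ∈ sector a b T → HasDerivWithinAt (fun τ => k τ s) (k' t s)
      {τ | (τ, s) ∈ sector a b T} t)
    (hk : TimesDifferentiableOn (N + 1) (fun z : ℝ × ℝ => k z.1 z.2) (sector a b δ))
    (p : ℝ[X]) :
    LogLead N m (k 0 0 • (b ^ (1 + m) • taylor (Real.log b) p - a ^ (1 + m) •
      taylor (Real.log a) p)) (sectorDeriv a b k k' fun s => p.eval (Real.log s) * s ^ m) := by
  have h := ((logLead_ray (m := m) hab hδ ha hab.le le_rfl hk p).add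
    (logLead_ray (m := m) hab hδ ha le_rfl hab.le hk p).neg).add
      (logLead_integral (m := m) ha hab hb hδ hδT hk' hd hk p)
  rw [add_zero, ← sub_eq_add_neg, ← smul_sub] at h
  exact h

end Expansion

/-! ### Expansion of the differentiated integral for a full sum -/

section Formal

variable {n N : ℕ} {α : ℕ → ℝ} {K K' : ℕ → ℝ → ℝ → ℝ} {T δ : ℝ} {x y : ℝ → ℝ}

theorem logLead_volterraDeriv (hα : IsNodes n α) (hK : KernelRegular n α K K' T) (hδ : 0 < δ)
    (hδT : δ ≤ T) (hB : ∀ i < n, TimesDifferentiableOn (N + 1)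
      (fun z : ℝ × ℝ => K (i + 1) z.1 z.2) (sector (α i) (α (i + 1)) δ)) (m : ℕ) (p : ℝ[X]) :
    LogLead N m (diffOp n α K m p)
      (volterraDeriv n α K K' fun s => p.eval (Real.log s) * s ^ m) := by
  have := LogLead.sum (Finset.range n) fun i hi => by
    rw [Finset.mem_range] at hi
    exact logLead_sectorDeriv (m := m) (hα.nonneg hi.le) (hα.lt i hi) (hα.le_one hi) hδ hδT
      (hK.cont' i hi) (hK.hasDeriv i hi) (hB i hi) p
  have e : diffOp n α K m p = ∑ i ∈ Finset.range n, K (i + 1) 0 0 •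
      (α (i + 1) ^ (1 + m) • taylor (Real.log (α (i + 1))) p -
        α i ^ (1 + m) • taylor (Real.log (α i)) p) := by
    simp [diffOp]
  rw [e]
  exact this

theorem volterraDeriv_add (hα : IsNodes n α) (hT : 0 < T) (hK : KernelRegular n α K K' T)
    (hx : MildSingular T x) (hy : MildSingular T y) {t : ℝ} (ht : t ∈ Ioc 0 T) :
    volterraDeriv n α K K' (fun s => x s + y s) t =
      volterraDeriv n α K K' x t + volterraDeriv n α K K' y t := by
  rw [volterraDeriv, volterraDeriv, volterraDeriv, ← Finset.sum_add_distrib]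
  refine Finset.sum_congr rfl fun i hi => ?_
  rw [Finset.mem_range] at hi
  exact sectorDeriv_add (hα.nonneg hi.le) (hα.lt i hi).le (hα.le_one hi) hT (hK.cont' i hi)
    hx hy ht

theorem volterraDeriv_logPoly (hα : IsNodes n α) (hT : 0 < T) (hK : KernelRegular n α K K' T)
    (y : ℕ → ℝ[X]) {t : ℝ} (ht : t ∈ Ioc 0 T) :
    volterraDeriv n α K K' (logPoly N y) t = ∑ i ∈ Finset.range (N + 1),
      volterraDeriv n α K K' (fun s => (y i).eval (Real.log s) * s ^ i) t := by
  induction N with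
  | zero =>
    have : logPoly 0 y = fun s => (y 0).eval (Real.log s) * s ^ 0 := by ext s; simp [logPoly]
    rw [this]; simp
  | succ N ih =>
    have : logPoly (N + 1) y = fun s => logPoly N y s + (y (N + 1)).eval (Real.log s) *
        s ^ (N + 1) := by
      ext s; rw [logPoly, Finset.sum_range_succ]; rfl
    rw [this, volterraDeriv_add hα hT hK (mildSingular_logPoly T N y)
      (mildSingular_eval_log_mul_pow T _ _) ht, ih, ← Finset.sum_range_succ]

/-- The asymptotics of the differentiated Volterra integral of a logarithmic-power sum: in each
order the difference operator acts on the coefficient of that order, and the remaining terms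
depend on the coefficients of lower order only. -/
theorem exists_formal_expansion (hα : IsNodes n α) (hK : KernelRegular n α K K' T) (hδ : 0 < δ)
    (hδT : δ ≤ T) (hB : ∀ i < n, TimesDifferentiableOn (N + 1)
      (fun z : ℝ × ℝ => K (i + 1) z.1 z.2) (sector (α i) (α (i + 1)) δ)) :
    ∃ e : ℕ → ℝ[X] → ℕ → ℝ[X], ∀ y : ℕ → ℝ[X],
      (fun t => volterraDeriv n α K K' (logPoly N y) t - logPoly N
        (fun j => diffOp n α K j (y j) + ∑ i ∈ Finset.range j, e i (y i) j) t)
        =o[𝓝[>] 0] fun t : ℝ => t ^ N := by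
  have hT := hδ.trans_le hδT
  -- `e i p j` is the coefficient of order `j` produced by `p (log t) * t ^ i`: zero for `j < i` and
  -- `diffOp i p` for `j = i`.
  choose e h0 hlead ho using logLead_volterraDeriv (N := N) hα hK hδ hδT hB
  refine ⟨e, fun y => ?_⟩
  have h1 : (fun t => ∑ i ∈ Finset.range (N + 1),
      (volterraDeriv n α K K' (fun s => (y i).eval (Real.log s) * s ^ i) t -
        logPoly N (e i (y i)) t)) =o[𝓝[>] 0] fun t : ℝ => t ^ N :=
    IsLittleO.fun_sum fun i _ => ho i (y i)
  refine h1.congr' ?_ EventuallyEq.rfl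
  filter_upwards [Ioo_mem_nhdsGT hT] with t ht
  rw [volterraDeriv_logPoly hα hT hK y (Ioo_subset_Ioc_self ht), Finset.sum_sub_distrib]
  congr 1
  simp only [logPoly]
  rw [Finset.sum_comm]
  refine Finset.sum_congr rfl fun j hj => ?_
  rw [← Finset.sum_mul, ← eval_finsetSum]
  congr 2
  rw [Finset.mem_range] at hj
  rw [← Finset.sum_range_add_sum_Ico _ (Nat.le_of_lt hj), Finset.sum_eq_sum_Ico_succ_bot hj, hlead,
    add_comm, Finset.sum_eq_zero (s := Finset.Ico (j + 1) (N + 1)), add_zero]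
  intro i hi
  rw [Finset.mem_Ico] at hi
  exact h0 i (y i) j (by omega)

end Formal

/-! ### The regularized equation for the remainder -/

section Regularized

variable {n N : ℕ} {α : ℕ → ℝ} {K K' : ℕ → ℝ → ℝ → ℝ} {T q : ℝ} {f u w : ℝ → ℝ} {y : ℕ → ℝ[X]}

/-- The derivative of the right-hand side of the regularized equation. -/
noncomputable def regRhsDeriv (n : ℕ) (α : ℕ → ℝ) (K K' : ℕ → ℝ → ℝ → ℝ) (f : ℝ → ℝ) (T : ℝ)
    (x : ℝ → ℝ) (t : ℝ) : ℝ :=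
  derivWithin f (Icc 0 T) t - volterraDeriv n α K K' x t

theorem hasDerivWithinAt_regRhs (hα : IsNodes n α) (hT : 0 < T) (hK : KernelRegular n α K K' T)
    (hf : ContDiffOn ℝ 1 f (Icc 0 T)) {x : ℝ → ℝ} (hx : MildSingular T x) {t : ℝ}
    (ht : t ∈ Ioc 0 T) :
    HasDerivWithinAt (regRhs n α K f x) (regRhsDeriv n α K K' f T x t) (Ioc 0 T) t :=
  ((hf.differentiableOn one_ne_zero t (Ioc_subset_Icc_self ht)).hasDerivWithinAt.mono
    Ioc_subset_Icc_self).sub (hasDerivWithinAt_volterra hα hT hK hx ht)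

theorem regRhs_eq_integral (hα : IsNodes n α) (hT : 0 < T) (hK : KernelRegular n α K K' T)
    (hf : ContDiffOn ℝ 1 f (Icc 0 T)) (hf0 : f 0 = 0) {x : ℝ → ℝ} (hx : MildSingular T x) {t : ℝ}
    (ht : t ∈ Ioc 0 T) :
    regRhs n α K f x t = ∫ s in (0 : ℝ)..t, regRhsDeriv n α K K' f T x s := by
  have h1 : MildSingular T (derivWithin f (Icc 0 T)) := mildSingular_of_continuousOn hT
    (hf.continuousOn_derivWithin (uniqueDiffOn_Icc hT) le_rfl)
  simp only [regRhsDeriv]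
  rw [intervalIntegral.integral_sub (h1.intervalIntegrable hT ht)
    ((mildSingular_volterraDeriv hα hT hK hx).intervalIntegrable hT ht),
    integral_derivWithin_eq hT hf hf0 ht, ← volterra_eq_integral hα hT hK hx ht, regRhs]

theorem continuousOn_regRhsDeriv (hα : IsNodes n α) (hT : 0 < T) (hK : KernelRegular n α K K' T)
    (hf : ContDiffOn ℝ 1 f (Icc 0 T)) {x : ℝ → ℝ} (hx : MildSingular T x) :
    ContinuousOn (regRhsDeriv n α K K' f T x) (Ioc 0 T) :=
  ((hf.continuousOn_derivWithin (uniqueDiffOn_Icc hT) le_rfl).mono Ioc_subset_Icc_self).sub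
    (mildSingular_volterraDeriv hα hT hK hx).continuousOn

/-- The integral equation for `w` is equivalent to its differentiated form. -/
theorem regularized_iff (hα : IsNodes n α) (hT : 0 < T) (hK : KernelRegular n α K K' T)
    (hA : DiagBound n α K T N q) (hf : ContDiffOn ℝ 1 f (Icc 0 T)) (hf0 : f 0 = 0) {x : ℝ → ℝ}
    (hx : MildSingular T x) (hw : ContinuousOn w (Icc 0 T)) :
    (∀ t ∈ Ioc 0 T, volterra n α K (fun s => s ^ N * w s) t = regRhs n α K f x t) ↔
      ∀ t ∈ Ioc 0 T, opL n α K N w t + opV n α K K' N w t =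
        regRhsDeriv n α K K' f T x t / (t ^ N * K n t t) := by
  have hw' : MildSingular T fun s => s ^ N * w s :=
    mildSingular_of_continuousOn hT ((continuousOn_pow N).mul hw)
  have hne : ∀ t ∈ Ioc 0 T, t ^ N * K n t t ≠ 0 := fun t ht =>
    mul_ne_zero (pow_ne_zero _ ht.1.ne') (hA.ne_zero t (Ioc_subset_Icc_self ht))
  constructor
  · intro h t ht
    have h1 := hasDerivWithinAt_volterra hα hT hK hw' ht
    have h2 := (hasDerivWithinAt_regRhs hα hT hK hf hx ht).congr h (h t ht)
    have h3 := (uniqueDiffOn_Ioc 0 T t ht).eq_deriv _ h1 h2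
    rw [volterraDeriv_pow_mul hA ht] at h3
    rw [eq_div_iff (hne t ht), mul_comm, h3]
  · intro h t ht
    rw [volterra_eq_integral hα hT hK hw' ht, regRhs_eq_integral hα hT hK hf hf0 hx ht]
    refine intervalIntegral.integral_congr_Ioo_of_le ht.1.le fun s hs => ?_
    have hs' : s ∈ Ioc 0 T := ⟨hs.1, hs.2.le.trans ht.2⟩
    rw [volterraDeriv_pow_mul hA hs', h s hs', mul_div_cancel₀ _ (hne s hs')]

theorem isSolution_ansatz_iff (hα : IsNodes n α) (hT : 0 < T) (hK : KernelRegular n α K K' T)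
    (y : ℕ → ℝ[X]) (hw : ContinuousOn w (Icc 0 T)) :
    IsSolution n α K f T (ansatz N y w) ↔
      ∀ t ∈ Ioc 0 T, volterra n α K (fun s => s ^ N * w s) t = regRhs n α K f (logPoly N y) t := by
  have hw' : MildSingular T fun s => s ^ N * w s :=
    mildSingular_of_continuousOn hT ((continuousOn_pow N).mul hw)
  have hy := mildSingular_logPoly T N y
  have h1 : ∀ t ∈ Ioc 0 T, volterra n α K (ansatz N y w) t =
      volterra n α K (logPoly N y) t + volterra n α K (fun s => s ^ N * w s) t :=
    fun t ht => volterra_add hα hT hK hy hw' ht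
  constructor
  · intro h t ht
    have := h.equation t ht
    rw [h1 t ht] at this
    rw [regRhs]; linarith
  · intro h
    refine ⟨(hy.add hw').continuousOn,
      fun t ht => intervalIntegrable_kernel hα hT hK (hy.add hw') ht, fun t ht => ?_⟩
    rw [h1 t ht, h t ht, regRhs]; ring

/-- The right-hand side of the differentiated regularized equation. -/
noncomputable def regTarget (n : ℕ) (α : ℕ → ℝ) (K K' : ℕ → ℝ → ℝ → ℝ) (f : ℝ → ℝ) (T : ℝ) (N : ℕ)
    (x : ℝ → ℝ) (t : ℝ) : ℝ :=
  if t = 0 then 0 else regRhsDeriv n α K K' f T x t / (t ^ N * K n t t)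

theorem regTarget_of_mem {x : ℝ → ℝ} {t : ℝ} (ht : t ∈ Ioc 0 T) :
    regTarget n α K K' f T N x t = regRhsDeriv n α K K' f T x t / (t ^ N * K n t t) :=
  if_neg ht.1.ne'

theorem continuousOn_regTarget (hα : IsNodes n α) (hT : 0 < T) (hK : KernelRegular n α K K' T)
    (hA : DiagBound n α K T N q) (hf : ContDiffOn ℝ 1 f (Icc 0 T)) {x : ℝ → ℝ}
    (hx : MildSingular T x)
    (ho : regRhsDeriv n α K K' f T x =o[𝓝[>] 0] fun t : ℝ => t ^ N) :
    ContinuousOn (regTarget n α K K' f T N x) (Icc 0 T) := by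
  have hIoc : ContinuousOn (regTarget n α K K' f T N x) (Ioc 0 T) := by
    refine ContinuousOn.congr (f := fun t => regRhsDeriv n α K K' f T x t / (t ^ N * K n t t)) ?_
      fun t ht => regTarget_of_mem ht
    refine (continuousOn_regRhsDeriv hα hT hK hf hx).div ((continuousOn_pow N).mul
      ((continuousOn_diag hα hK).mono Ioc_subset_Icc_self)) fun t ht =>
      mul_ne_zero (pow_ne_zero _ ht.1.ne') (hA.ne_zero t (Ioc_subset_Icc_self ht))
  have h0 : (0 : ℝ) ∈ Icc 0 T := left_mem_Icc.2 hT.le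
  intro t ht
  rcases ht.1.eq_or_lt with rfl | ht0
  · have h1 : Tendsto (fun t => regRhsDeriv n α K K' f T x t / t ^ N * (K n t t)⁻¹) (𝓝[>] 0)
        (𝓝 (0 * (K n 0 0)⁻¹)) := by
      refine ho.tendsto_div_nhds_zero.mul (Tendsto.inv₀ ?_ (hA.ne_zero 0 h0))
      exact ((continuousOn_diag hα hK) 0 h0).mono_left (nhdsWithin_le_of_mem (Icc_mem_nhdsGT hT))
    rw [zero_mul] at h1
    have h2 : ContinuousWithinAt (regTarget n α K K' f T N x) (Ioi 0) 0 := by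
      rw [ContinuousWithinAt, regTarget, if_pos rfl]
      refine h1.congr' ?_
      filter_upwards [Ioo_mem_nhdsGT hT] with t ht
      rw [regTarget_of_mem (Ioo_subset_Ioc_self ht), div_mul_eq_div_div, div_eq_mul_inv _ (K n t t)]
    refine (continuousWithinAt_insert_self.2 h2).mono fun s hs => ?_
    rcases hs.1.eq_or_lt with h | h
    · exact Or.inl h.symm
    · exact Or.inr h
  · refine (hIoc t ⟨ht0, ht.2⟩).mono_of_mem_nhdsWithin ?_
    filter_upwards [self_mem_nhdsWithin, mem_nhdsWithin_of_mem_nhds (Ioi_mem_nhds ht0)]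
      with s hs hs0 using ⟨hs0, hs.2⟩

theorem opV_zero : opV n α K K' N u 0 = 0 := by simp [opV]

/-- At `t = 0` the equation reduces to `u 0 * L(N) / K_n(0,0) = 0`, and `L(N) ≠ 0` by Condition A.
-/
theorem exists_regular_part (hα : IsNodes n α) (hT : 0 < T) (hK : KernelRegular n α K K' T)
    (hA : DiagBound n α K T N q) (hf : ContDiffOn ℝ 1 f (Icc 0 T)) {x : ℝ → ℝ}
    (hx : MildSingular T x)
    (ho : regRhsDeriv n α K K' f T x =o[𝓝[>] 0] fun t : ℝ => t ^ N) :
    ∃ u, ContinuousOn u (Icc 0 T) ∧ u 0 = 0 ∧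
      ∀ t ∈ Icc 0 T, opL n α K N u t + opV n α K K' N u t = regTarget n α K K' f T N x t := by
  obtain ⟨u, hu, h⟩ := exists_opL_add_opV_eq hα hT hK hA (K' := K')
    (continuousOn_regTarget hα hT hK hA hf hx ho)
  refine ⟨u, hu, ?_, h⟩
  have h0 := left_mem_Icc.2 hT.le
  have h1 := h 0 h0
  rw [opV_zero, add_zero, opL_zero, regTarget, if_pos rfl, div_eq_zero_iff] at h1
  rcases h1 with h1 | h1
  · exact (mul_eq_zero.1 h1).resolve_right (charL_ne_zero hα hT hA le_rfl)
  · exact absurd h1 (hA.ne_zero 0 h0)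

/-- Here `g'` is `t ^ N` times the continuous function `K_n (L w + V w)`, which vanishes at zero
because `w 0 = 0`. This is what subjects the polynomials of an arbitrary solution to the formal
equations. -/
theorem regRhsDeriv_isLittleO_of_solution (hα : IsNodes n α) (hT : 0 < T)
    (hK : KernelRegular n α K K' T) (hA : DiagBound n α K T N q) (hw : ContinuousOn w (Icc 0 T))
    (hw0 : w 0 = 0) {x : ℝ → ℝ}
    (h : ∀ t ∈ Ioc 0 T, opL n α K N w t + opV n α K K' N w t =
      regRhsDeriv n α K K' f T x t / (t ^ N * K n t t)) :
    regRhsDeriv n α K K' f T x =o[𝓝[>] 0] fun t : ℝ => t ^ N := by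
  have h0 : (0 : ℝ) ∈ Icc 0 T := left_mem_Icc.2 hT.le
  have hc : ContinuousOn (fun t => K n t t * (opL n α K N w t + opV n α K K' N w t)) (Icc 0 T) :=
    (continuousOn_diag hα hK).mul
      ((continuousOn_opL hα hK hA hw).add (continuousOn_opV hα hT hK hA hw))
  have h1 : Tendsto (fun t => K n t t * (opL n α K N w t + opV n α K K' N w t)) (𝓝[>] 0) (𝓝 0) := by
    have := (hc 0 h0).mono_left (nhdsWithin_le_of_mem (Icc_mem_nhdsGT hT))
    simpa [opV_zero, opL_zero, hw0] using this
  refine ((isBigO_refl (fun t : ℝ => t ^ N) (𝓝[>] 0)).mul_isLittleO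
    ((isLittleO_one_iff ℝ).2 h1)).congr' ?_ (Eventually.of_forall fun t => mul_one _)
  filter_upwards [Ioo_mem_nhdsGT hT] with t ht
  have ht' := Ioo_subset_Ioc_self ht
  rw [h t ht', ← mul_assoc, mul_div_cancel₀]
  exact mul_ne_zero (pow_ne_zero _ ht.1.ne') (hA.ne_zero t (Ioc_subset_Icc_self ht'))

end Regularized

/-! ### Solving the formal equations and counting the constants -/

section Formal

/-- The formal equations for the coefficients of the logarithmic-power sum. -/
theorem isLittleO_iff_formal {n N : ℕ} {α : ℕ → ℝ} {K K' : ℕ → ℝ → ℝ → ℝ} {T : ℝ} {f : ℝ → ℝ}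
    {d : ℕ → ℝ}
    (hd : (fun t => derivWithin f (Icc 0 T) t - ∑ l ∈ Finset.range (N + 1), d l * t ^ l)
      =o[𝓝[>] 0] fun t : ℝ => t ^ N) {y G : ℕ → ℝ[X]}
    (hG : (fun t => volterraDeriv n α K K' (logPoly N y) t - logPoly N G t)
      =o[𝓝[>] 0] fun t : ℝ => t ^ N) :
    (regRhsDeriv n α K K' f T (logPoly N y) =o[𝓝[>] 0] fun t : ℝ => t ^ N) ↔
      ∀ j ≤ N, G j = C (d j) := by
  have hdl : ∀ t, logPoly N (fun j => C (d j)) t = ∑ l ∈ Finset.range (N + 1), d l * t ^ l :=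
    fun t => by simp [logPoly]
  constructor
  · intro h j hj
    have h1 : logPoly N (fun j => G j - C (d j)) =o[𝓝[>] 0] fun t : ℝ => t ^ N := by
      refine ((hd.sub hG).sub h).congr_left fun t => ?_
      rw [logPoly_sub, hdl, regRhsDeriv]; ring
    exact sub_eq_zero.1 (eq_zero_of_logPoly_isLittleO h1 j hj)
  · intro h
    refine (hd.sub hG).congr_left fun t => ?_
    have : logPoly N G t = ∑ l ∈ Finset.range (N + 1), d l * t ^ l := by
      rw [← hdl, logPoly, logPoly]
      refine Finset.sum_congr rfl fun j hj => ?_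
      rw [h j (Nat.lt_succ_iff.1 (Finset.mem_range.1 hj))]
    rw [this, regRhsDeriv]; ring

theorem exists_strong_recursion {β : Type} (S : ∀ j : ℕ, (∀ i < j, β) → β) :
    ∃ x : ℕ → β, ∀ j, x j = S j fun i _ => x i :=
  ⟨WellFounded.fix Nat.lt_wfRel.wf S, fun _ => WellFounded.fix_eq _ _ _⟩

/-- The formal equations are solvable, and the solution is determined by its lowest
coefficients. -/
theorem exists_formal_solution {n : ℕ} {α : ℕ → ℝ} {K : ℕ → ℝ → ℝ → ℝ} {R : ℕ → ℕ}
    (hR : ∀ j, (∀ l < R j, moment n α K j l = 0) ∧ moment n α K j (R j) ≠ 0) (d : ℕ → ℝ)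
    (e : ℕ → ℝ[X] → ℕ → ℝ[X]) (c : ℕ → ℕ → ℝ) :
    ∃ x : ℕ → ℝ[X],
      (∀ j, diffOp n α K j (x j) + ∑ i ∈ Finset.range j, e i (x i) j = C (d j)) ∧
      (∀ j, ∀ i < R j, (x j).coeff i = c j i) ∧
      ∀ (N : ℕ) (y : ℕ → ℝ[X]),
        (∀ j ≤ N, diffOp n α K j (y j) + ∑ i ∈ Finset.range j, e i (y i) j = C (d j)) →
        (∀ j ≤ N, ∀ i < R j, (y j).coeff i = c j i) → ∀ j ≤ N, y j = x j := by
  choose Sol hSol hUniq using fun j q => diffOp_existsUnique (hR j).1 (hR j).2 q (c j)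
  -- The equation of order `j` has a right-hand side depending on earlier polynomials only, so it
  -- fixes `x j` once its `R j` lowest coefficients are given.
  obtain ⟨x, hx⟩ := exists_strong_recursion fun j prev =>
    Sol j (C (d j) - ∑ i : Fin j, e i (prev i i.2) j)
  have hx' : ∀ j, x j = Sol j (C (d j) - ∑ i ∈ Finset.range j, e i (x i) j) := fun j => by
    rw [hx j, ← Fin.sum_univ_eq_sum_range (fun i => e i (x i) j)]
  refine ⟨x, fun j => ?_, fun j i hi => ?_, fun N y hy hc j => ?_⟩
  · have := (hSol j (C (d j) - ∑ i ∈ Finset.range j, e i (x i) j)).1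
    rw [← hx' j] at this
    rw [this, sub_add_cancel]
  · rw [hx' j]
    exact (hSol j _).2 i hi
  · induction j using Nat.strong_induction_on with
    | _ j ih =>
      intro hj
      rw [hx' j]
      refine hUniq j _ _ ⟨?_, hc j hj⟩
      have h1 : ∑ i ∈ Finset.range j, e i (x i) j = ∑ i ∈ Finset.range j, e i (y i) j :=
        Finset.sum_congr rfl fun i hi => by
          rw [Finset.mem_range] at hi
          rw [ih i hi (hi.le.trans hj)]
      rw [h1, ← hy j hj, add_sub_cancel_right]

/-- The vector of arbitrary constants, arranged by exponents and powers of the logarithm. -/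
theorem exists_constants {k : ℕ} {j : Fin k → ℕ} (hj : Function.Injective j) (r : Fin k → ℕ)
    (C : Fin (∑ m, r m) → ℝ) :
    ∃ c : ℕ → ℕ → ℝ, ∀ m, ∀ i : Fin (r m), c (j m) i = C (finSigmaFinEquiv ⟨m, i⟩) := by
  classical
  -- Injectivity of `j` makes the chosen index unique; positions carrying no constant get the value
  -- zero.
  refine ⟨fun l i => if h : ∃ p : (m : Fin k) × Fin (r m), j p.1 = l ∧ (p.2 : ℕ) = i then
    C (finSigmaFinEquiv h.choose) else 0, fun m i => ?_⟩
  have h : ∃ p : (m : Fin k) × Fin (r m), j p.1 = j m ∧ (p.2 : ℕ) = i := ⟨⟨m, i⟩, rfl, rfl⟩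
  simp only [dif_pos h]
  have h1 := h.choose_spec
  generalize h.choose = p at h1 ⊢
  obtain ⟨m', i'⟩ := p
  obtain ⟨h2, h3⟩ := h1
  obtain rfl : m' = m := hj h2
  obtain rfl : i' = i := Fin.ext h3
  rfl

/-- Extends the multiplicities to all exponents, so that roots and non-roots are treated alike.
Where `L(l) ≠ 0` the moment of index `0` is already nonzero and there is no freedom. -/
theorem exists_multiplicity {n k : ℕ} {α : ℕ → ℝ} {K : ℕ → ℝ → ℝ → ℝ} (hα : IsNodes n α)
    {j : Fin k → ℕ} (hj : Function.Injective j)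
    (hroots : ∀ l : ℕ, charL n α K l = 0 ↔ ∃ m, j m = l) {r : Fin k → ℕ}
    (hr : ∀ m, analyticOrderAt (auxP n α K (j m)) 1 = (r m : ℕ∞)) :
    ∃ R : ℕ → ℕ, (∀ l, (∀ i < R l, moment n α K l i = 0) ∧ moment n α K l (R l) ≠ 0) ∧
      (∀ m, R (j m) = r m) ∧ ∀ l, charL n α K l ≠ 0 → R l = 0 := by
  have h : ∀ l, ∃ ρ : ℕ, ((∀ i < ρ, moment n α K l i = 0) ∧ moment n α K l ρ ≠ 0) ∧
      (∀ m, j m = l → ρ = r m) ∧ (charL n α K l ≠ 0 → ρ = 0) := by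
    intro l
    by_cases hl : charL n α K l = 0
    · obtain ⟨m, rfl⟩ := (hroots l).1 hl
      refine ⟨r m, moment_of_analyticOrderAt hα.ne_zero hα.zero hα.last (hr m), fun m' h => ?_,
        fun h => absurd hl h⟩
      rw [hj h]
    · refine ⟨0, ⟨fun i hi => absurd hi (Nat.not_lt_zero i), by rwa [moment_zero]⟩,
        fun m h => absurd ((hroots l).2 ⟨m, h⟩) hl, fun _ => rfl⟩
  choose R h1 h2 h3 using h
  exact ⟨R, h1, fun m => h2 _ m rfl, h3⟩

theorem diffOp_C (n : ℕ) (α : ℕ → ℝ) (K : ℕ → ℝ → ℝ → ℝ) (j : ℕ) (a : ℝ) :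
    diffOp n α K j (C a) = C (charL n α K j * a) := by
  have h : diffOp n α K j (X ^ 0) = C (charL n α K j) := by
    ext i
    rw [coeff_diffOp_X_pow, coeff_C]
    rcases i with _ | i
    · simp [moment_zero]
    · simp
  have h2 : (C a : ℝ[X]) = a • X ^ 0 := by rw [pow_zero, smul_eq_C_mul, mul_one]
  rw [h2, map_smul, h, smul_C, smul_eq_mul, mul_comm]

/-- Positive powers of `t` absorb the logarithms, so only `x 0` could obstruct a limit. For `N = 0`
the hypothesis `u 0 = 0` disposes of the remainder. -/
theorem tendsto_ansatz {N : ℕ} {x : ℕ → ℝ[X]} {a T : ℝ} (hT : 0 < T) (hx : x 0 = C a) {u : ℝ → ℝ}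
    (hu : ContinuousOn u (Icc 0 T)) (hu0 : u 0 = 0) :
    Tendsto (ansatz N x u) (𝓝[>] 0) (𝓝 a) := by
  have h1 : Tendsto (fun t => ∑ i ∈ Finset.range N, (x (i + 1)).eval (Real.log t) * t ^ (i + 1))
      (𝓝[>] 0) (𝓝 0) := by
    rw [← Finset.sum_const_zero (s := Finset.range N)]
    refine tendsto_finsetSum _ fun i _ => ?_
    have := pow_mul_eval_log_isLittleO (x (i + 1)) (Nat.succ_pos i)
    simpa [mul_comm] using this.tendsto_div_nhds_zero
  have h2 : Tendsto (fun t : ℝ => t ^ N * u t) (𝓝[>] 0) (𝓝 (0 ^ N * u 0)) :=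
    (((continuous_pow N).tendsto 0).mono_left nhdsWithin_le_nhds).mul
      ((hu 0 (left_mem_Icc.2 hT.le)).mono_left (nhdsWithin_le_of_mem (Icc_mem_nhdsGT hT)))
  rw [hu0, mul_zero] at h2
  have h3 := (h1.add_const a).add h2
  rw [zero_add, add_zero] at h3
  refine h3.congr fun t => ?_
  rw [ansatz, logPoly, Finset.sum_range_succ', hx]
  simp

end Formal

end VolterraDisc

/-! ### The main theorem -/

open VolterraDisc
theorem theorem3 (n N : ℕ) (T : ℝ) (hT : 0 < T)
    (α : ℕ → ℝ) (hα0 : α 0 = 0) (hαn : α n = 1) (hα : ∀ i < n, α i < α (i + 1))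
    (K K' : ℕ → ℝ → ℝ → ℝ) (f : ℝ → ℝ)
    (hK : KernelRegular n α K K' T)
    (hf : ContDiffOn ℝ 1 f (Icc 0 T)) (hf0 : f 0 = 0)
    (hA : ConditionA n α K T N) (hB : ConditionB n α K f T N)
    (k : ℕ) (j : Fin k → ℕ) (hj : Function.Injective j)
    (hroots : ∀ l : ℕ, charL n α K l = 0 ↔ ∃ m, j m = l)
    (r : Fin k → ℕ) (hr : ∀ m, analyticOrderAt (auxP n α K (j m)) 1 = (r m : ℕ∞)) :
    ∃ (x : (Fin (∑ m, r m) → ℝ) → ℕ → ℝ[X]) (u : (Fin (∑ m, r m) → ℝ) → ℝ → ℝ),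
      -- the arbitrary constants are the `r m` lowest coefficients of the polynomials `x_{j m}`
      (∀ C, ∀ m, ∀ i : Fin (r m),
        (x C (j m)).coeff i = C (finSigmaFinEquiv ⟨m, i⟩)) ∧
      -- for all values of the constants there is a solution of the required form
      (∀ C, ContinuousOn (u C) (Icc 0 T) ∧ u C 0 = 0 ∧
        IsSolution n α K f T (ansatz N (x C) (u C))) ∧
      -- different values give different solutions
      (∀ C C', EqOn (ansatz N (x C) (u C)) (ansatz N (x C') (u C')) (Ioc 0 T) → C = C') ∧
      -- there are no other solutions of this form
      (∀ (y : ℕ → ℝ[X]) (w : ℝ → ℝ), ContinuousOn w (Icc 0 T) → w 0 = 0 →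
        IsSolution n α K f T (ansatz N y w) →
        ∃ C, (∀ i ≤ N, y i = x C i) ∧ EqOn w (u C) (Icc 0 T)) ∧
      -- if zero is not a root, the solutions have a finite limit at zero
      (charL n α K 0 ≠ 0 → ∀ C, ∃ l : ℝ, Tendsto (ansatz N (x C) (u C)) (𝓝[>] 0) (𝓝 l)) ∧
      -- `u` is the only continuous solution of the regularized equation
      (∀ C, (∀ t ∈ Ioc 0 T, volterra n α K (fun s => s ^ N * u C s) t =
          regRhs n α K f (logPoly N (x C)) t) ∧
        ∀ w : ℝ → ℝ, ContinuousOn w (Icc 0 T) →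
          (∀ t ∈ Ioc 0 T, volterra n α K (fun s => s ^ N * w s) t =
            regRhs n α K f (logPoly N (x C)) t) →
          EqOn w (u C) (Icc 0 T)) ∧
      -- the sum is an asymptotic approximation, and the successive approximations exist, are
      -- uniquely determined by the initial function, and converge to `u` uniformly on `[0,T]`
      (∀ C, ∃ g' : ℝ → ℝ,
        (∀ t ∈ Ioc 0 T,
          HasDerivWithinAt (regRhs n α K f (logPoly N (x C))) (g' t) (Ioc 0 T) t) ∧
        g' =o[𝓝[>] 0] (fun t => t ^ N) ∧
        ∀ v₀ : ℝ → ℝ, ContinuousOn v₀ (Icc 0 T) →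
          ∃ v : ℕ → ℝ → ℝ, v 0 = v₀ ∧ IsSuccApprox n α K K' T N g' v ∧
            (∀ v' : ℕ → ℝ → ℝ, v' 0 = v₀ → IsSuccApprox n α K K' T N g' v' →
              ∀ m, EqOn (v' m) (v m) (Icc 0 T)) ∧
            TendstoUniformlyOn v (u C) atTop (Icc 0 T)) := by
  have hN : IsNodes n α := ⟨hα0, hαn, hα⟩
  obtain ⟨q, hq⟩ := hA.exists_diagBound
  obtain ⟨δ, hδ, hδT, hBf, hBK⟩ := hB
  obtain ⟨d, hd⟩ := exists_deriv_expansion hδ hδT hf hBf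
  obtain ⟨e, he⟩ := exists_formal_expansion hN hK hδ hδT hBK
  obtain ⟨R, hR, hRj, hR0⟩ := exists_multiplicity hN hj hroots hr
  -- All roots lie in the range of the ansatz, so every constant can be read off from the solution.
  have hjN : ∀ m, j m ≤ N := fun m => by
    by_contra! h
    exact charL_ne_zero hN hT hq h.le ((hroots (j m)).2 ⟨m, rfl⟩)
  choose c hc using exists_constants hj r
  choose x hx hxc hxu using fun C => exists_formal_solution hR d e (c C)
  have hiff : ∀ y : ℕ → ℝ[X],
      (regRhsDeriv n α K K' f T (logPoly N y) =o[𝓝[>] 0] fun t : ℝ => t ^ N) ↔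
        ∀ j ≤ N, diffOp n α K j (y j) + ∑ i ∈ Finset.range j, e i (y i) j = Polynomial.C (d j) :=
    fun y => isLittleO_iff_formal hd (he y)
  have hxo : ∀ C, regRhsDeriv n α K K' f T (logPoly N (x C)) =o[𝓝[>] 0] fun t : ℝ => t ^ N :=
    fun C => (hiff _).2 fun j _ => hx C j
  have hms : ∀ y, MildSingular T (logPoly N y) := mildSingular_logPoly T N
  choose u hu hu0 hueq using fun C => exists_regular_part hN hT hK hq hf (hms (x C)) (hxo C)
  have hxcoeff : ∀ C, ∀ m, ∀ i : Fin (r m),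
      (x C (j m)).coeff i = C (finSigmaFinEquiv ⟨m, i⟩) := fun C m i => by
    rw [hxc C (j m) i (by rw [hRj]; exact i.2), hc]
  have hreg : ∀ C, ∀ t ∈ Ioc 0 T, volterra n α K (fun s => s ^ N * u C s) t =
      regRhs n α K f (logPoly N (x C)) t := fun C =>
    (regularized_iff hN hT hK hq hf hf0 (hms (x C)) (hu C)).2 fun t ht => by
      rw [hueq C t (Ioc_subset_Icc_self ht), regTarget_of_mem ht]
  have hregu : ∀ C, ∀ w : ℝ → ℝ, ContinuousOn w (Icc 0 T) →
      (∀ t ∈ Ioc 0 T, volterra n α K (fun s => s ^ N * w s) t =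
        regRhs n α K f (logPoly N (x C)) t) → EqOn w (u C) (Icc 0 T) := fun C w hw h => by
    have h1 := (regularized_iff hN hT hK hq hf hf0 (hms (x C)) hw).1 h
    refine eqOn_of_opL_add_opV_eq hN hT hK hq hw (hu C) ?_
    refine eqOn_Icc_of_eqOn_Ioc hT
      ((continuousOn_opL hN hK hq hw).add (continuousOn_opV hN hT hK hq hw))
      ((continuousOn_opL hN hK hq (hu C)).add (continuousOn_opV hN hT hK hq (hu C)))
      fun t ht => ?_
    rw [h1 t ht, hueq C t (Ioc_subset_Icc_self ht),
      regTarget_of_mem ht]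
  refine ⟨x, u, hxcoeff, fun C => ⟨hu C, hu0 C, ?_⟩, fun C C' h => ?_, fun y w hw hw0 hsol => ?_,
    fun h0 C => ?_, fun C => ⟨hreg C, hregu C⟩, fun C => ?_⟩
  · exact (isSolution_ansatz_iff hN hT hK (x C) (hu C)).2 (hreg C)
  -- If two ansätze agree, their polynomial parts differ by `t ^ N * (u C' - u C) = o(t ^ N)`, so
  -- all coefficients up to order `N` coincide.
  · have h1 : logPoly N (fun i => x C i - x C' i) =o[𝓝[>] 0] fun t : ℝ => t ^ N := by
      have h2 : Tendsto (fun t => u C' t - u C t) (𝓝[>] 0) (𝓝 0) := by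
        have := (((hu C').sub (hu C)) 0 (left_mem_Icc.2 hT.le)).mono_left
          (nhdsWithin_le_of_mem (Icc_mem_nhdsGT hT))
        simpa [hu0, Pi.sub_def] using this
      refine ((isBigO_refl (fun t : ℝ => t ^ N) (𝓝[>] 0)).mul_isLittleO
        ((isLittleO_one_iff ℝ).2 h2)).congr' ?_ (Eventually.of_forall fun t => mul_one _)
      filter_upwards [Ioo_mem_nhdsGT hT] with t ht
      have := h (Ioo_subset_Ioc_self ht)
      simp only [ansatz] at this
      rw [logPoly_sub]
      linarith
    have h3 := eq_zero_of_logPoly_isLittleO h1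
    funext idx
    obtain ⟨⟨m, i⟩, rfl⟩ := finSigmaFinEquiv.surjective idx
    rw [← hxcoeff C, ← hxcoeff C', sub_eq_zero.1 (h3 (j m) (hjN m))]
  · have h1 := (isSolution_ansatz_iff hN hT hK y hw).1 hsol
    have h2 := (regularized_iff hN hT hK hq hf hf0 (hms y) hw).1 h1
    have h3 := (hiff y).1 (regRhsDeriv_isLittleO_of_solution hN hT hK hq hw hw0 h2)
    -- The constants are read off from the given solution; uniqueness of the formal solution then
    -- identifies all its polynomials.
    let C : Fin (∑ m, r m) → ℝ := fun idx =>
      (y (j (finSigmaFinEquiv.symm idx).1)).coeff (finSigmaFinEquiv.symm idx).2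
    have hC : ∀ p, C (finSigmaFinEquiv p) = (y (j p.1)).coeff p.2 := fun p => by
      simp only [C]
      rw [Equiv.symm_apply_apply]
    have h4 : ∀ i ≤ N, y i = x C i := by
      refine hxu C N y h3 fun l _ i hi => ?_
      have hl : charL n α K l = 0 := by
        by_contra hl
        rw [hR0 l hl] at hi
        exact Nat.not_lt_zero i hi
      obtain ⟨m, rfl⟩ := (hroots l).1 hl
      rw [hRj] at hi
      rw [hc C m ⟨i, hi⟩]
      exact (hC ⟨m, ⟨i, hi⟩⟩).symm
    have h5 : logPoly N y = logPoly N (x C) := by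
      ext t
      refine Finset.sum_congr rfl fun i hi => ?_
      rw [h4 i (Nat.lt_succ_iff.1 (Finset.mem_range.1 hi))]
    exact ⟨C, h4, hregu C w hw (h5 ▸ h1)⟩
  -- On constants `diffOp 0` is multiplication by `L(0)`, so this constant solves the equation of
  -- order zero; uniqueness, used with `N = 0`, identifies it with `x C 0`.
  · refine ⟨d 0 / charL n α K 0, tendsto_ansatz hT ?_ (hu C) (hu0 C)⟩
    refine (hxu C 0 (fun _ => Polynomial.C (d 0 / charL n α K 0)) ?_ ?_ 0 le_rfl).symm
    · intro l hl
      obtain rfl := Nat.le_zero.1 hl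
      rw [diffOp_C, mul_div_cancel₀ _ h0, Finset.range_zero, Finset.sum_empty, add_zero]
    · intro l hl i hi
      obtain rfl := Nat.le_zero.1 hl
      rw [hR0 0 h0] at hi
      exact absurd hi (Nat.not_lt_zero i)
  · exact ⟨regRhsDeriv n α K K' f T (logPoly N (x C)),
      fun t ht => hasDerivWithinAt_regRhs hN hT hK hf (hms (x C)) ht, hxo C, fun v₀ hv₀ =>
      exists_succApprox hN hT hK hq (continuousOn_regTarget hN hT hK hq hf (hms (x C)) (hxo C))
        (fun t ht => regTarget_of_mem ht) (hu C) (hueq C) hv₀⟩
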